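/- An arithmetic circuit over $\mathbb{Z}$ in the variables $x_1,\dots,x_n$ is a nonempty sequence of gates, each of which is an integer constant, a variable, or the sum or the product of two earlier gates; it computes the polynomial at its last gate. There is a randomized algorithm which, given an arithmetic circuit $C$ computing a polynomial $f\in\mathbb{Z}[x_1,\dots,x_n]$ and integers $e_1,\dots,e_n\ge 0$ (all integers in the input being written in binary), decides with error probability at most $1/3$ whether $f\notin\langle x_1^{e_1},x_2^{e_2},\dots,x_n^{e_n}\rangle$: it accepts with probability at least $2/3$ if $f$ is not in this ideal of $\mathbb{Z}[x_1,\dots,x_n]$, and with probability at most $1/3$ if it is. Let $k$ be the total degree of $f$ ($k=0$ if $f=0$), which need not be given to the algorithm, and let $N$ be the length of the input in bits. Then, for all outcomes of the coin tosses, the algorithm halts within time $O^*(4.08^k)$, that is, $4.08^k\cdot N^{O(1)}$, and uses space polynomial in $N$ and $k$ (in bits). Time and space are measured on a random access machine with logarithmic cost that can toss fair coins. -/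

import Mathlib

open MeasureTheory
open scoped ENNReal

noncomputable section

/-! ### Arithmetic circuits over the integers -/

/-- A gate with inputs `x_0, …, x_{n-1}`, placed after `s` earlier gates: an integer constant,
a variable, or the sum or product of the values of two earlier gates. -/
inductive Gate (n s : ℕ) : Type
  | const (c : ℤ)
  | var (i : Fin n)
  | add (i j : Fin s)
  | mul (i j : Fin s)

/-- An arithmetic circuit over `ℤ` in `n` variables with `s` gates, listed in topological order. -/
inductive Circuit (n : ℕ) : ℕ → Type
  | nil : Circuit n 0
  | snoc {s : ℕ} (C : Circuit n s) (g : Gate n s) : Circuit n (s + 1)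

/-- The polynomial at a gate, given the polynomials at all earlier gates. -/
def Gate.eval {n s : ℕ} (v : Fin s → MvPolynomial (Fin n) ℤ) :
    Gate n s → MvPolynomial (Fin n) ℤ
  | .const c => MvPolynomial.C c
  | .var i => MvPolynomial.X i
  | .add i j => v i + v j
  | .mul i j => v i * v j

/-- The polynomials computed at all the gates of a circuit. -/
def Circuit.eval {n : ℕ} : {s : ℕ} → Circuit n s → Fin s → MvPolynomial (Fin n) ℤ
  | _, .nil => Fin.elim0
  | _, .snoc C g => Fin.snoc (α := fun _ => MvPolynomial (Fin n) ℤ) C.eval (g.eval C.eval)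

/-- The polynomial computed by a circuit with at least one gate: the one at its last gate. -/
def Circuit.poly {n s : ℕ} (C : Circuit n (s + 1)) : MvPolynomial (Fin n) ℤ :=
  C.eval (Fin.last s)

/-- Description of a gate by three numbers: a tag and two operands. A constant is described by its
sign (in the tag) and its absolute value. -/
def Gate.encode {n s : ℕ} : Gate n s → List ℕ
  | .const c => if 0 ≤ c then [0, c.natAbs, 0] else [1, c.natAbs, 0]
  | .var i => [2, i, 0]
  | .add i j => [3, i, j]
  | .mul i j => [4, i, j]

def Circuit.encode {n : ℕ} : {s : ℕ} → Circuit n s → List ℕ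
  | _, .nil => []
  | _, .snoc C g => C.encode ++ g.encode

/-- The input of the membership problem as a list of numbers: the number of variables, the number
of gates, the exponents, and the gates. -/
def encodeInput {n s : ℕ} (C : Circuit n s) (e : Fin n → ℕ) : List ℕ :=
  n :: s :: (List.ofFn e ++ C.encode)

/-- Length in bits of a list of numbers written in binary, with one separator per number. -/
def bitLength (w : List ℕ) : ℕ := (w.map fun x => Nat.size x + 1).sum

/-! ### Random access machines with logarithmic cost and fair coins -/

namespace RAM

/-- Arithmetic operations on natural numbers. Subtraction is truncated at `0`, `div` and `mod` are
quotient and remainder, and division by `0` yields quotient `0` and leaves the dividend as the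
remainder. -/
inductive Op : Type
  | add | sub | mul | div | mod

def Op.eval : Op → ℕ → ℕ → ℕ
  | .add, x, y => x + y
  | .sub, x, y => x - y
  | .mul, x, y => x * y
  | .div, x, y => x / y
  | .mod, x, y => x % y

/-- Expressions: literals, memory access (with computed address) and arithmetic operations. -/
inductive Exp : Type
  | lit (c : ℕ)
  | mem (a : Exp)
  | bin (o : Op) (a b : Exp)

/-- The memory has one cell for each natural number; every cell holds a natural number, and only
finitely many cells are nonzero. -/
abbrev Mem : Type := ℕ →₀ ℕ

def Exp.eval (m : Mem) : Exp → ℕ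
  | .lit c => c
  | .mem a => m (a.eval m)
  | .bin o a b => o.eval (a.eval m) (b.eval m)

/-- Logarithmic cost of an evaluation: a literal costs its bit length, a memory access the bit
length of the value read (the address has been paid for when it was computed), an operation the
product of the bit lengths of the operands (as in schoolbook arithmetic). -/
def Exp.cost (m : Mem) : Exp → ℕ
  | .lit c => Nat.size c + 1
  | .mem a => a.cost m + Nat.size (m (a.eval m)) + 1
  | .bin _ a b =>
      a.cost m + b.cost m + (Nat.size (a.eval m) + 1) * (Nat.size (b.eval m) + 1)

/-- Programs: `assign a e` writes the value of `e` into the cell with address `a`, `flip a` writes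
a random bit there, `cond` and `loop` test whether the value of an expression is nonzero. -/
inductive Cmd : Type
  | assign (a e : Exp)
  | flip (a : Exp)
  | seq (p q : Cmd)
  | cond (e : Exp) (p q : Cmd)
  | loop (e : Exp) (p : Cmd)

/-- The number of bits needed to write down the addresses and the contents of all nonzero cells. -/
def memBits (m : Mem) : ℕ := m.sum fun a v => Nat.size a + Nat.size v

/-- State of a computation: the memory, the number of coins tossed so far, the time spent so far,
and the largest amount of space (in bits) used so far. -/
structure State : Type where
  mem : Mem
  coins : ℕ
  time : ℕ
  space : ℕ

/-- Spend `t` units of time; the evaluation that is paid for may occupy `t` bits of scratch space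
in addition to the memory. -/
def State.charge (s : State) (t : ℕ) : State :=
  { s with time := s.time + t, space := max s.space (memBits s.mem + t) }

/-- Write `v` into the cell with address `a`. -/
def State.write (s : State) (a v : ℕ) : State :=
  { s with mem := s.mem.update a v, space := max s.space (memBits (s.mem.update a v)) }

/-- `Exec ω p s s'`: with the outcomes `ω 0, ω 1, …` of the coin tosses, the program `p` started
in state `s` halts in state `s'`. There is no such `s'` if it does not halt. -/
inductive Exec (ω : ℕ → Bool) : Cmd → State → State → Prop
  | assign (a e : Exp) (s : State) :
      Exec ω (.assign a e) s
        ((s.charge (a.cost s.mem + e.cost s.mem + 1)).write (a.eval s.mem) (e.eval s.mem))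
  | flip (a : Exp) (s : State) :
      Exec ω (.flip a) s
        { (s.charge (a.cost s.mem + 1)).write (a.eval s.mem) (ω s.coins).toNat with
          coins := s.coins + 1 }
  | seq {p q : Cmd} {s s' s'' : State} :
      Exec ω p s s' → Exec ω q s' s'' → Exec ω (.seq p q) s s''
  | cond_true {e : Exp} {p q : Cmd} {s s' : State} : e.eval s.mem ≠ 0 →
      Exec ω p (s.charge (e.cost s.mem + 1)) s' → Exec ω (.cond e p q) s s'
  | cond_false {e : Exp} {p q : Cmd} {s s' : State} : e.eval s.mem = 0 →
      Exec ω q (s.charge (e.cost s.mem + 1)) s' → Exec ω (.cond e p q) s s'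
  | loop_true {e : Exp} {p : Cmd} {s s' s'' : State} : e.eval s.mem ≠ 0 →
      Exec ω p (s.charge (e.cost s.mem + 1)) s' → Exec ω (.loop e p) s' s'' →
      Exec ω (.loop e p) s s''
  | loop_false {e : Exp} {p : Cmd} {s : State} : e.eval s.mem = 0 →
      Exec ω (.loop e p) s (s.charge (e.cost s.mem + 1))

/-- A randomized algorithm: a program together with the address at which its input begins. The
cells below that address serve as registers. -/
structure Algorithm : Type where
  base : ℕ
  body : Cmd

/-- The memory that holds the list `w` from address `b` on, and is zero elsewhere. -/
def loadMem (b : ℕ) : List ℕ → Mem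
  | [] => 0
  | x :: w => (loadMem (b + 1) w).update b x

/-- The state in which the algorithm starts on the input `w`. -/
def Algorithm.init (A : Algorithm) (w : List ℕ) : State where
  mem := loadMem A.base w
  coins := 0
  time := 0
  space := memBits (loadMem A.base w)

/-- With coin tosses `ω`, the algorithm halts on the input `w` in state `s`. -/
def Algorithm.Halts (A : Algorithm) (w : List ℕ) (ω : ℕ → Bool) (s : State) : Prop :=
  Exec ω A.body (A.init w) s

/-- The algorithm accepts if it halts with a nonzero number in cell `0`. -/
def Algorithm.Accepts (A : Algorithm) (w : List ℕ) (ω : ℕ → Bool) : Prop :=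
  ∃ s : State, A.Halts w ω s ∧ s.mem 0 ≠ 0

/-- The distribution of an infinite sequence of independent fair coin tosses. -/
def coinMeasure : Measure (ℕ → Bool) :=
  Measure.infinitePi fun _ => (PMF.uniformOfFintype Bool).toMeasure

/-- The probability that the algorithm accepts the input `w`. -/
def Algorithm.acceptProb (A : Algorithm) (w : List ℕ) : ℝ≥0∞ :=
  coinMeasure {ω | A.Accepts w ω}

end RAM

end

namespace RAM

/-! ### Determinism -/

/-! The ideal is monomial, so `f` lies outside it iff some monomial `x^α` of `f` has `α i < e i` for
all `i`. The algorithm searches for such a monomial in degree `j = 0, 1, 2, …`, and after each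
degree it tests whether `f` has monomials of still larger degree.

Fix `j` and put `q = j / 2`, `M = j + q`. Replace `x_i` by a sum over `min (e i - 1) j` slots, each
with a random weight and a random one of `M` colours. Expanding a monomial of degree `j` chooses a
slot for each of its factors. If only the choices with pairwise distinct colours are kept, a
monomial with some `α i ≥ e i` disappears by the pigeonhole principle (`residue_eq_zero`), while a
monomial outside the ideal leaves a nonzero polynomial in the weights as soon as its own `j` slots
have distinct colours (`eval_residuePoly_indicator`). Random weights then detect it by
Schwartz–Zippel.

To keep only distinct colours, colours become signs: a weighted alternating sum over the points of
the cube `{0,1}^(3q+1)` with at most `q` ones annihilates every product of at most `j` signs, of the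
same parity as `j`, unless it consists of `j` distinct ones (`levelSum_prod_sign`). Evaluating at
opposite points scaled by `P`, modulo `P^(j+1)`, removes the degrees of the wrong parity and those
above `j` (`pow_dvd_mainSum_sub`). Random `P` also keeps numbers short: the integers involved are
doubly exponential, but few primes divide a given one.

Up to polynomial factors one trial visits `M.choose j` points and succeeds with probability
`M.descFactorial j / M^j`. Repeating it often enough costs `M^j / j! ≤ (3e/2)^j`, and `3e/2 < 4.08`
(`mainTrials_mul_choose_le`).

The degree test evaluates the `(j+1)`-st finite difference at `0` of `t ↦ f(tζ)`, which kills
exactly the degrees up to `j`. It never succeeds when `j` is the total degree `k`, so the algorithm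
stops by stage `k` for all coins. Elements of the ideal are never accepted. Another `f` is lost only
if a degree test stops too early (probability at most `1/4`) or all main trials at degree `|α|` fail
(at most `1/12`).

On the machine, everything happens in 64 registers with words of `W` bits, the gate values being
packed into a single register. `Ht` is a Hoare logic counting steps, and `Run.exec` converts steps
into logarithmic cost and space. -/

theorem Exec.deterministic {ω : ℕ → Bool} {p : Cmd} {s s₁ s₂ : State}
    (h₁ : Exec ω p s s₁) (h₂ : Exec ω p s s₂) : s₁ = s₂ := by
  induction h₁ generalizing s₂ with
  | assign a e s => cases h₂; rfl
  | flip a s => cases h₂; rfl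
  | seq _ _ ih₁ ih₂ =>
    cases h₂ with
    | seq k₁ k₂ => cases ih₁ k₁; exact ih₂ k₂
  | cond_true h _ ih =>
    cases h₂ with
    | cond_true _ k => exact ih k
    | cond_false k _ => exact absurd k h
  | cond_false h _ ih =>
    cases h₂ with
    | cond_true k _ => exact absurd h k
    | cond_false _ k => exact ih k
  | loop_true h _ _ ih₁ ih₂ =>
    cases h₂ with
    | loop_true _ k₁ k₂ => cases ih₁ k₁; exact ih₂ k₂
    | loop_false k => exact absurd k h
  | loop_false h =>
    cases h₂ with
    | loop_true k _ _ => exact absurd h k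
    | loop_false _ => rfl

/-! ### Cost semantics and a Hoare logic with step counts. -/

/-! ### Expressions over an arbitrary memory function -/

/-- Plain functions instead of finitely supported ones, so that memories can be computed with
`Function.update`. -/
def Exp.ev (m : ℕ → ℕ) : Exp → ℕ
  | .lit c => c
  | .mem a => m (a.ev m)
  | .bin o a b => o.eval (a.ev m) (b.ev m)

theorem Exp.eval_eq_ev (m : Mem) (e : Exp) : e.eval m = e.ev m := by
  induction e with
  | lit c => rfl
  | mem a ih => simp [Exp.eval, Exp.ev, ih]
  | bin o a b iha ihb => simp [Exp.eval, Exp.ev, iha, ihb]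

/-- Values of `e` have at most `e.magnitude * (W + 1)` bits on a memory with words of `W` bits. -/
def Exp.magnitude : Exp → ℕ
  | .lit c => c + 1
  | .mem _ => 1
  | .bin _ a b => a.magnitude + b.magnitude

/-- Evaluating `e` costs at most `e.weight * (W + 1) ^ 2` on a memory with words of `W` bits. -/
def Exp.weight : Exp → ℕ
  | .lit c => c + 1
  | .mem a => a.weight + 1
  | .bin _ a b => a.weight + b.weight + (a.magnitude + 1) * (b.magnitude + 1)

theorem Exp.one_le_magnitude (e : Exp) : 1 ≤ e.magnitude := by
  induction e with
  | lit c => simp [Exp.magnitude]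
  | mem a ih => simp [Exp.magnitude]
  | bin o a b iha ihb => simp only [Exp.magnitude]; omega

theorem size_le_self (n : ℕ) : Nat.size n ≤ n := Nat.size_le.2 Nat.lt_two_pow_self

/-- Multiplication is the extreme case. The conditions `1 ≤ k`, `1 ≤ l` serve addition, where `2^k +
2^l ≤ 2^(k+l)` is needed. -/
theorem Op.eval_lt {o : Op} {x y k l : ℕ} (hx : x < 2 ^ k) (hy : y < 2 ^ l) (hk : 1 ≤ k)
    (hl : 1 ≤ l) : o.eval x y < 2 ^ (k + l) := by
  have h1 : 2 ^ k ≤ 2 ^ (k + l) := Nat.pow_le_pow_right (by norm_num) (by omega)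
  cases o with
  | add =>
    have h2 : 2 ≤ 2 ^ k := by simpa using Nat.pow_le_pow_right (n := 2) (by norm_num) hk
    have h3 : 2 ≤ 2 ^ l := by simpa using Nat.pow_le_pow_right (n := 2) (by norm_num) hl
    simp only [Op.eval, pow_add]
    nlinarith
  | sub => exact lt_of_le_of_lt (Nat.sub_le _ _) (hx.trans_le h1)
  | mul => simpa only [Op.eval, pow_add] using Nat.mul_lt_mul'' hx hy
  | div => exact lt_of_le_of_lt (Nat.div_le_self _ _) (hx.trans_le h1)
  | mod => exact lt_of_le_of_lt (Nat.mod_le _ _) (hx.trans_le h1)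

theorem Exp.ev_lt {m : ℕ → ℕ} {W : ℕ} (hm : ∀ a, m a < 2 ^ W) (e : Exp) :
    e.ev m < 2 ^ (e.magnitude * (W + 1)) := by
  induction e with
  | lit c =>
    refine lt_of_lt_of_le (Nat.lt_two_pow_self (n := c)) (Nat.pow_le_pow_right (by norm_num) ?_)
    simp only [Exp.magnitude]; nlinarith
  | mem a ih =>
    exact (hm _).trans_le (Nat.pow_le_pow_right (by norm_num) (by simp [Exp.magnitude]))
  | bin o a b iha ihb =>
    simp only [Exp.magnitude, add_mul, Exp.ev]
    exact Op.eval_lt iha ihb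
      (Nat.mul_pos a.one_le_magnitude (by omega)) (Nat.mul_pos b.one_le_magnitude (by omega))

/-- An operation costs the product of two operand lengths, each linear in `W` by `Exp.ev_lt`; hence
the square. -/
theorem Exp.cost_le {m : Mem} {W : ℕ} (hm : ∀ a, m a < 2 ^ W) (e : Exp) :
    e.cost m ≤ e.weight * (W + 1) ^ 2 := by
  have hW : 1 ≤ (W + 1) ^ 2 := Nat.one_le_pow _ _ (by omega)
  induction e with
  | lit c =>
    simp only [Exp.cost, Exp.weight]
    have := size_le_self c
    nlinarith
  | mem a ih =>
    simp only [Exp.cost, Exp.weight]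
    have := Nat.size_le.2 (hm (a.eval m))
    nlinarith
  | bin o a b iha ihb =>
    simp only [Exp.cost, Exp.weight]
    have ha := Nat.size_le.2 (Exp.ev_lt hm a)
    have hb := Nat.size_le.2 (Exp.ev_lt hm b)
    rw [← Exp.eval_eq_ev] at ha hb
    have h : (Nat.size (a.eval m) + 1) * (Nat.size (b.eval m) + 1)
        ≤ ((a.magnitude + 1) * (W + 1)) * ((b.magnitude + 1) * (W + 1)) :=
      Nat.mul_le_mul (by nlinarith) (by nlinarith)
    nlinarith

/-! ### Executions that write only to registers -/

/-- Maxima rather than sums: this bounds the cost of a single elementary step, while `Run` counts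
the steps. -/
def Cmd.weight : Cmd → ℕ
  | .assign a e => a.weight + e.weight + 1
  | .flip a => a.weight + 1
  | .seq p q => max p.weight q.weight
  | .cond e p q => max (e.weight + 1) (max p.weight q.weight)
  | .loop e p => max (e.weight + 1) p.weight

/-- `Run W ω p m c m' c' t`: with the coins `ω`, the program `p` leads from the memory `m`, with
`c` coins tossed, to `m'`, with `c'` coins tossed, in `t` elementary steps. The cells below `64`
are its registers; it writes to no other cells, and writes only numbers of at most `W` bits. -/
inductive Run (W : ℕ) (ω : ℕ → Bool) : Cmd → (ℕ → ℕ) → ℕ → (ℕ → ℕ) → ℕ → ℕ → Prop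
  | assign {r : ℕ} {e : Exp} {m : ℕ → ℕ} {c : ℕ} : r < 64 → e.ev m < 2 ^ W →
      Run W ω (.assign (.lit r) e) m c (Function.update m r (e.ev m)) c 1
  | flip {r : ℕ} {m : ℕ → ℕ} {c : ℕ} : r < 64 → 0 < W →
      Run W ω (.flip (.lit r)) m c (Function.update m r (ω c).toNat) (c + 1) 1
  | seq {p q : Cmd} {m m' m'' : ℕ → ℕ} {c c' c'' t t' : ℕ} : Run W ω p m c m' c' t →
      Run W ω q m' c' m'' c'' t' → Run W ω (.seq p q) m c m'' c'' (t + t')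
  | cond_true {e : Exp} {p q : Cmd} {m m' : ℕ → ℕ} {c c' t : ℕ} : e.ev m ≠ 0 →
      Run W ω p m c m' c' t → Run W ω (.cond e p q) m c m' c' (t + 1)
  | cond_false {e : Exp} {p q : Cmd} {m m' : ℕ → ℕ} {c c' t : ℕ} : e.ev m = 0 →
      Run W ω q m c m' c' t → Run W ω (.cond e p q) m c m' c' (t + 1)
  | loop_true {e : Exp} {p : Cmd} {m m' m'' : ℕ → ℕ} {c c' c'' t t' : ℕ} : e.ev m ≠ 0 →
      Run W ω p m c m' c' t → Run W ω (.loop e p) m' c' m'' c'' t' →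
      Run W ω (.loop e p) m c m'' c'' (t + t' + 1)
  | loop_false {e : Exp} {p : Cmd} {m : ℕ → ℕ} {c : ℕ} : e.ev m = 0 →
      Run W ω (.loop e p) m c m c 1

/-- Can the value of this expression be the address `a`? (Only decided for literals.) -/
def Exp.hits : Exp → ℕ → Bool
  | .lit c, a => a == c
  | _, _ => true

/-- Does the program possibly write to the cell `a`? -/
def Cmd.wr : Cmd → ℕ → Bool
  | .assign r _, a => r.hits a
  | .flip r, a => r.hits a
  | .seq p q, a => p.wr a || q.wr a
  | .cond _ p q, a => p.wr a || q.wr a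
  | .loop _ p, a => p.wr a

/-- Does the program toss coins? -/
def Cmd.tosses : Cmd → Bool
  | .assign _ _ => false
  | .flip _ => true
  | .seq p q => p.tosses || q.tosses
  | .cond _ p q => p.tosses || q.tosses
  | .loop _ p => p.tosses

section Run

variable {W : ℕ} {ω : ℕ → Bool} {p : Cmd} {m m' : ℕ → ℕ} {c c' t : ℕ}

theorem Run.frame (h : Run W ω p m c m' c' t) {a : ℕ} (ha : p.wr a = false) : m' a = m a := by
  induction h with
  | assign _ _ => simp only [Cmd.wr, Exp.hits, beq_eq_false_iff_ne] at ha; simp [ha]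
  | flip _ _ => simp only [Cmd.wr, Exp.hits, beq_eq_false_iff_ne] at ha; simp [ha]
  | seq _ _ ih₁ ih₂ =>
    simp only [Cmd.wr, Bool.or_eq_false_iff] at ha
    rw [ih₂ ha.2, ih₁ ha.1]
  | cond_true _ _ ih => simp only [Cmd.wr, Bool.or_eq_false_iff] at ha; exact ih ha.1
  | cond_false _ _ ih => simp only [Cmd.wr, Bool.or_eq_false_iff] at ha; exact ih ha.2
  | loop_true _ _ _ ih₁ ih₂ => rw [ih₂ ha, ih₁ ha]
  | loop_false _ => rfl

theorem Run.input (h : Run W ω p m c m' c' t) {a : ℕ} (ha : 64 ≤ a) : m' a = m a := by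
  induction h with
  | assign hr _ => rw [Function.update_of_ne (by omega)]
  | flip hr _ => rw [Function.update_of_ne (by omega)]
  | seq _ _ ih₁ ih₂ => rw [ih₂, ih₁]
  | cond_true _ _ ih => exact ih
  | cond_false _ _ ih => exact ih
  | loop_true _ _ _ ih₁ ih₂ => rw [ih₂, ih₁]
  | loop_false _ => rfl

theorem Run.coins (h : Run W ω p m c m' c' t) (hp : p.tosses = false) : c' = c := by
  induction h with
  | assign _ _ => rfl
  | flip _ _ => simp [Cmd.tosses] at hp
  | seq _ _ ih₁ ih₂ =>
    simp only [Cmd.tosses, Bool.or_eq_false_iff] at hp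
    rw [ih₂ hp.2, ih₁ hp.1]
  | cond_true _ _ ih => simp only [Cmd.tosses, Bool.or_eq_false_iff] at hp; exact ih hp.1
  | cond_false _ _ ih => simp only [Cmd.tosses, Bool.or_eq_false_iff] at hp; exact ih hp.2
  | loop_true _ _ _ ih₁ ih₂ => rw [ih₂ hp, ih₁ hp]
  | loop_false _ => rfl

theorem update_lt {W r v : ℕ} {m : ℕ → ℕ} (hm : ∀ a, m a < 2 ^ W) (hv : v < 2 ^ W) (a : ℕ) :
    Function.update m r v a < 2 ^ W := by
  rw [Function.update_apply]; split_ifs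
  · exact hv
  · exact hm a

theorem toNat_lt {W : ℕ} (hW : 0 < W) (b : Bool) : b.toNat < 2 ^ W :=
  lt_of_lt_of_le (by cases b <;> decide : b.toNat < 2 ^ 1) (Nat.pow_le_pow_right (by norm_num) hW)

theorem Run.lt (h : Run W ω p m c m' c' t) (hm : ∀ a, m a < 2 ^ W) : ∀ a, m' a < 2 ^ W := by
  induction h with
  | assign hr hv => exact update_lt hm hv
  | flip hr hW => exact update_lt hm (toNat_lt hW _)
  | seq _ _ ih₁ ih₂ => exact ih₂ (ih₁ hm)
  | cond_true _ _ ih => exact ih hm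
  | cond_false _ _ ih => exact ih hm
  | loop_true _ _ _ ih₁ ih₂ => exact ih₂ (ih₁ hm)
  | loop_false _ => exact hm

/-- Executions that write only to registers are executions of the machine; the cost of each step
and the space are bounded in terms of the word size. -/
theorem Run.exec (h : Run W ω p m c m' c' t) {m₀ : ℕ → ℕ} {S w : ℕ}
    (hS : ∀ μ : Mem, (∀ a, 64 ≤ a → μ a = m₀ a) → (∀ a, μ a < 2 ^ W) → memBits μ ≤ S)
    (hw : p.weight ≤ w) (hm : ∀ a, m a < 2 ^ W) (hm₀ : ∀ a, 64 ≤ a → m a = m₀ a)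
    (s : State) (hs : ⇑s.mem = m) (hc : s.coins = c) :
    ∃ s' : State, Exec ω p s s' ∧ ⇑s'.mem = m' ∧ s'.coins = c' ∧
      s'.time ≤ s.time + t * (w * (W + 1) ^ 2) ∧
      s'.space ≤ max s.space (S + w * (W + 1) ^ 2) := by
  have hW : 1 ≤ (W + 1) ^ 2 := Nat.one_le_pow _ _ (by omega)
  induction h generalizing s with
  | @assign r e m c hr hv =>
    subst hs hc
    refine ⟨_, .assign _ _ _, ?_, rfl, ?_, ?_⟩
    · simp [State.write, State.charge, Exp.eval_eq_ev, Exp.ev, Finsupp.coe_update]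
    · have h1 := Exp.cost_le hm (.lit r)
      have h2 := Exp.cost_le hm e
      simp only [State.write, State.charge, Cmd.weight] at hw ⊢
      nlinarith
    · have h1 := Exp.cost_le hm (.lit r)
      have h2 := Exp.cost_le hm e
      have h3 := hS s.mem hm₀ hm
      have h4 := hS (s.mem.update r (e.ev s.mem))
        (fun a ha => by rw [Finsupp.coe_update, Function.update_of_ne (by omega), hm₀ a ha])
        (fun a => by rw [Finsupp.coe_update]; exact update_lt hm hv a)
      simp only [State.write, State.charge, Cmd.weight, Exp.eval_eq_ev, Exp.ev] at hw ⊢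
      refine max_le (max_le (le_max_left _ _) (le_max_of_le_right ?_)) (le_max_of_le_right ?_)
      · nlinarith
      · omega
  | @flip r m c hr hW' =>
    subst hs hc
    refine ⟨_, .flip _ _, ?_, rfl, ?_, ?_⟩
    · simp [State.write, State.charge, Exp.eval_eq_ev, Exp.ev, Finsupp.coe_update]
    · have h1 := Exp.cost_le hm (.lit r)
      simp only [State.write, State.charge, Cmd.weight] at hw ⊢
      nlinarith
    · have h1 := Exp.cost_le hm (.lit r)
      have h3 := hS s.mem hm₀ hm
      have h4 := hS (s.mem.update r (ω s.coins).toNat)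
        (fun a ha => by rw [Finsupp.coe_update, Function.update_of_ne (by omega), hm₀ a ha])
        (fun a => by rw [Finsupp.coe_update]; exact update_lt hm (toNat_lt hW' _) a)
      simp only [State.write, State.charge, Cmd.weight, Exp.eval_eq_ev, Exp.ev] at hw ⊢
      refine max_le (max_le (le_max_left _ _) (le_max_of_le_right ?_)) (le_max_of_le_right ?_)
      · nlinarith
      · omega
  | seq k₁ k₂ ih₁ ih₂ =>
    simp only [Cmd.weight, max_le_iff] at hw
    obtain ⟨s₁, e₁, a₁, b₁, d₁, f₁⟩ := ih₁ hw.1 hm hm₀ s hs hc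
    obtain ⟨s₂, e₂, a₂, b₂, d₂, f₂⟩ := ih₂ hw.2 (k₁.lt hm)
      (fun a ha => by rw [k₁.input ha, hm₀ a ha]) s₁ a₁ b₁
    refine ⟨s₂, .seq e₁ e₂, a₂, b₂, ?_, f₂.trans (max_le f₁ (le_max_right _ _))⟩
    rw [add_mul]; omega
  | @cond_true e p q m m' c c' t he k ih =>
    simp only [Cmd.weight, max_le_iff] at hw
    have h1 := Exp.cost_le (m := s.mem) (W := W) (by rwa [hs]) e
    have h3 := hS s.mem (by rwa [hs]) (by rwa [hs])
    obtain ⟨s₁, e₁, a₁, b₁, d₁, f₁⟩ := ih hw.2.1 hm hm₀ (s.charge (e.cost s.mem + 1)) hs hc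
    refine ⟨s₁, .cond_true (by rwa [Exp.eval_eq_ev, hs]) e₁, a₁, b₁, ?_, f₁.trans (max_le ?_ (le_max_right _ _))⟩
    · simp only [State.charge] at d₁; nlinarith
    · simp only [State.charge]
      exact max_le (le_max_left _ _) (le_max_of_le_right (by nlinarith))
  | @cond_false e p q m m' c c' t he k ih =>
    simp only [Cmd.weight, max_le_iff] at hw
    have h1 := Exp.cost_le (m := s.mem) (W := W) (by rwa [hs]) e
    have h3 := hS s.mem (by rwa [hs]) (by rwa [hs])
    obtain ⟨s₁, e₁, a₁, b₁, d₁, f₁⟩ := ih hw.2.2 hm hm₀ (s.charge (e.cost s.mem + 1)) hs hc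
    refine ⟨s₁, .cond_false (by rwa [Exp.eval_eq_ev, hs]) e₁, a₁, b₁, ?_, f₁.trans (max_le ?_ (le_max_right _ _))⟩
    · simp only [State.charge] at d₁; nlinarith
    · simp only [State.charge]
      exact max_le (le_max_left _ _) (le_max_of_le_right (by nlinarith))
  | @loop_true e p m m' m'' c c' c'' t t' he k₁ k₂ ih₁ ih₂ =>
    have hw' := hw
    simp only [Cmd.weight, max_le_iff] at hw'
    have h1 := Exp.cost_le (m := s.mem) (W := W) (by rwa [hs]) e
    have h3 := hS s.mem (by rwa [hs]) (by rwa [hs])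
    obtain ⟨s₁, e₁, a₁, b₁, d₁, f₁⟩ := ih₁ hw'.2 hm hm₀ (s.charge (e.cost s.mem + 1)) hs hc
    obtain ⟨s₂, e₂, a₂, b₂, d₂, f₂⟩ := ih₂ hw (k₁.lt hm)
      (fun a ha => by rw [k₁.input ha, hm₀ a ha]) s₁ a₁ b₁
    refine ⟨s₂, .loop_true (by rwa [Exp.eval_eq_ev, hs]) e₁ e₂, a₂, b₂, ?_,
      f₂.trans (max_le (f₁.trans (max_le ?_ (le_max_right _ _))) (le_max_right _ _))⟩
    · simp only [State.charge] at d₁; nlinarith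
    · simp only [State.charge]
      exact max_le (le_max_left _ _) (le_max_of_le_right (by nlinarith))
  | @loop_false e p m c he =>
    simp only [Cmd.weight, max_le_iff] at hw
    have h1 := Exp.cost_le (m := s.mem) (W := W) (by rwa [hs]) e
    have h3 := hS s.mem (by rwa [hs]) (by rwa [hs])
    refine ⟨_, .loop_false (by rwa [Exp.eval_eq_ev, hs]), hs, hc, ?_, ?_⟩
    · simp only [State.charge]; nlinarith
    · simp only [State.charge]
      exact max_le (le_max_left _ _) (le_max_of_le_right (by nlinarith))

end Run

/-! ### Total correctness with step counts -/

/-- Started in memory `m` with `c` coins tossed, the program `p` halts within `T` steps with a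
memory and a number of tossed coins that satisfy `Q`. -/
def Ht (W : ℕ) (ω : ℕ → Bool) (p : Cmd) (m : ℕ → ℕ) (c T : ℕ) (Q : (ℕ → ℕ) → ℕ → Prop) : Prop :=
  ∃ m' c' t, Run W ω p m c m' c' t ∧ t ≤ T ∧ Q m' c'

/-- `set r e` writes the value of `e` into register `r`. -/
abbrev Cmd.set (r : ℕ) (e : Exp) : Cmd := .assign (.lit r) e

/-- The value of a register. -/
abbrev Exp.reg (r : ℕ) : Exp := .mem (.lit r)

/-- Repeat `p` as often as register `k` says, which is counted down to `0`. -/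
def Cmd.rep (k : ℕ) (p : Cmd) : Cmd :=
  .loop (.reg k) (.seq p (.set k (.bin .sub (.reg k) (.lit 1))))

section Rules

variable {W : ℕ} {ω : ℕ → Bool} {p q : Cmd} {m : ℕ → ℕ} {c T T₁ T₂ : ℕ}
  {Q R : (ℕ → ℕ) → ℕ → Prop}

theorem Ht.mono (h : Ht W ω p m c T₁ R) (hT : T₁ ≤ T) (hQ : ∀ m' c', R m' c' → Q m' c') :
    Ht W ω p m c T Q := by
  obtain ⟨m', c', t, hr, ht, hR⟩ := h
  exact ⟨m', c', t, hr, ht.trans hT, hQ _ _ hR⟩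

theorem Ht.le (h : Ht W ω p m c T₁ Q) (hT : T₁ ≤ T) : Ht W ω p m c T Q :=
  h.mono hT fun _ _ h => h

theorem Ht.frame (h : Ht W ω p m c T R) (hQ : ∀ m' c', R m' c' →
      (∀ a, p.wr a = false → m' a = m a) → (∀ a, 64 ≤ a → m' a = m a) →
      (p.tosses = false → c' = c) → Q m' c') : Ht W ω p m c T Q := by
  obtain ⟨m', c', t, hr, ht, hR⟩ := h
  exact ⟨m', c', t, hr, ht, hQ _ _ hR (fun _ => hr.frame) (fun _ => hr.input) hr.coins⟩

theorem Ht.set {r : ℕ} {e : Exp} (hr : r < 64) (he : e.ev m < 2 ^ W)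
    (hQ : Q (Function.update m r (e.ev m)) c) : Ht W ω (.set r e) m c 1 Q :=
  ⟨_, _, _, .assign hr he, le_rfl, hQ⟩

theorem Ht.flip {r : ℕ} (hr : r < 64) (hW : 0 < W)
    (hQ : Q (Function.update m r (ω c).toNat) (c + 1)) : Ht W ω (.flip (.lit r)) m c 1 Q :=
  ⟨_, _, _, .flip hr hW, le_rfl, hQ⟩

/-- The frame facts about `p` are handed to the proof for `q`, so `R` has to describe only what `p`
changes. -/
theorem Ht.seq (h : Ht W ω p m c T₁ R) (hq : ∀ m' c', R m' c' →
      (∀ a, p.wr a = false → m' a = m a) → (∀ a, 64 ≤ a → m' a = m a) →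
      (p.tosses = false → c' = c) → Ht W ω q m' c' T₂ Q) :
    Ht W ω (.seq p q) m c (T₁ + T₂) Q := by
  obtain ⟨m', c', t, hr, ht, hR⟩ := h
  obtain ⟨m'', c'', t', hr', ht', hQ⟩ :=
    hq _ _ hR (fun _ => hr.frame) (fun _ => hr.input) hr.coins
  exact ⟨m'', c'', t + t', .seq hr hr', add_le_add ht ht', hQ⟩

theorem Ht.set_seq {r : ℕ} {e : Exp} (hr : r < 64) (he : e.ev m < 2 ^ W)
    (hq : Ht W ω q (Function.update m r (e.ev m)) c T Q) :
    Ht W ω (.seq (.set r e) q) m c (T + 1) Q := by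
  obtain ⟨m', c', t, hr', ht, hQ⟩ := hq
  exact ⟨m', c', 1 + t, .seq (.assign hr he) hr', by omega, hQ⟩

theorem Ht.cond {e : Exp} (h₁ : e.ev m ≠ 0 → Ht W ω p m c T Q)
    (h₂ : e.ev m = 0 → Ht W ω q m c T Q) : Ht W ω (.cond e p q) m c (T + 1) Q := by
  by_cases he : e.ev m = 0
  · obtain ⟨m', c', t, hr, ht, hQ⟩ := h₂ he
    exact ⟨m', c', t + 1, .cond_false he hr, by omega, hQ⟩
  · obtain ⟨m', c', t, hr, ht, hQ⟩ := h₁ he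
    exact ⟨m', c', t + 1, .cond_true he hr, by omega, hQ⟩

/-- The index of `Inv` is a strictly decreasing variant; each round pays its body and one test, and
the last test is the final `1`. -/
theorem Ht.loop {e : Exp} (Inv : ℕ → (ℕ → ℕ) → ℕ → Prop) {v : ℕ} (h₀ : Inv v m c)
    (hs : ∀ v m₁ c₁, Inv v m₁ c₁ → e.ev m₁ ≠ 0 → (∀ a, p.wr a = false → m₁ a = m a) →
      (∀ a, 64 ≤ a → m₁ a = m a) → Ht W ω p m₁ c₁ T fun m₂ c₂ => ∃ v' < v, Inv v' m₂ c₂) :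
    Ht W ω (.loop e p) m c (v * (T + 1) + 1)
      fun m' c' => e.ev m' = 0 ∧ ∃ v', Inv v' m' c' := by
  induction v using Nat.strong_induction_on generalizing m c with
  | _ v ih =>
    by_cases he : e.ev m = 0
    · exact ⟨m, c, 1, .loop_false he, by omega, he, v, h₀⟩
    · obtain ⟨m₁, c₁, t₁, hr₁, ht₁, v₁, hv₁, hI₁⟩ :=
        hs v m c h₀ he (fun _ _ => rfl) (fun _ _ => rfl)
      obtain ⟨m₂, c₂, t₂, hr₂, ht₂, hQ⟩ := ih v₁ hv₁ hI₁ fun v m' c' hI he hf hi =>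
        hs v m' c' hI he (fun a ha => by rw [hf a ha, hr₁.frame ha])
          (fun a ha => by rw [hi a ha, hr₁.input ha])
      refine ⟨m₂, c₂, _, .loop_true he hr₁ hr₂, ?_, hQ⟩
      have : (v₁ + 1) * (T + 1) ≤ v * (T + 1) := Nat.mul_le_mul_right _ hv₁
      nlinarith

/-- `Inv i` describes the memory after `i` rounds, when the counter holds `N - i`. A round consists
of the test, the body and the decrement, hence `T + 2`. -/
theorem Ht.rep {k N : ℕ} (Inv : ℕ → (ℕ → ℕ) → ℕ → Prop) (hN : m k = N) (hk : k < 64)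
    (hW : N < 2 ^ W) (hwr : p.wr k = false) (h₀ : Inv 0 m c)
    (hs : ∀ i < N, ∀ m₁ c₁, Inv i m₁ c₁ → (∀ a, (p.rep k).wr a = false → m₁ a = m a) →
      (∀ a, 64 ≤ a → m₁ a = m a) →
      Ht W ω p m₁ c₁ T fun m₂ c₂ => Inv (i + 1) (Function.update m₂ k (N - (i + 1))) c₂) :
    Ht W ω (p.rep k) m c (N * (T + 2) + 1) (Inv N) := by
  have h := Ht.loop (W := W) (ω := ω) (p := .seq p (.set k (.bin .sub (.reg k) (.lit 1))))
    (e := .reg k) (m := m) (c := c) (T := T + 1) (v := N)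
    (fun v m' c' => m' k = v ∧ v ≤ N ∧ Inv (N - v) m' c') ⟨hN, le_rfl, by simpa using h₀⟩
    (by
      rintro v m₁ c₁ ⟨hv, hvN, hI⟩ he hf hi
      have hv0 : v ≠ 0 := by rw [← hv]; simpa [Exp.ev] using he
      obtain ⟨m₂, c₂, t, hr, ht, hI₂⟩ := hs (N - v) (by omega) m₁ c₁ hI hf hi
      refine Ht.seq (T₂ := 1) (R := fun m₂ c₂ => Inv (N - v + 1)
        (Function.update m₂ k (N - (N - v + 1))) c₂) ⟨m₂, c₂, t, hr, ht, hI₂⟩ fun m' c' hI' hf' _ _ =>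
        Ht.set hk ?_ ⟨v - 1, by omega, ?_, by omega, ?_⟩
      · simp only [Exp.ev, Op.eval, hf' k hwr, hv]; omega
      · simp only [Exp.ev, Op.eval, Function.update_self, hf' k hwr, hv]
      · have h1 : N - v + 1 = N - (v - 1) := by omega
        have h2 : N - (N - (v - 1)) = v - 1 := by omega
        rw [h1, h2] at hI'
        simpa only [Exp.ev, Op.eval, hf' k hwr, hv] using hI')
  refine h.mono le_rfl ?_
  rintro m' c' ⟨he, v, hv, _, hI⟩
  have : v = 0 := by rw [← hv]; simpa [Exp.ev] using he
  simpa [this] using hI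

end Rules

/-! ### Notation for programs -/

instance : Add Exp := ⟨.bin .add⟩
instance : Sub Exp := ⟨.bin .sub⟩
instance : Mul Exp := ⟨.bin .mul⟩
instance : Div Exp := ⟨.bin .div⟩
instance : Mod Exp := ⟨.bin .mod⟩
instance (n : ℕ) : OfNat Exp n := ⟨.lit n⟩

infixr:35 " ;; " => Cmd.seq

section Ev

variable (m : ℕ → ℕ) (a b : Exp)

@[simp] theorem Exp.ev_add : (a + b).ev m = a.ev m + b.ev m := rfl
@[simp] theorem Exp.ev_sub : (a - b).ev m = a.ev m - b.ev m := rfl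
@[simp] theorem Exp.ev_mul : (a * b).ev m = a.ev m * b.ev m := rfl
@[simp] theorem Exp.ev_div : (a / b).ev m = a.ev m / b.ev m := rfl
@[simp] theorem Exp.ev_mod : (a % b).ev m = a.ev m % b.ev m := rfl
@[simp] theorem Exp.ev_ofNat (n : ℕ) : (no_index (OfNat.ofNat n) : Exp).ev m = n := rfl
@[simp] theorem Exp.ev_mem : (Exp.mem a).ev m = m (a.ev m) := rfl
@[simp] theorem Exp.ev_lit (n : ℕ) : (Exp.lit n).ev m = n := rfl

end Ev

-- Input cells have symbolic addresses such as `66 + i`; this lets `simp` read them past register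
-- writes.
@[simp] theorem update_add_of_lt {m : ℕ → ℕ} {r v k i : ℕ} (h : r < k) :
    Function.update m r v (k + i) = m (k + i) :=
  Function.update_of_ne (by omega) _ _

/-! ### The program and its verification, routine by routine. -/

section Subroutines

variable {W : ℕ} {ω : ℕ → Bool} {m : ℕ → ℕ} {c : ℕ}

/-! ### Powers and random numbers -/

/-- Register `dst` becomes `base ^ cnt`. -/
def powProg (dst : ℕ) (base cnt : Exp) : Cmd :=
  .set 30 cnt ;; .set dst 1 ;; (Cmd.set dst (.reg dst * base)).rep 30

/-- `base` is evaluated anew in every round, so its value is required on all memories that differ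
only in the two registers written. Positivity of `b` bounds the intermediate powers by the last one.
-/
theorem powProg_ht {dst b e : ℕ} {base cnt : Exp} (hd : dst < 64) (hd' : 30 ≠ dst)
    (hcnt : cnt.ev m = e)
    (hbase : ∀ m', (∀ a, a ≠ 30 → a ≠ dst → m' a = m a) → base.ev m' = b)
    (hb : e ≠ 0 → 0 < b) (he : e < 2 ^ W) (hbe : b ^ e < 2 ^ W) :
    Ht W ω (powProg dst base cnt) m c (3 * e + 3) fun m' _ => m' dst = b ^ e := by
  have hW : 1 < 2 ^ W := by
    refine lt_of_le_of_lt ?_ hbe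
    rcases eq_or_ne e 0 with rfl | h
    · simp
    · exact Nat.one_le_pow _ _ (hb h)
  apply Ht.le
  · apply Ht.set_seq (by norm_num) (by rwa [hcnt])
    apply Ht.set_seq hd (by simpa using hW)
    · refine Ht.rep (N := e) (T := 1) (fun i m' _ => m' dst = b ^ i) ?_ (by norm_num) he ?_ ?_ ?_
      · simp [hd', hcnt]
      · simpa [Cmd.wr, Exp.hits] using hd'
      · simp
      · intro i hi m₁ c₁ h₁ hf _
        have hbv : base.ev m₁ = b := hbase m₁ fun a ha ha' => by
          rw [hf a (by simp [Cmd.rep, Cmd.wr, Exp.hits, ha, ha'])]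
          simp [ha, ha']
        have hv : (Exp.reg dst * base).ev m₁ = b ^ (i + 1) := by simp [h₁, hbv, pow_succ]
        refine Ht.set hd ?_ ?_
        · rw [hv]
          exact lt_of_le_of_lt (Nat.pow_le_pow_right (hb (by omega)) hi) hbe
        · rw [hv]; simp [hd'.symm]
  · omega

/-- The number with binary digits `ω c, …, ω (c + L - 1)`. -/
def coinNumber (ω : ℕ → Bool) (c : ℕ) : ℕ → ℕ
  | 0 => 0
  | L + 1 => 2 * coinNumber ω c L + (ω (c + L)).toNat

theorem coinNumber_lt (ω : ℕ → Bool) (c L : ℕ) : coinNumber ω c L < 2 ^ L := by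
  induction L with
  | zero => simp [coinNumber]
  | succ L ih =>
    have := Bool.toNat_le (ω (c + L))
    simp only [coinNumber, pow_succ]; omega

/-- Register `10` becomes a random number of `cnt` bits. -/
def drawProg (cnt : Exp) : Cmd :=
  .set 43 cnt ;; .set 10 0 ;; (.flip (.lit 44) ;; .set 10 (2 * .reg 10 + .reg 44)).rep 43

theorem drawProg_ht {L : ℕ} {cnt : Exp} (hcnt : cnt.ev m = L) (hL : L ≤ W) (hW : 0 < W) :
    Ht W ω (drawProg cnt) m c (4 * L + 3)
      fun m' c' => m' 10 = coinNumber ω c L ∧ c' = c + L := by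
  have hLW : L < 2 ^ W := lt_of_le_of_lt hL Nat.lt_two_pow_self
  apply Ht.le
  · apply Ht.set_seq (by norm_num) (by rwa [hcnt])
    apply Ht.set_seq (by norm_num) (by simp)
    refine Ht.rep (N := L) (T := 2) (fun i m' c' => m' 10 = coinNumber ω c i ∧ c' = c + i)
      (by simp [hcnt]) (by norm_num) hLW (by decide) (by simp [coinNumber]) ?_
    rintro i hi m₁ c₁ ⟨h₁, rfl⟩ hf _
    refine Ht.seq (T₁ := 1) (T₂ := 1) (R := fun m' c' => m' 10 = coinNumber ω c i ∧
      m' 44 = (ω (c + i)).toNat ∧ c' = c + (i + 1))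
      (Ht.flip (by norm_num) hW (by simp [h₁, add_assoc])) ?_
    rintro m₂ c₂ ⟨h₂, h₃, rfl⟩ _ _ _
    have hv : (2 * Exp.reg 10 + Exp.reg 44).ev m₂ = coinNumber ω c (i + 1) := by
      simp [h₂, h₃, coinNumber]
    refine Ht.set (by norm_num) ?_ ?_
    · rw [hv]
      exact (coinNumber_lt _ _ _).trans_le (Nat.pow_le_pow_right (by norm_num) (by omega))
    · rw [hv]; simp
  · omega

end Subroutines

/-! ### The value of a variable -/

/-- The digit of `z` at position `i` in base `B`. -/
def digit (B z i : ℕ) : ℕ := z / B ^ i % B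

/-- `signedForm e j B M ζ γ x i` is the sum of the first `min (e i - 1) j` entries of the `i`-th
block of `j` digits of `ζ`, with signs given by the bits of `x` at the positions described by the
corresponding digits of `γ`. -/
def signedForm (e : ℕ → ℕ) (j B M ζ γ x i : ℕ) : ℤ :=
  ∑ l ∈ Finset.range j, (digit B ζ (i * j + l) : ℤ) * (if l + 2 ≤ e i then 1 else 0) *
    (-1) ^ (x / 2 ^ (digit B γ (i * j + l) % M))

/-- Registers hold no negative numbers, so `Q - 1` plays the role of `-1`. The truncation of `Q - 2`
at `Q = 1` is harmless because `ZMod 1` is trivial. -/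
theorem natCast_signFactor {Q : ℕ} (hQ : 0 < Q) (k : ℕ) :
    ((1 + (Q - 2) * (k % 2) : ℕ) : ZMod Q) = (-1) ^ k := by
  rw [neg_one_pow_eq_pow_mod_two]
  rcases Nat.lt_or_ge Q 2 with h | h
  · obtain rfl : Q = 1 := by omega
    exact Subsingleton.elim _ _
  · rcases Nat.mod_two_eq_zero_or_one k with hk | hk
    · simp [hk]
    · simp only [hk, mul_one, pow_one]
      push_cast [Nat.cast_sub h]
      simp only [CharP.cast_eq_zero]; ring

section

variable {W : ℕ} {ω : ℕ → Bool} {m : ℕ → ℕ} {c : ℕ}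

/-- Register `19` becomes the value modulo register `12` of the variable whose index is in register
`22`, at the point used by the main test. -/
def mainVar (σ : Exp) : Cmd :=
  .set 33 0 ;; .set 34 0 ;; .set 41 (.reg 4) ;;
  (powProg 31 (.reg 9) (.reg 22 * .reg 4 + .reg 34) ;;
    .set 35 (.reg 13 / .reg 31 % .reg 9) ;;
    .set 36 (.reg 14 / .reg 31 % .reg 9 % .reg 7) ;;
    powProg 31 2 (.reg 36) ;;
    -- By truncated subtraction, `1 - (l + 2 - e i)` is the indicator of `l + 2 ≤ e i`: exactly the
    -- first `e i - 1` slots are used.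
    .set 33 ((.reg 33 + .reg 35 * (1 - (.reg 34 + 2 - .mem (66 + .reg 22))) * .reg 11 *
      (1 + (.reg 12 - 2) * ((.reg 15 / .reg 31 + σ) % 2))) % .reg 12) ;;
    .set 34 (.reg 34 + 1)).rep 41 ;;
  .set 19 (.reg 33)

theorem mainVar_ht {n j M B P Q ζ γ x i σ : ℕ} {e : ℕ → ℕ} {σe : Exp}
    (h4 : m 4 = j) (h7 : m 7 = M) (h9 : m 9 = B) (h11 : m 11 = P) (h12 : m 12 = Q)
    (h13 : m 13 = ζ) (h14 : m 14 = γ) (h15 : m 15 = x) (h22 : m 22 = i)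
    (he : ∀ i < n, m (66 + i) = e i) (hσ : ∀ m, σe.ev m = σ) (hi : i < n)
    (hM : j ≠ 0 → 0 < M) (hB : 0 < B) (hQ : 0 < Q) (hj : j < 2 ^ W) (hnj : n * j < 2 ^ W)
    (hBW : B ^ (n * j) < 2 ^ W) (hMW : 2 ^ M < 2 ^ W) (hQW : Q ≤ 2 ^ W) :
    Ht W ω (mainVar σe) m c (j * (3 * (n * j) + 3 * M + 12) + 5)
      fun m' _ => m' 19 < Q ∧
        ((m' 19 : ℕ) : ZMod Q) = ((P * (-1) ^ σ * signedForm e j B M ζ γ x i : ℤ) : ZMod Q) := by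
  have hW : 1 < 2 ^ W := lt_of_le_of_lt (Nat.one_le_two_pow (n := M)) hMW
  have hMlt : M < 2 ^ W := Nat.lt_two_pow_self.trans hMW
  apply Ht.le
  · apply Ht.set_seq (by norm_num) (by simp)
    apply Ht.set_seq (by norm_num) (by simp)
    apply Ht.set_seq (by norm_num) (by simp [h4, hj])
    apply Ht.seq (T₂ := 1) (R := fun m' _ => m' 34 = j ∧ m' 33 < Q ∧ ((m' 33 : ℕ) : ZMod Q) =
        ((P * (-1) ^ σ * signedForm e j B M ζ γ x i : ℤ) : ZMod Q))
    · refine Ht.rep (N := j) (T := 3 * (n * j) + 3 * M + 10) (fun k m' _ => m' 34 = k ∧ m' 33 < Q ∧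
        ((m' 33 : ℕ) : ZMod Q) = ((P * (-1) ^ σ * ∑ l ∈ Finset.range k,
          (digit B ζ (i * j + l) : ℤ) * (if l + 2 ≤ e i then 1 else 0) *
          (-1) ^ (x / 2 ^ (digit B γ (i * j + l) % M)) : ℤ) : ZMod Q)) ?_ ?_ hj ?_ ?_ ?_
      · simp [h4]
      · norm_num
      · rfl
      · simp [hQ]
      · rintro k hk m₁ c₁ ⟨k34, k33, ks⟩ hf hin
        have hidx : i * j + k < n * j := by nlinarith
        have hpow : B ^ (i * j + k) < 2 ^ W :=
          lt_of_le_of_lt (Nat.pow_le_pow_right hB hidx.le) hBW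
        have hM' : 0 < M := hM (by omega)
        have hcol : digit B γ (i * j + k) % M < M := Nat.mod_lt _ hM'
        have k4 : m₁ 4 = j := by rw [hf 4 rfl]; simp [h4]
        have k7 : m₁ 7 = M := by rw [hf 7 rfl]; simp [h7]
        have k9 : m₁ 9 = B := by rw [hf 9 rfl]; simp [h9]
        have k11 : m₁ 11 = P := by rw [hf 11 rfl]; simp [h11]
        have k12 : m₁ 12 = Q := by rw [hf 12 rfl]; simp [h12]
        have k13 : m₁ 13 = ζ := by rw [hf 13 rfl]; simp [h13]
        have k14 : m₁ 14 = γ := by rw [hf 14 rfl]; simp [h14]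
        have k15 : m₁ 15 = x := by rw [hf 15 rfl]; simp [h15]
        have k22 : m₁ 22 = i := by rw [hf 22 rfl]; simp [h22]
        have ke : m₁ (66 + i) = e i := by
          rw [hin _ (by omega), ← he i hi]; simp
        apply Ht.le
        · apply Ht.seq (powProg_ht (b := B) (e := i * j + k) (by norm_num) (by norm_num)
            (by simp [k22, k4, k34]) (fun m' h' => by simp [h' 9, k9]) (fun _ => hB) (hidx.trans hnj) hpow)
          intro m₂ c₂ l31 hf₂ hi₂ _
          apply Ht.set_seq (by norm_num)
          · simp only [Exp.ev_mod, Exp.ev_div, Exp.ev_mem, Exp.ev_lit, hf₂ 9 rfl, k9]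
            refine (Nat.mod_lt _ hB).trans_le ((Nat.le_self_pow (n := n * j) (by
              have := Nat.zero_le (i * j + k); omega) B).trans hBW.le)
          apply Ht.set_seq (by norm_num)
          · simp only [Exp.ev_mod, Exp.ev_div, Exp.ev_mem, Exp.ev_lit,
              Function.update_of_ne (show (7 : ℕ) ≠ 35 by norm_num), hf₂ 7 rfl, k7]
            exact (Nat.mod_lt _ hM').trans hMlt
          apply Ht.seq (powProg_ht (b := 2) (e := digit B γ (i * j + k) % M) (by norm_num)
            (by norm_num) (by simp [digit, hf₂ 14 rfl, hf₂ 9 rfl, hf₂ 7 rfl, k14, k9, k7, l31])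
            (fun m' h' => by simp) (fun _ => by norm_num) (hcol.trans hMlt)
            (lt_of_le_of_lt (Nat.pow_le_pow_right (by norm_num) hcol.le) hMW))
          intro m₃ c₃ p31 hf₃ hi₃ _
          have q33 : m₃ 33 = m₁ 33 := by rw [hf₃ 33 rfl]; simp [hf₂ 33 rfl]
          have q34 : m₃ 34 = k := by rw [hf₃ 34 rfl]; simp [hf₂ 34 rfl, k34]
          have q35 : m₃ 35 = digit B ζ (i * j + k) := by
            rw [hf₃ 35 rfl]; simp [hf₂ 13 rfl, hf₂ 9 rfl, k9, k13, l31, digit]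
          have q11 : m₃ 11 = P := by rw [hf₃ 11 rfl]; simp [hf₂ 11 rfl, k11]
          have q12 : m₃ 12 = Q := by rw [hf₃ 12 rfl]; simp [hf₂ 12 rfl, k12]
          have q15 : m₃ 15 = x := by rw [hf₃ 15 rfl]; simp [hf₂ 15 rfl, k15]
          have q22 : m₃ 22 = i := by rw [hf₃ 22 rfl]; simp [hf₂ 22 rfl, k22]
          have qe : m₃ (66 + i) = e i := by
            rw [hi₃ _ (by omega)]; simp [hi₂ (66 + i) (by omega), ke]
          have hval : ((Exp.reg 33 + .reg 35 * (1 - (.reg 34 + 2 - .mem (66 + .reg 22))) * .reg 11 *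
              (1 + (.reg 12 - 2) * ((.reg 15 / .reg 31 + σe) % 2))) % .reg 12).ev m₃ =
              (m₁ 33 + digit B ζ (i * j + k) * (1 - (k + 2 - e i)) * P * (1 + (Q - 2) *
                ((x / 2 ^ (digit B γ (i * j + k) % M) + σ) % 2))) % Q := by
            simp [q33, q34, q35, q11, q12, q15, q22, qe, p31, hσ]
          apply Ht.set_seq (by norm_num)
          · rw [hval]; exact (Nat.mod_lt _ hQ).trans_le hQW
          rw [hval]
          refine Ht.set (by norm_num) ?_ ?_
          · simp [q34]; omega
          · refine ⟨by simp [q34], by simpa using Nat.mod_lt _ hQ, ?_⟩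
            have h1 : ((1 - (k + 2 - e i) : ℕ) : ZMod Q) =
                ((if k + 2 ≤ e i then 1 else 0 : ℤ) : ZMod Q) := by
              split_ifs with h
              · rw [Nat.sub_eq_zero_of_le h]; simp
              · rw [Nat.sub_eq_zero_of_le (by omega)]; simp
            rw [Function.update_of_ne (by norm_num), Function.update_of_ne (by norm_num),
              Function.update_self, ZMod.natCast_mod, Finset.sum_range_succ, Nat.cast_add, Nat.cast_mul, Nat.cast_mul, Nat.cast_mul,
              natCast_signFactor hQ, ks, h1]
            push_cast
            ring
        · have := hcol.le
          omega
    · rintro m' c' ⟨k34, k33, ks⟩ hf hin _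
      refine Ht.set (by norm_num) ?_ ?_
      · simpa using k33.trans_le hQW
      · exact ⟨by simpa using k33, by simpa using ks⟩
  · ring_nf; omega

/-- Register `19` becomes register `45` times the value of the variable whose index is in register
`22`, at the point used by the degree test, modulo register `12`. -/
def degreeVar : Cmd :=
  powProg 31 (.reg 9) (.reg 22) ;; .set 19 (.reg 13 / .reg 31 % .reg 9 * .reg 45 % .reg 12)

theorem degreeVar_ht {n B Q ζ i t : ℕ} (h9 : m 9 = B) (h12 : m 12 = Q) (h13 : m 13 = ζ)
    (h22 : m 22 = i) (h45 : m 45 = t) (hi : i < n) (hB : 0 < B) (hQ : 0 < Q)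
    (hn : n < 2 ^ W) (hBW : B ^ n < 2 ^ W) (hQW : Q ≤ 2 ^ W) :
    Ht W ω degreeVar m c (3 * n + 4) fun m' _ => m' 19 < Q ∧
        ((m' 19 : ℕ) : ZMod Q) = ((t * digit B ζ i : ℤ) : ZMod Q) := by
  apply Ht.le
  · apply Ht.seq (powProg_ht (b := B) (e := i) (by norm_num) (by norm_num)
      (by simp [h22]) (fun m' h' => by simp [h' 9, h9]) (fun _ => hB) (hi.trans hn) (lt_of_le_of_lt (Nat.pow_le_pow_right hB hi.le) hBW))
    intro m₂ c₂ l31 hf₂ hi₂ _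
    have hval : (Exp.reg 13 / .reg 31 % .reg 9 * .reg 45 % .reg 12).ev m₂ =
        digit B ζ i * t % Q := by
      simp [hf₂ 13 rfl, hf₂ 9 rfl, hf₂ 45 rfl, hf₂ 12 rfl, l31, h9, h12, h13, h45, digit]
    refine Ht.set (by norm_num) ?_ ?_
    · rw [hval]; exact (Nat.mod_lt _ hQ).trans_le hQW
    · rw [hval]
      refine ⟨by simpa using Nat.mod_lt _ hQ, ?_⟩
      simp [mul_comm]
  · omega

end

/-! ### Evaluation of a circuit -/

/-- Register `dst` becomes the digit at position `idx` in base register `12` of register `17`. -/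
def fetchProg (dst : ℕ) (idx : Exp) : Cmd :=
  powProg 31 (.reg 12) idx ;; .set dst (.reg 17 / .reg 31 % .reg 12)

/-- Evaluate the gate with the number in register `20`, append its value to the packed list of
values in register `17`, and leave it in register `19`. -/
def gateProg (var : Cmd) : Cmd :=
  .set 21 (.mem (66 + .reg 1 + 3 * .reg 20)) ;;
  .set 22 (.mem (67 + .reg 1 + 3 * .reg 20)) ;;
  .set 23 (.mem (68 + .reg 1 + 3 * .reg 20)) ;;
  .cond (.reg 21)
    (.cond (.reg 21 - 1)
      (.cond (.reg 21 - 2)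
        (fetchProg 47 (.reg 22) ;; fetchProg 48 (.reg 23) ;;
          .cond (.reg 21 - 3) (.set 19 (.reg 47 * .reg 48 % .reg 12))
            (.set 19 ((.reg 47 + .reg 48) % .reg 12)))
        var)
      (.set 19 ((.reg 12 - .reg 22 % .reg 12) % .reg 12)))
    (.set 19 (.reg 22 % .reg 12)) ;;
  .set 17 (.reg 17 + .reg 19 * .reg 18) ;;
  .set 18 (.reg 18 * .reg 12) ;;
  .set 20 (.reg 20 + 1)

/-- Evaluate the circuit modulo register `12`, with `var` evaluating the variables. -/
def circuitProg (var : Cmd) : Cmd :=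
  .set 17 0 ;; .set 18 1 ;; .set 20 0 ;; .set 40 (.reg 2) ;; (gateProg var).rep 40

/-- The value at gate `g`, described by a tag and two operands, is computed from earlier values. -/
def GateOK {Q : ℕ} (n : ℕ) (pt val : ℕ → ZMod Q) (g tag a b : ℕ) : Prop :=
  (tag = 0 ∧ val g = a) ∨ (tag = 1 ∧ val g = -a) ∨ (tag = 2 ∧ a < n ∧ val g = pt a) ∨
    (tag = 3 ∧ a < g ∧ b < g ∧ val g = val a + val b) ∨
    (tag = 4 ∧ a < g ∧ b < g ∧ val g = val a * val b)

section

variable {W : ℕ} {ω : ℕ → Bool} {m : ℕ → ℕ} {c : ℕ}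

theorem fetchProg_ht {dst Q V a G : ℕ} {idx : Exp} (hd : dst < 64) (hi : idx.ev m = a)
    (h12 : m 12 = Q) (h17 : m 17 = V) (ha : a < G) (hG : G < 2 ^ W) (hQ : 0 < Q)
    (hQW : Q ^ G < 2 ^ W) :
    Ht W ω (fetchProg dst idx) m c (3 * G + 4) fun m' _ => m' dst = V / Q ^ a % Q := by
  apply Ht.le
  · apply Ht.seq (powProg_ht (b := Q) (by norm_num) (by norm_num) hi
      (fun m' h' => by simp [h' 12, h12]) (fun _ => hQ) (ha.trans hG)
      (lt_of_le_of_lt (Nat.pow_le_pow_right hQ ha.le) hQW))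
    intro m' c' h31 hf _ _
    have hv : (Exp.reg 17 / .reg 31 % .reg 12).ev m' = V / Q ^ a % Q := by
      simp [hf 17 rfl, hf 12 rfl, h31, h12, h17]
    refine Ht.set hd ?_ ?_
    · rw [hv]
      exact (Nat.mod_lt _ hQ).trans_le ((Nat.le_self_pow (by omega) _).trans hQW.le)
    · simp [hv]
  · omega

/-- The gate values are the base-`Q` digits of one number. Since `V < Q ^ g`, adding `v * Q ^ g`
writes digit `g` and leaves the lower ones intact. A fixed set of registers thus suffices, at the
price of words that hold `Q ^ G`. -/
theorem gateProg_ht {var : Cmd} {n G Q g V T : ℕ} {pt val : ℕ → ZMod Q}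
    (h1 : m 1 = n) (h12 : m 12 = Q) (h17 : m 17 = V) (h18 : m 18 = Q ^ g) (h20 : m 20 = g)
    (hg : g < G) (hQ : 0 < Q) (hQW : Q ^ G < 2 ^ W) (hGW : G < 2 ^ W)
    (hV : V < Q ^ g) (hval : ∀ i < g, ((V / Q ^ i % Q : ℕ) : ZMod Q) = val i)
    (hin : ∀ a, 64 ≤ a → m a < 2 ^ W)
    (hgate : GateOK n pt val g (m (66 + n + 3 * g)) (m (67 + n + 3 * g)) (m (68 + n + 3 * g)))
    (hwr : ∀ r ∈ [12, 17, 18, 20], var.wr r = false)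
    (hvar : ∀ m₁ c₁, m₁ 22 < n → (∀ a, a ≠ 21 → a ≠ 22 → a ≠ 23 → m₁ a = m a) →
      Ht W ω var m₁ c₁ T fun m' _ => m' 19 < Q ∧ ((m' 19 : ℕ) : ZMod Q) = pt (m₁ 22)) :
    Ht W ω (gateProg var) m c (T + 6 * G + 19) fun m' _ =>
      m' 18 = Q ^ (g + 1) ∧ m' 17 < Q ^ (g + 1) ∧ m' 20 = g + 1 ∧
      (∀ i < g + 1, ((m' 17 / Q ^ i % Q : ℕ) : ZMod Q) = val i) ∧
      m' 19 < Q ∧ ((m' 19 : ℕ) : ZMod Q) = val g := by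
  have hQle : Q ≤ Q ^ G := Nat.le_self_pow (by omega) _
  have hQg : Q ^ (g + 1) ≤ Q ^ G := Nat.pow_le_pow_right hQ hg
  obtain ⟨tag, htag⟩ : ∃ tag, m (66 + n + 3 * g) = tag := ⟨_, rfl⟩
  obtain ⟨a, ha⟩ : ∃ a, m (67 + n + 3 * g) = a := ⟨_, rfl⟩
  obtain ⟨b, hb⟩ : ∃ b, m (68 + n + 3 * g) = b := ⟨_, rfl⟩
  rw [htag, ha, hb] at hgate
  have htW : tag < 2 ^ W := by rw [← htag]; exact hin _ (by omega)
  have haW : a < 2 ^ W := by rw [← ha]; exact hin _ (by omega)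
  have hbW : b < 2 ^ W := by rw [← hb]; exact hin _ (by omega)
  have e21 : (Exp.mem (66 + .reg 1 + 3 * .reg 20)).ev m = tag := by simp [h1, h20, htag]
  apply Ht.le
  · apply Ht.set_seq (by norm_num) (by rwa [e21])
    rw [e21]
    have e22 : (Exp.mem (67 + .reg 1 + 3 * .reg 20)).ev (Function.update m 21 tag) = a := by
      simp [h1, h20, add_assoc, ← ha]
    apply Ht.set_seq (by norm_num) (by rwa [e22])
    rw [e22]
    have e23 : (Exp.mem (68 + .reg 1 + 3 * .reg 20)).ev
        (Function.update (Function.update m 21 tag) 22 a) = b := by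
      simp [h1, h20, add_assoc, ← hb]
    apply Ht.set_seq (by norm_num) (by rwa [e23])
    rw [e23]
    generalize hm₁ : Function.update (Function.update (Function.update m 21 tag) 22 a) 23 b = m₁
    have k21 : m₁ 21 = tag := by simp [← hm₁]
    have k22 : m₁ 22 = a := by simp [← hm₁]
    have k23 : m₁ 23 = b := by simp [← hm₁]
    have kf : ∀ a, a ≠ 21 → a ≠ 22 → a ≠ 23 → m₁ a = m a := by
      intro a h1 h2 h3; simp [← hm₁, h1, h2, h3]
    have k12 : m₁ 12 = Q := by rw [kf 12 (by norm_num) (by norm_num) (by norm_num), h12]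
    have k17 : m₁ 17 = V := by rw [kf 17 (by norm_num) (by norm_num) (by norm_num), h17]
    have k18 : m₁ 18 = Q ^ g := by rw [kf 18 (by norm_num) (by norm_num) (by norm_num), h18]
    have k20 : m₁ 20 = g := by rw [kf 20 (by norm_num) (by norm_num) (by norm_num), h20]
    apply Ht.seq (T₁ := T + 6 * G + 13) (T₂ := 3)
      (R := fun m' _ => m' 19 < Q ∧ ((m' 19 : ℕ) : ZMod Q) = val g)
    · refine Ht.le (T₁ := (T + 6 * G + 12) + 1) (Ht.cond (fun ht => ?_) (fun ht => ?_)) le_rfl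
      · have ht0 : tag ≠ 0 := by simpa [k21] using ht
        refine Ht.le (T₁ := (T + 6 * G + 11) + 1) (Ht.cond (fun ht => ?_) (fun ht => ?_)) le_rfl
        · have ht1 : 2 ≤ tag := by
            have : tag - 1 ≠ 0 := by simpa [k21] using ht
            omega
          refine Ht.le (T₁ := (T + 6 * G + 10) + 1) (Ht.cond (fun ht => ?_) (fun ht => ?_)) le_rfl
          · have ht2 : 3 ≤ tag := by
              have : tag - 2 ≠ 0 := by simpa [k21] using ht
              omega
            have hab : a < g ∧ b < g := by
              rcases hgate with h | h | h | h | h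
              · omega
              · omega
              · omega
              · exact ⟨h.2.1, h.2.2.1⟩
              · exact ⟨h.2.1, h.2.2.1⟩
            apply Ht.le
            · apply Ht.seq (fetchProg_ht (by norm_num) (by simpa using k22) k12 k17
                (hab.1.trans hg) hGW hQ hQW)
              intro m₂ c₂ l47 hf₂ _ _
              have l12 : m₂ 12 = Q := by rw [hf₂ 12 rfl, k12]
              have l17 : m₂ 17 = V := by rw [hf₂ 17 rfl, k17]
              have l23 : m₂ 23 = b := by rw [hf₂ 23 rfl, k23]
              have l21 : m₂ 21 = tag := by rw [hf₂ 21 rfl, k21]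
              apply Ht.seq (fetchProg_ht (by norm_num) (by simpa using l23) l12 l17
                (hab.2.trans hg) hGW hQ hQW)
              intro m₃ c₃ p48 hf₃ _ _
              have p12 : m₃ 12 = Q := by rw [hf₃ 12 rfl, l12]
              have p21 : m₃ 21 = tag := by rw [hf₃ 21 rfl, l21]
              have p47 : m₃ 47 = V / Q ^ a % Q := by rw [hf₃ 47 rfl, l47]
              apply Ht.cond
              · intro ht
                have ht3 : tag = 4 := by
                  have : tag - 3 ≠ 0 := by simpa [p21] using ht
                  rcases hgate with h | h | h | h | h <;> omega
                have hgv : val g = val a * val b := by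
                  rcases hgate with h | h | h | h | h
                  · omega
                  · omega
                  · omega
                  · omega
                  · exact h.2.2.2
                refine Ht.set (by norm_num) ?_ ⟨?_, ?_⟩
                · simpa [p12] using (Nat.mod_lt _ hQ).trans_le (hQle.trans hQW.le)
                · simpa [p12] using Nat.mod_lt _ hQ
                · rw [Function.update_self]
                  simp only [Exp.ev_mod, Exp.ev_mul, Exp.ev_mem, Exp.ev_lit, p12, p47, p48]
                  rw [ZMod.natCast_mod, Nat.cast_mul, hval a hab.1, hval b hab.2, hgv]
              · intro ht
                have ht3 : tag = 3 := by
                  have : tag - 3 = 0 := by simpa [p21] using ht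
                  omega
                have hgv : val g = val a + val b := by
                  rcases hgate with h | h | h | h | h
                  · omega
                  · omega
                  · omega
                  · exact h.2.2.2
                  · omega
                refine Ht.set (by norm_num) ?_ ⟨?_, ?_⟩
                · simpa [p12] using (Nat.mod_lt _ hQ).trans_le (hQle.trans hQW.le)
                · simpa [p12] using Nat.mod_lt _ hQ
                · rw [Function.update_self]
                  simp only [Exp.ev_mod, Exp.ev_add, Exp.ev_mem, Exp.ev_lit, p12, p47, p48]
                  rw [ZMod.natCast_mod, Nat.cast_add, hval a hab.1, hval b hab.2, hgv]
            · omega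
          · have ht2 : tag = 2 := by
              have : tag - 2 = 0 := by simpa [k21] using ht
              omega
            have hgv : a < n ∧ val g = pt a := by
              rcases hgate with h | h | h | h | h
              · omega
              · omega
              · exact h.2
              · omega
              · omega
            refine Ht.mono (hvar m₁ c (by rw [k22]; exact hgv.1) kf) (by omega) ?_
            rintro m' _ ⟨h, h'⟩
            rw [k22] at h'
            exact ⟨h, h'.trans hgv.2.symm⟩
        · have ht1 : tag = 1 := by
            have : tag - 1 = 0 := by simpa [k21] using ht
            omega
          have hgv : val g = -a := by
            rcases hgate with h | h | h | h | h
            · omega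
            · exact h.2
            · omega
            · omega
            · omega
          refine Ht.le (Ht.set (by norm_num) ?_ ⟨?_, ?_⟩) (by omega : 1 ≤ _)
          · simpa [k12] using (Nat.mod_lt _ hQ).trans_le (hQle.trans hQW.le)
          · simpa [k12] using Nat.mod_lt _ hQ
          · rw [Function.update_self]
            simp only [Exp.ev_mod, Exp.ev_sub, Exp.ev_mem, Exp.ev_lit, k12, k22]
            rw [ZMod.natCast_mod, Nat.cast_sub (Nat.mod_lt _ hQ).le, ZMod.natCast_mod, hgv]
            simp
      · have ht0 : tag = 0 := by simpa [k21] using ht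
        have hgv : val g = a := by
          rcases hgate with h | h | h | h | h
          · exact h.2
          · omega
          · omega
          · omega
          · omega
        refine Ht.le (Ht.set (by norm_num) ?_ ⟨?_, ?_⟩) (by omega : 1 ≤ _)
        · simpa [k12] using (Nat.mod_lt _ hQ).trans_le (hQle.trans hQW.le)
        · simpa [k12] using Nat.mod_lt _ hQ
        · rw [Function.update_self]
          simp only [Exp.ev_mod, Exp.ev_mem, Exp.ev_lit, k12, k22]
          rw [ZMod.natCast_mod, hgv]
    · rintro m₂ c₂ ⟨h19, h19'⟩ hf₂ _ _
      have w12 := hwr 12 (by simp)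
      have w17 := hwr 17 (by simp)
      have w18 := hwr 18 (by simp)
      have w20 := hwr 20 (by simp)
      have l12 : m₂ 12 = Q := by
        rw [hf₂ 12 (by simp [Cmd.wr, Exp.hits, fetchProg, powProg, Cmd.rep, w12]), k12]
      have l17 : m₂ 17 = V := by
        rw [hf₂ 17 (by simp [Cmd.wr, Exp.hits, fetchProg, powProg, Cmd.rep, w17]), k17]
      have l18 : m₂ 18 = Q ^ g := by
        rw [hf₂ 18 (by simp [Cmd.wr, Exp.hits, fetchProg, powProg, Cmd.rep, w18]), k18]
      have l20 : m₂ 20 = g := by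
        rw [hf₂ 20 (by simp [Cmd.wr, Exp.hits, fetchProg, powProg, Cmd.rep, w20]), k20]
      generalize hv : m₂ 19 = v at h19 h19'
      have hnew : V + v * Q ^ g < Q ^ (g + 1) := by
        have : (v + 1) * Q ^ g ≤ Q * Q ^ g := Nat.mul_le_mul_right _ h19
        rw [pow_succ]; nlinarith
      apply Ht.set_seq (by norm_num)
      · simpa [l17, l18, hv] using hnew.trans_le (hQg.trans hQW.le)
      apply Ht.set_seq (by norm_num)
      · simpa [l18, l12, ← pow_succ] using lt_of_le_of_lt hQg hQW
      refine Ht.set (by norm_num) ?_ ⟨?_, ?_, ?_, ?_, ?_, ?_⟩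
      · simpa [l20] using lt_of_le_of_lt hg hGW
      · simp [l18, l12, pow_succ]
      · simpa [l17, l18, hv] using hnew
      · simp [l20]
      · intro i hi
        have hu : (m₂ 17 + m₂ 19 * m₂ 18) = V + v * Q ^ g := by rw [l17, l18, hv]
        simp only [Function.update_of_ne (show (17 : ℕ) ≠ 20 by norm_num),
          Function.update_of_ne (show (17 : ℕ) ≠ 18 by norm_num), Function.update_self,
          Exp.ev_add, Exp.ev_mul, Exp.ev_mem, Exp.ev_lit, hu]
        rcases Nat.lt_succ_iff_lt_or_eq.1 hi with hi' | rfl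
        · rw [← hval i hi']
          obtain ⟨k, rfl⟩ := Nat.exists_eq_add_of_lt hi'
          rw [show V + v * Q ^ (i + k + 1) = V + Q ^ i * (Q * (v * Q ^ k)) by ring,
            Nat.add_mul_div_left _ _ (pow_pos hQ i), Nat.add_mul_mod_self_left]
        · rw [← h19', Nat.add_mul_div_right _ _ (pow_pos hQ i), Nat.div_eq_of_lt hV, zero_add,
            Nat.mod_eq_of_lt h19]
      · simpa [hv] using h19
      · simpa [hv] using h19'
  · omega

theorem circuitProg_ht {var : Cmd} {n G Q T : ℕ} {pt val : ℕ → ZMod Q}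
    (h1 : m 1 = n) (h2 : m 2 = G) (h12 : m 12 = Q)
    (hG : 0 < G) (hQ : 0 < Q) (hQW : Q ^ G < 2 ^ W) (hGW : G < 2 ^ W)
    (hin : ∀ a, 64 ≤ a → m a < 2 ^ W)
    (hgate : ∀ g < G,
      GateOK n pt val g (m (66 + n + 3 * g)) (m (67 + n + 3 * g)) (m (68 + n + 3 * g)))
    (hwr : ∀ r ∈ [1, 12, 17, 18, 20, 40], var.wr r = false)
    (hvar : ∀ m₁ c₁, m₁ 22 < n → (∀ a, (circuitProg var).wr a = false → m₁ a = m a) →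
      (∀ a, 64 ≤ a → m₁ a = m a) →
      Ht W ω var m₁ c₁ T fun m' _ => m' 19 < Q ∧ ((m' 19 : ℕ) : ZMod Q) = pt (m₁ 22)) :
    Ht W ω (circuitProg var) m c (G * (T + 6 * G + 21) + 5) fun m' _ =>
      m' 19 < Q ∧ ((m' 19 : ℕ) : ZMod Q) = val (G - 1) := by
  have hW : 1 < 2 ^ W := lt_of_le_of_lt (Nat.one_le_pow _ _ hQ) hQW
  apply Ht.le
  · apply Ht.set_seq (by norm_num) (by simp)
    apply Ht.set_seq (by norm_num) (by simpa using hW)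
    apply Ht.set_seq (by norm_num) (by simp)
    apply Ht.set_seq (by norm_num) (by simpa [h2] using hGW)
    refine Ht.mono (Ht.rep (N := G) (T := T + 6 * G + 19) (fun g m' _ =>
      m' 18 = Q ^ g ∧ m' 17 < Q ^ g ∧ m' 20 = g ∧
      (∀ i < g, ((m' 17 / Q ^ i % Q : ℕ) : ZMod Q) = val i) ∧
      (0 < g → m' 19 < Q ∧ ((m' 19 : ℕ) : ZMod Q) = val (g - 1))) ?_ (by norm_num) hGW ?_ ?_ ?_)
      le_rfl ?_
    · simp [h2]
    · simp [gateProg, Cmd.wr, Exp.hits, fetchProg, powProg, Cmd.rep, hwr 40]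
    · simp
    · rintro g hg m₁ c₁ ⟨k18, k17, k20, kv, k19⟩ hf hi
      have hr : ∀ r ∈ [1, 12], ((gateProg var).rep 40).wr r = false := by
        intro r hr
        have := hwr r (by simp at hr ⊢; tauto)
        simp only [List.mem_cons, List.not_mem_nil, or_false] at hr
        rcases hr with rfl | rfl <;>
          simp [gateProg, Cmd.wr, Exp.hits, fetchProg, powProg, Cmd.rep, this]
      have k1 : m₁ 1 = n := by rw [hf 1 (hr 1 (by simp))]; simp [h1]
      have k12 : m₁ 12 = Q := by rw [hf 12 (hr 12 (by simp))]; simp [h12]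
      have ki : ∀ a, 64 ≤ a → m₁ a = m a := by
        intro a ha
        rw [hi a ha, Function.update_of_ne (by omega), Function.update_of_ne (by omega),
          Function.update_of_ne (by omega), Function.update_of_ne (by omega)]
      refine Ht.mono (gateProg_ht (pt := pt) (G := G) (g := g) (T := T) k1 k12 rfl k18 k20 hg hQ hQW hGW k17
        kv (fun a ha => by rw [ki a ha]; exact hin a ha) ?_ ?_ ?_) le_rfl ?_
      · rw [ki _ (by omega), ki _ (by omega), ki _ (by omega)]; exact hgate g hg
      · intro r hr; exact hwr r (by simp at hr ⊢; tauto)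
      · intro m₂ c₂ h22 h'
        refine hvar m₂ c₂ h22 ?_ ?_
        · intro a ha
          have ha' := ha
          simp only [circuitProg, gateProg, Cmd.wr, Exp.hits, fetchProg, powProg, Cmd.rep,
            Bool.or_eq_false_iff, beq_eq_false_iff_ne] at ha
          rw [h' a (by tauto) (by tauto) (by tauto), hf a (by
              simp only [circuitProg, Cmd.wr, Bool.or_eq_false_iff] at ha'; tauto),
            Function.update_of_ne (by tauto), Function.update_of_ne (by tauto),
            Function.update_of_ne (by tauto), Function.update_of_ne (by tauto)]
        · intro a ha
          rw [h' a (by omega) (by omega) (by omega), ki a ha]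
      · rintro m' _ ⟨q18, q17, q20, qv, q19⟩
        refine ⟨?_, ?_, ?_, ?_, ?_⟩
        · simpa using q18
        · simpa using q17
        · simpa using q20
        · simpa using qv
        · simpa using q19
    · rintro m' _ ⟨-, -, -, -, h⟩
      exact h hG
  · ring_nf; omega

end

/-! ### Binary digit sums -/

/-- The sum of the `m` lowest binary digits of `x`. -/
def bitSum (m x : ℕ) : ℕ := ∑ c ∈ Finset.range m, x / 2 ^ c % 2

theorem bitSum_succ (m x : ℕ) : bitSum (m + 1) x = x % 2 + bitSum m (x / 2) := by
  rw [bitSum, Finset.sum_range_succ', add_comm]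
  simp [bitSum, pow_succ', Nat.div_div_eq_div_mul]

/-- The carry turns a run of trailing ones into zeros and sets at most one new bit. -/
theorem bitSum_succ_le (m x : ℕ) : bitSum m (x + 1) ≤ bitSum m x + 1 := by
  induction m generalizing x with
  | zero => simp [bitSum]
  | succ m ih =>
    rw [bitSum_succ, bitSum_succ]
    rcases Nat.mod_two_eq_zero_or_one x with h | h
    · rw [show (x + 1) / 2 = x / 2 by omega]; omega
    · rw [show (x + 1) / 2 = x / 2 + 1 by omega]
      have := ih (x / 2); omega

/-- Here `2 ^ t` is the lowest one of `x`. Adding it clears that bit, and the carry sets at most one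
higher bit. -/
theorem bitSum_add_lowbit_le {m x t : ℕ} (h : 2 ^ t ∣ x) (h' : ¬ 2 ^ (t + 1) ∣ x) :
    bitSum m (x + 2 ^ t) ≤ bitSum m x := by
  induction t generalizing m x with
  | zero =>
    cases m with
    | zero => simp [bitSum]
    | succ m =>
      rw [bitSum_succ, bitSum_succ]
      have hx : x % 2 = 1 := by simp at h'; omega
      rw [show (x + 2 ^ 0) / 2 = x / 2 + 1 by simp; omega]
      have := bitSum_succ_le m (x / 2)
      simp only [pow_zero]; omega
  | succ t ih =>
    cases m with
    | zero => simp [bitSum]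
    | succ m =>
      obtain ⟨u, rfl⟩ := h
      rw [bitSum_succ, bitSum_succ]
      have e1 : 2 ^ (t + 1) * u = 2 * (2 ^ t * u) := by ring
      have e2 : 2 ^ (t + 1) * u + 2 ^ (t + 1) = 2 * (2 ^ t * u + 2 ^ t) := by ring
      rw [e2, e1, Nat.mul_div_cancel_left _ (by norm_num), Nat.mul_div_cancel_left _ (by norm_num),
        Nat.mul_mod_right, Nat.mul_mod_right]
      refine Nat.add_le_add_left (ih ⟨u, rfl⟩ fun hd => h' ?_) 0
      rw [e1, pow_succ']
      exact Nat.mul_dvd_mul_left 2 hd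

/-- All `y` in this range agree with `x` from bit `t` on, and `x` has no ones below. Hence jumping
from `x` to `x + 2 ^ t` skips only points with at least as many ones as `x`. -/
theorem bitSum_le_of_lt {m x y t : ℕ} (h : 2 ^ t ∣ x) (h₁ : x ≤ y) (h₂ : y < x + 2 ^ t) :
    bitSum m x ≤ bitSum m y := by
  refine Finset.sum_le_sum fun c _ => ?_
  rcases Nat.lt_or_ge c t with hc | hc
  · have : 2 ^ (c + 1) ∣ x := (pow_dvd_pow 2 (by omega)).trans h
    obtain ⟨u, rfl⟩ := this
    rw [pow_succ, mul_assoc, Nat.mul_div_cancel_left _ (by positivity), Nat.mul_mod_right]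
    exact Nat.zero_le _
  · have h3 : x / 2 ^ t = y / 2 ^ t := by
      obtain ⟨u, rfl⟩ := h
      rw [Nat.mul_div_cancel_left _ (by positivity)]
      symm
      rw [Nat.div_eq_iff (by positivity)]
      constructor
      · rw [mul_comm]; exact h₁
      · have : 0 < 2 ^ t := by positivity
        rw [mul_comm]; omega
    obtain ⟨d, rfl⟩ := Nat.exists_eq_add_of_le hc
    rw [pow_add, ← Nat.div_div_eq_div_mul, ← Nat.div_div_eq_div_mul, h3]

/-- The weight of the sets of `p` positions in the main test. -/
def levelWeight (q p : ℕ) : ℕ := ∏ t ∈ Finset.range q, (q - p + t + 1)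

section

variable {W : ℕ} {ω : ℕ → Bool} {m : ℕ → ℕ} {c : ℕ}

/-- Register `28` becomes the number of ones among the `reg 27` lowest digits of `reg 15`. -/
def countProg : Cmd :=
  .set 28 0 ;; .set 37 (.reg 15) ;; .set 42 (.reg 27) ;;
  (.set 28 (.reg 28 + .reg 37 % 2) ;; .set 37 (.reg 37 / 2)).rep 42

theorem countProg_ht {x k : ℕ} (h15 : m 15 = x) (h27 : m 27 = k) (hx : x < 2 ^ W)
    (hk : k < 2 ^ W) :
    Ht W ω countProg m c (4 * k + 4) fun m' _ => m' 28 = bitSum k x := by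
  apply Ht.le
  · apply Ht.set_seq (by norm_num) (by simp)
    apply Ht.set_seq (by norm_num) (by simpa [h15])
    apply Ht.set_seq (by norm_num) (by simpa [h27])
    refine Ht.mono (Ht.rep (N := k) (T := 2) (fun i m' _ => m' 28 = bitSum i x ∧ m' 37 = x / 2 ^ i)
      (by simp [h27]) (by norm_num) hk (by decide) (by simp [bitSum, h15]) ?_) le_rfl
      fun _ _ h => h.1
    rintro i hi m₁ c₁ ⟨h₁, h₂⟩ hf _
    have hle : bitSum (i + 1) x ≤ i + 1 := by
      refine (Finset.sum_le_card_nsmul _ _ 1 fun c _ => ?_).trans (by simp)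
      have := Nat.mod_lt (x / 2 ^ c) two_pos; omega
    have hs : bitSum i x + x / 2 ^ i % 2 = bitSum (i + 1) x :=
      (Finset.sum_range_succ (fun c => x / 2 ^ c % 2) i).symm
    apply Ht.set_seq (by norm_num)
    · simp only [Exp.ev_add, Exp.ev_mod, Exp.ev_mem, Exp.ev_lit, Exp.ev_ofNat, h₁, h₂, hs]
      omega
    refine Ht.set (by norm_num) ?_ ⟨?_, ?_⟩
    · simpa [h₂] using lt_of_le_of_lt ((Nat.div_le_self _ _).trans (Nat.div_le_self _ _)) hx
    · simp [h₁, h₂, hs]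
    · simp [h₂, pow_succ, Nat.div_div_eq_div_mul]
  · omega

/-- Register `29` becomes the weight of a set of `reg 28` positions. -/
def weightProg : Cmd :=
  .set 29 1 ;; .set 37 (.reg 6 - .reg 28) ;; .set 42 (.reg 6) ;;
  (.set 37 (.reg 37 + 1) ;; .set 29 (.reg 29 * .reg 37)).rep 42

theorem weightProg_ht {q p : ℕ} (h6 : m 6 = q) (h28 : m 28 = p) (hq : 2 * q < 2 ^ W)
    (hqW : (2 * q) ^ q < 2 ^ W) :
    Ht W ω weightProg m c (4 * q + 4) fun m' _ => m' 29 = levelWeight q p := by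
  have hq' : q < 2 ^ W := by omega
  have hW : 1 < 2 ^ W := by
    rcases Nat.eq_zero_or_pos q with rfl | h
    · simpa using hqW
    · omega
  apply Ht.le
  · apply Ht.set_seq (by norm_num) (by simpa using hW)
    apply Ht.set_seq (by norm_num) (by simp [h6, h28]; omega)
    apply Ht.set_seq (by norm_num) (by simpa [h6])
    refine Ht.mono (Ht.rep (N := q) (T := 2) (fun i m' _ => m' 37 = q - p + i ∧
      m' 29 = ∏ t ∈ Finset.range i, (q - p + t + 1)) (by simp [h6]) (by norm_num) hq' (by decide)
      (by simp [h6, h28]) ?_) le_rfl fun _ _ h => h.2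
    rintro i hi m₁ c₁ ⟨h₁, h₂⟩ hf _
    have hle : ∏ t ∈ Finset.range (i + 1), (q - p + t + 1) ≤ (2 * q) ^ q := by
      refine (Finset.prod_le_pow_card _ _ (2 * q) fun t ht => ?_).trans
        (Nat.pow_le_pow_right (by omega) (by simpa using hi))
      have := Finset.mem_range.1 ht; omega
    rw [Finset.prod_range_succ] at hle
    apply Ht.set_seq (by norm_num)
    · simp [h₁]; omega
    refine Ht.set (by norm_num) ?_ ⟨?_, ?_⟩
    · simpa [h₁, h₂] using lt_of_le_of_lt hle hqW
    · simp [h₁]; omega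
    · simp [h₁, h₂, Finset.prod_range_succ]
  · omega

/-- Register `38` becomes the lowest one in the binary representation of `reg 15`. -/
def lowbitProg : Cmd :=
  .set 38 1 ;; .set 42 (.reg 27) ;;
  -- The factor is `2` as long as the doubled power still divides `x`, and `1` from then on.
  (Cmd.set 38 (.reg 38 * (1 + (1 - .reg 15 % (2 * .reg 38))))).rep 42

theorem lowbitProg_ht {x k : ℕ} (h15 : m 15 = x) (h27 : m 27 = k) (hk : 2 ^ k < 2 ^ W) :
    Ht W ω lowbitProg m c (3 * k + 3) fun m' _ => ∃ t ≤ k, m' 38 = 2 ^ t ∧ 2 ^ t ∣ x ∧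
      (t = k ∨ ¬ 2 ^ (t + 1) ∣ x) := by
  have hk' : k < 2 ^ W := Nat.lt_two_pow_self.trans hk
  have hW : 1 < 2 ^ W := lt_of_le_of_lt (Nat.one_le_pow _ _ (by norm_num)) hk
  apply Ht.le
  · apply Ht.set_seq (by norm_num) (by simpa using hW)
    apply Ht.set_seq (by norm_num) (by simpa [h27])
    refine Ht.rep (N := k) (T := 1) (fun i m' _ => ∃ t ≤ i, m' 38 = 2 ^ t ∧ 2 ^ t ∣ x ∧
      (t = i ∨ ¬ 2 ^ (t + 1) ∣ x)) (by simp [h27]) (by norm_num) hk' (by decide) ?_ ?_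
    · exact ⟨0, le_rfl, by simp⟩
    rintro i hi m₁ c₁ ⟨t, hti, h₁, hd, hor⟩ hf _
    have k15 : m₁ 15 = x := by rw [hf 15 rfl]; simp [h15]
    have hv : (Exp.reg 38 * (1 + (1 - .reg 15 % (2 * .reg 38)))).ev m₁ =
        2 ^ t * (1 + (1 - x % 2 ^ (t + 1))) := by simp [h₁, k15, pow_succ']
    by_cases hx : 2 ^ (t + 1) ∣ x
    · have hti' : t = i := by tauto
      have hv' : (Exp.reg 38 * (1 + (1 - .reg 15 % (2 * .reg 38)))).ev m₁ = 2 ^ (t + 1) := by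
        rw [hv, Nat.mod_eq_zero_of_dvd hx, pow_succ]
      refine Ht.set (by norm_num) ?_ ⟨t + 1, by omega, ?_, hx, by omega⟩
      · rw [hv']
        exact lt_of_le_of_lt (Nat.pow_le_pow_right (by norm_num) (by omega)) hk
      · rw [hv']; simp
    · have hv' : (Exp.reg 38 * (1 + (1 - .reg 15 % (2 * .reg 38)))).ev m₁ = 2 ^ t := by
        have : x % 2 ^ (t + 1) ≠ 0 := fun h => hx (Nat.dvd_of_mod_eq_zero h)
        rw [hv, Nat.sub_eq_zero_of_le (by omega), add_zero, mul_one]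
      refine Ht.set (by norm_num) ?_ ⟨t, by omega, ?_, hd, Or.inr hx⟩
      · rw [hv']
        exact lt_of_le_of_lt (Nat.pow_le_pow_right (by norm_num) (by omega)) hk
      · rw [hv']; simp
  · omega

end

/-! ### One trial of the main test -/

/-- The gates at address `66 + n` of the input compute, modulo every number, the function `F`. -/
def Computes (n G : ℕ) (inp : ℕ → ℕ) (F : (ℕ → ℤ) → ℤ) : Prop :=
  ∀ (Q : ℕ) (pt : ℕ → ℤ), ∃ val : ℕ → ZMod Q,
    (∀ g < G, GateOK n (fun i => ((pt i : ℤ) : ZMod Q)) val g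
      (inp (66 + n + 3 * g)) (inp (67 + n + 3 * g)) (inp (68 + n + 3 * g))) ∧
    val (G - 1) = ((F pt : ℤ) : ZMod Q)

/-- The point at which the main test evaluates. -/
def mainPoint (inp : ℕ → ℕ) (j B P ζ γ x σ : ℕ) (i : ℕ) : ℤ :=
  P * (-1) ^ σ * signedForm (fun i => inp (66 + i)) j B (j + j / 2) ζ γ x i

/-- The sign with which an evaluation contributes to the main test. -/
def mainSign (j x σ : ℕ) : ℕ :=
  bitSum (3 * (j / 2) + 1) x + (1 - j % 2) * (x / 2 ^ (3 * (j / 2))) + σ * j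

/-- The evaluations at opposite points carry the relative sign `(-1)^j`, so monomials whose degree
has the other parity than `j` cancel. -/
def mainTerm (F : (ℕ → ℤ) → ℤ) (inp : ℕ → ℕ) (j B P ζ γ x : ℕ) : ℤ :=
  levelWeight (j / 2) (bitSum (3 * (j / 2) + 1) x) *
    ((-1) ^ mainSign j x 0 * F (mainPoint inp j B P ζ γ x 0) +
      (-1) ^ mainSign j x 1 * F (mainPoint inp j B P ζ γ x 1))

/-- The number computed by one trial of the main test. -/
def mainSum (F : (ℕ → ℤ) → ℤ) (inp : ℕ → ℕ) (j B P ζ γ : ℕ) : ℤ :=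
  ∑ x ∈ (Finset.range (2 ^ (3 * (j / 2) + 1))).filter
    (fun x => bitSum (3 * (j / 2) + 1) x ≤ j / 2), mainTerm F inp j B P ζ γ x

/-- Add to register `16` the contribution of one evaluation. -/
def halfProg (σ : ℕ) : Cmd :=
  circuitProg (mainVar (.lit σ)) ;;
  .set 16 ((.reg 16 + .reg 29 * .reg 19 * (1 + (.reg 12 - 2) *
    ((.reg 28 + (1 - .reg 4 % 2) * (.reg 15 / (.reg 26 / 2)) + .lit σ * .reg 4) % 2))) % .reg 12)

/-- Enumerates the points with few ones in increasing order and without memory: from a point with at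
most `q` ones move to the next number, from any other point jump by its lowest one. -/
def stepProg : Cmd :=
  countProg ;;
  .cond (.reg 6 + 1 - .reg 28)
    (weightProg ;; halfProg 0 ;; halfProg 1 ;; .set 15 (.reg 15 + 1))
    (lowbitProg ;; .set 15 (.reg 15 + .reg 38))

def sumProg : Cmd :=
  .set 15 0 ;; .set 16 0 ;; .loop (.reg 26 - .reg 15) stepProg

/-- These registers stay fixed during the summation. The working ones are 15 (the point `x`), 16
(the sum), 17 and 18 (packed gate values and the next power of `Q`), 19 (the current value), 28 and
29 (number of ones and weight). -/
structure MainEnv (n G j B P Q ζ γ : ℕ) (inp m : ℕ → ℕ) : Prop where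
  h1 : m 1 = n
  h2 : m 2 = G
  h4 : m 4 = j
  h6 : m 6 = j / 2
  h7 : m 7 = j + j / 2
  h9 : m 9 = B
  h11 : m 11 = P
  h12 : m 12 = Q
  h13 : m 13 = ζ
  h14 : m 14 = γ
  h26 : m 26 = 2 ^ (3 * (j / 2) + 1)
  h27 : m 27 = 3 * (j / 2) + 1
  input : ∀ a, 64 ≤ a → m a = inp a

theorem MainEnv.of_frame {n G j B P Q ζ γ : ℕ} {inp m m' : ℕ → ℕ}
    (h : MainEnv n G j B P Q ζ γ inp m)
    (hf : ∀ a ∈ [1, 2, 4, 6, 7, 9, 11, 12, 13, 14, 26, 27], m' a = m a)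
    (hi : ∀ a, 64 ≤ a → m' a = m a) : MainEnv n G j B P Q ζ γ inp m' where
  h1 := by rw [hf _ (by simp), h.h1]
  h2 := by rw [hf _ (by simp), h.h2]
  h4 := by rw [hf _ (by simp), h.h4]
  h6 := by rw [hf _ (by simp), h.h6]
  h7 := by rw [hf _ (by simp), h.h7]
  h9 := by rw [hf _ (by simp), h.h9]
  h11 := by rw [hf _ (by simp), h.h11]
  h12 := by rw [hf _ (by simp), h.h12]
  h13 := by rw [hf _ (by simp), h.h13]
  h14 := by rw [hf _ (by simp), h.h14]
  h26 := by rw [hf _ (by simp), h.h26]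
  h27 := by rw [hf _ (by simp), h.h27]
  input := fun a ha => by rw [hi a ha, h.input a ha]

theorem MainEnv.update {n G j B P Q ζ γ : ℕ} {inp m : ℕ → ℕ} {r v : ℕ}
    (h : MainEnv n G j B P Q ζ γ inp m)
    (hr : r ∉ [1, 2, 4, 6, 7, 9, 11, 12, 13, 14, 26, 27]) (hr' : r < 64) :
    MainEnv n G j B P Q ζ γ inp (Function.update m r v) :=
  h.of_frame (fun a ha => Function.update_of_ne (fun hh : a = r => hr (by rwa [← hh])) _ _)
    (fun a ha => Function.update_of_ne (by omega) _ _)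

structure MainBounds (W n G j B Q : ℕ) (inp : ℕ → ℕ) : Prop where
  hG : 0 < G
  hB : 0 < B
  hQ : 0 < Q
  hQW : Q ^ G < 2 ^ W
  hGW : G < 2 ^ W
  hj : j < 2 ^ W
  hnj : n * j < 2 ^ W
  hBW : B ^ (n * j) < 2 ^ W
  -- One bit more than the cube needs: `x + 2 ^ t` has to fit before it is compared with `2 ^ (3 *
  -- (j / 2) + 1)`.
  hm : 3 * (j / 2) + 2 ≤ W
  hq : (2 * (j / 2)) ^ (j / 2) < 2 ^ W
  hin : ∀ a, 64 ≤ a → inp a < 2 ^ W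

/-- A bound for the number of steps of one evaluation of the circuit in the main test. -/
def evalCost (n G j : ℕ) : ℕ :=
  G * (j * (3 * (n * j) + 3 * (j + j / 2) + 12) + 6 * G + 26) + 6

section

variable {W : ℕ} {ω : ℕ → Bool} {m : ℕ → ℕ} {c n G j B P Q ζ γ : ℕ} {inp : ℕ → ℕ}
  {F : (ℕ → ℤ) → ℤ}

theorem halfProg_ht {x σ w : ℕ} (hb : MainBounds W n G j B Q inp)
    (he : MainEnv n G j B P Q ζ γ inp m) (hF : Computes n G inp F)
    (h15 : m 15 = x) (h29 : m 29 = w) (h28 : m 28 = bitSum (3 * (j / 2) + 1) x) :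
    Ht W ω (halfProg σ) m c (evalCost n G j) fun m' _ => m' 16 < Q ∧
      ((m' 16 : ℕ) : ZMod Q) = (m 16 : ZMod Q) +
        ((w * ((-1) ^ mainSign j x σ * F (mainPoint inp j B P ζ γ x σ)) : ℤ) : ZMod Q) := by
  obtain ⟨val, hval, hlast⟩ := hF Q (mainPoint inp j B P ζ γ x σ)
  have hQle : Q ≤ 2 ^ W := (Nat.le_self_pow hb.hG.ne' _).trans hb.hQW.le
  have hM : j + j / 2 < W := by have := hb.hm; omega
  apply Ht.le
  · apply Ht.seq (circuitProg_ht (T := j * (3 * (n * j) + 3 * (j + j / 2) + 12) + 5)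
      (pt := fun i => ((mainPoint inp j B P ζ γ x σ i : ℤ) : ZMod Q)) (val := val)
      he.h1 he.h2 he.h12 hb.hG hb.hQ hb.hQW hb.hGW (fun a ha => by rw [he.input a ha]; exact hb.hin a ha)
      (fun g hg => by
        rw [he.input _ (by omega), he.input _ (by omega), he.input _ (by omega)]
        exact hval g hg)
      (fun r hr => by
        simp only [List.mem_cons, List.not_mem_nil, or_false] at hr
        rcases hr with rfl | rfl | rfl | rfl | rfl | rfl <;> rfl)
      (fun m₁ c₁ h22 hf hi => by
        have he₁ : MainEnv n G j B P Q ζ γ inp m₁ := he.of_frame (fun a ha => hf a (by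
          simp only [List.mem_cons, List.not_mem_nil, or_false] at ha
          rcases ha with rfl | rfl | rfl | rfl | rfl | rfl | rfl | rfl | rfl | rfl | rfl | rfl <;>
            rfl)) hi
        exact mainVar_ht (e := fun i => inp (66 + i)) (σ := σ) he₁.h4 he₁.h7 he₁.h9 he₁.h11 he₁.h12
          he₁.h13 he₁.h14 (by rw [hf 15 rfl, h15]) rfl (fun i _ => he₁.input _ (by omega))
          (fun _ => rfl) h22 (by omega) hb.hB hb.hQ hb.hj hb.hnj hb.hBW
          (Nat.pow_lt_pow_right (by norm_num) hM) hQle))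
    rintro m₁ c₁ ⟨k19, k19'⟩ hf hi _
    rw [hlast] at k19'
    have k16 : m₁ 16 = m 16 := hf 16 rfl
    have k29 : m₁ 29 = w := by rw [hf 29 rfl, h29]
    have k28 : m₁ 28 = bitSum (3 * (j / 2) + 1) x := by rw [hf 28 rfl, h28]
    have k12 : m₁ 12 = Q := by rw [hf 12 rfl, he.h12]
    have k4 : m₁ 4 = j := by rw [hf 4 rfl, he.h4]
    have k15 : m₁ 15 = x := by rw [hf 15 rfl, h15]
    have k26 : m₁ 26 = 2 ^ (3 * (j / 2) + 1) := by rw [hf 26 rfl, he.h26]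
    have hv : ((Exp.reg 16 + .reg 29 * .reg 19 * (1 + (.reg 12 - 2) *
        ((.reg 28 + (1 - .reg 4 % 2) * (.reg 15 / (.reg 26 / 2)) + .lit σ * .reg 4) % 2))) %
        .reg 12).ev m₁ = (m 16 + w * m₁ 19 * (1 + (Q - 2) * (mainSign j x σ % 2))) % Q := by
      simp [k16, k29, k28, k12, k4, k15, k26, mainSign, pow_succ]
    refine Ht.set (by norm_num) ?_ ⟨?_, ?_⟩
    · rw [hv]; exact (Nat.mod_lt _ hb.hQ).trans_le hQle
    · rw [hv]; simpa using Nat.mod_lt _ hb.hQ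
    · rw [hv, Function.update_self, ZMod.natCast_mod, Nat.cast_add, Nat.cast_mul, Nat.cast_mul,
        natCast_signFactor hb.hQ, k19']
      push_cast
      ring
  · unfold evalCost; ring_nf; omega

/-- A bound for the number of steps for one value of the enumeration. -/
def stepCost (n G j : ℕ) : ℕ := 2 * evalCost n G j + 20 * j + 100

theorem stepProg_ht {x : ℕ} (hb : MainBounds W n G j B Q inp)
    (he : MainEnv n G j B P Q ζ γ inp m) (hF : Computes n G inp F)
    (h15 : m 15 = x) (hx : x < 2 ^ (3 * (j / 2) + 1)) (h16 : m 16 < Q) :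
    Ht W ω stepProg m c (stepCost n G j) fun m' _ => m' 16 < Q ∧
      (bitSum (3 * (j / 2) + 1) x ≤ j / 2 → m' 15 = x + 1 ∧ ((m' 16 : ℕ) : ZMod Q) =
        (m 16 : ZMod Q) + ((mainTerm F inp j B P ζ γ x : ℤ) : ZMod Q)) ∧
      (j / 2 < bitSum (3 * (j / 2) + 1) x → m' 16 = m 16 ∧ ∃ t ≤ 3 * (j / 2) + 1,
        m' 15 = x + 2 ^ t ∧ 2 ^ t ∣ x ∧ ¬ 2 ^ (t + 1) ∣ x) := by
  have hpow : 2 ^ (3 * (j / 2) + 2) ≤ 2 ^ W := Nat.pow_le_pow_right (by norm_num) hb.hm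
  have hpow' : 2 ^ (3 * (j / 2) + 2) = 2 * 2 ^ (3 * (j / 2) + 1) := by ring
  have hm' : 3 * (j / 2) + 1 < 2 ^ (3 * (j / 2) + 1) := Nat.lt_two_pow_self
  apply Ht.le
  · apply Ht.seq (countProg_ht h15 he.h27 (by omega) (by omega))
    intro m₁ c₁ k28 hf₁ hi₁ _
    have he₁ : MainEnv n G j B P Q ζ γ inp m₁ := he.of_frame (fun a ha => hf₁ a (by
      simp only [List.mem_cons, List.not_mem_nil, or_false] at ha
      rcases ha with rfl | rfl | rfl | rfl | rfl | rfl | rfl | rfl | rfl | rfl | rfl | rfl <;>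
        rfl)) hi₁
    have k15 : m₁ 15 = x := by rw [hf₁ 15 rfl, h15]
    have k16 : m₁ 16 = m 16 := hf₁ 16 rfl
    have hcond : (Exp.reg 6 + 1 - .reg 28).ev m₁ = j / 2 + 1 - bitSum (3 * (j / 2) + 1) x := by
      simp [he₁.h6, k28]
    refine Ht.cond (T := 2 * evalCost n G j + 9 * j + 50) (fun ht => ?_) (fun ht => ?_)
    · rw [hcond] at ht
      have hle : bitSum (3 * (j / 2) + 1) x ≤ j / 2 := by omega
      apply Ht.le
      · apply Ht.seq (weightProg_ht he₁.h6 k28 (by omega) hb.hq)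
        intro m₂ c₂ k29 hf₂ hi₂ _
        have he₂ : MainEnv n G j B P Q ζ γ inp m₂ := he₁.of_frame (fun a ha => hf₂ a (by
          simp only [List.mem_cons, List.not_mem_nil, or_false] at ha
          rcases ha with rfl | rfl | rfl | rfl | rfl | rfl | rfl | rfl | rfl | rfl | rfl | rfl <;>
            rfl)) hi₂
        have l15 : m₂ 15 = x := by rw [hf₂ 15 rfl, k15]
        apply Ht.seq (halfProg_ht (σ := 0) hb he₂ hF l15 k29 (by rw [hf₂ 28 rfl, k28]))
        rintro m₃ c₃ ⟨-, p16⟩ hf₃ hi₃ _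
        have he₃ : MainEnv n G j B P Q ζ γ inp m₃ := he₂.of_frame (fun a ha => hf₃ a (by
          simp only [List.mem_cons, List.not_mem_nil, or_false] at ha
          rcases ha with rfl | rfl | rfl | rfl | rfl | rfl | rfl | rfl | rfl | rfl | rfl | rfl <;>
            rfl)) hi₃
        have p15 : m₃ 15 = x := by rw [hf₃ 15 rfl, l15]
        apply Ht.seq (halfProg_ht (σ := 1) hb he₃ hF p15 (by rw [hf₃ 29 rfl, k29])
          (by rw [hf₃ 28 rfl, hf₂ 28 rfl, k28]))
        rintro m₄ c₄ ⟨q16, q16'⟩ hf₄ hi₄ _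
        refine Ht.set (by norm_num) ?_ ⟨?_, ?_, ?_⟩
        · simp [hf₄ 15 rfl, p15]; omega
        · simpa using q16
        · intro _
          refine ⟨by simp [hf₄ 15 rfl, p15], ?_⟩
          rw [Function.update_of_ne (by norm_num), q16', p16, hf₂ 16 rfl, k16, mainTerm]
          push_cast
          ring
        · intro h; omega
      · omega
    · rw [hcond] at ht
      have hlt : j / 2 < bitSum (3 * (j / 2) + 1) x := by omega
      apply Ht.le
      · apply Ht.seq (lowbitProg_ht k15 he₁.h27 (by omega))
        rintro m₂ c₂ ⟨t, ht, l38, hd, hor⟩ hf₂ hi₂ _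
        have hx0 : 0 < x := by
          rcases Nat.eq_zero_or_pos x with rfl | h
          · simp [bitSum] at hlt
          · exact h
        have hnd : ¬ 2 ^ (t + 1) ∣ x := by
          rcases hor with rfl | h
          · exact fun _ => absurd (Nat.le_of_dvd hx0 hd) (by omega)
          · exact h
        have htle : 2 ^ t ≤ 2 ^ (3 * (j / 2) + 1) := Nat.pow_le_pow_right (by norm_num) ht
        refine Ht.set (by norm_num) ?_ ⟨?_, ?_, ?_⟩
        · simp [hf₂ 15 rfl, k15, l38]; omega
        · simpa [hf₂ 16 rfl, k16] using h16
        · intro h; omega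
        · intro _
          exact ⟨by simp [hf₂ 16 rfl, k16], t, ht, by simp [hf₂ 15 rfl, k15, l38], hd, hnd⟩
      · omega
  · unfold stepCost; omega

/-- Every visited point of the cube has at most `q + 1` ones: a unit step from a point with at most
`q` ones adds at most one, and a jump adds none. The number of such points not yet passed is the
variant, so the cost is governed by the low levels of the cube and not by its size. -/
theorem sumProg_ht (hb : MainBounds W n G j B Q inp)
    (he : MainEnv n G j B P Q ζ γ inp m) (hF : Computes n G inp F) :
    Ht W ω sumProg m c (((Finset.range (2 ^ (3 * (j / 2) + 1))).filter
        (fun x => bitSum (3 * (j / 2) + 1) x ≤ j / 2 + 1)).card * (stepCost n G j + 1) + 3)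
      fun m' _ => m' 16 < Q ∧
        ((m' 16 : ℕ) : ZMod Q) = ((mainSum F inp j B P ζ γ : ℤ) : ZMod Q) := by
  have hW : 0 < 2 ^ W := by positivity
  set K := 3 * (j / 2) + 1 with hK
  apply Ht.le
  · apply Ht.set_seq (by norm_num) (by simp)
    apply Ht.set_seq (by norm_num) (by simp)
    refine Ht.mono (Ht.loop (T := stepCost n G j)
      (v := ((Finset.range (2 ^ K)).filter (fun x => bitSum K x ≤ j / 2 + 1)).card)
      (fun v m₁ _ => ∃ x, MainEnv n G j B P Q ζ γ inp m₁ ∧ m₁ 15 = x ∧ x ≤ 2 ^ K ∧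
        (x < 2 ^ K → bitSum K x ≤ j / 2 + 1) ∧ m₁ 16 < Q ∧
        v = ((Finset.range (2 ^ K)).filter (fun y => x ≤ y ∧ bitSum K y ≤ j / 2 + 1)).card ∧
        ((m₁ 16 : ℕ) : ZMod Q) = ((∑ y ∈ (Finset.range x).filter (fun y => bitSum K y ≤ j / 2),
          mainTerm F inp j B P ζ γ y : ℤ) : ZMod Q)) ?_ ?_) le_rfl ?_
    · refine ⟨0, (he.update (by simp) (by norm_num)).update (by simp) (by norm_num), by simp,
        Nat.zero_le _, by simp [bitSum], by simpa using hb.hQ, by simp, by simp⟩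
    · rintro v m₁ c₁ ⟨x, he₁, h15, hx, hxb, h16, hv, hacc⟩ hcond hf hi
      have hx' : x < 2 ^ K := by
        have : 2 ^ K - x ≠ 0 := by simpa [he₁.h26, h15, hK] using hcond
        omega
      refine Ht.frame (stepProg_ht hb he₁ hF h15 hx' h16) ?_
      rintro m₂ c₂ ⟨k16, h₁, h₂⟩ hf₂ hi₂ _
      have he₂ : MainEnv n G j B P Q ζ γ inp m₂ := he₁.of_frame (fun a ha => hf₂ a (by
        simp only [List.mem_cons, List.not_mem_nil, or_false] at ha
        rcases ha with rfl | rfl | rfl | rfl | rfl | rfl | rfl | rfl | rfl | rfl | rfl | rfl <;>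
          rfl)) hi₂
      have hcard : ∀ x', x < x' → ((Finset.range (2 ^ K)).filter
          (fun y => x' ≤ y ∧ bitSum K y ≤ j / 2 + 1)).card < v := by
        intro x' hxx'
        rw [hv]
        refine Finset.card_lt_card (Finset.ssubset_iff_of_subset ?_ |>.2 ⟨x, ?_, ?_⟩)
        · intro y hy
          simp only [Finset.mem_filter] at hy ⊢
          exact ⟨hy.1, by omega, hy.2.2⟩
        · simp [hx', hxb hx']
        · simp only [Finset.mem_filter, not_and]; omega
      rcases Nat.lt_or_ge (j / 2) (bitSum K x) with hlt | hle
      · obtain ⟨k16', t, ht, k15, hd, hnd⟩ := h₂ hlt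
        refine ⟨_, hcard (x + 2 ^ t) (by have : 0 < 2 ^ t := by positivity
                                         omega), x + 2 ^ t, he₂, k15, ?_, ?_, k16, rfl, ?_⟩
        -- Both `x` and `2 ^ K` are multiples of `2 ^ t`, so a jump cannot overshoot the end of the
        -- cube.
        · obtain ⟨u, rfl⟩ := hd
          obtain ⟨d, hd⟩ := Nat.exists_eq_add_of_le ht
          rw [hK, hd, pow_add] at hx' ⊢
          have := Nat.lt_of_mul_lt_mul_left hx'
          calc 2 ^ t * u + 2 ^ t = 2 ^ t * (u + 1) := by ring
            _ ≤ _ := Nat.mul_le_mul_left _ this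
        · exact fun _ => (bitSum_add_lowbit_le hd hnd).trans (hxb hx')
        · rw [k16', hacc]
          congr 1
          -- The points skipped by the jump have more than `q` ones and contribute nothing.
          refine Finset.sum_congr ?_ fun _ _ => rfl
          ext y
          simp only [Finset.mem_filter, Finset.mem_range]
          constructor
          · rintro ⟨h1, h2⟩; exact ⟨by omega, h2⟩
          · rintro ⟨h1, h2⟩
            refine ⟨?_, h2⟩
            by_contra hcon
            have := bitSum_le_of_lt (m := K) hd (by omega : x ≤ y) h1
            omega
      · obtain ⟨k15, k16'⟩ := h₁ hle
        refine ⟨_, hcard (x + 1) (by omega), x + 1, he₂, k15, hx', ?_, k16, rfl, ?_⟩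
        · intro _
          have := bitSum_succ_le K x; omega
        · rw [k16', hacc, Finset.range_add_one, Finset.filter_insert, if_pos hle,
            Finset.sum_insert (by simp)]
          push_cast
          ring
    · rintro m₁ c₁ ⟨hcond, v, x, he₁, h15, hx, hxb, h16, hv, hacc⟩
      have hx' : x = 2 ^ K := by
        have : 2 ^ K - x = 0 := by simpa [he₁.h26, h15, hK] using hcond
        omega
      subst hx'
      exact ⟨h16, hacc⟩
  · omega

end

/-! ### Trials -/

/-- Repeat a trial `cnt` times, each time with a fresh random number of `len` bits in `reg 10`. -/
def trialsProg (cnt len : Exp) (trial : Cmd) : Cmd :=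
  .set 24 cnt ;; (drawProg len ;; trial).rep 24

/-- One trial of the main test, which raises the flag in register `0` if it succeeds. -/
def mainTrial : Cmd :=
  -- The draw is read in base `B`: its lowest digit plus one is `P`, the next `n * j` digits are the
  -- weights `ζ`, the rest are the colours `γ`.
  .set 11 (.reg 10 % .reg 9 + 1) ;;
  powProg 31 (.reg 9) (.reg 1 * .reg 4) ;;
  .set 13 (.reg 10 / .reg 9 % .reg 31) ;;
  .set 14 (.reg 10 / .reg 9 / .reg 31) ;;
  powProg 12 (.reg 11) (.reg 4 + 1) ;;
  sumProg ;;
  -- `1 - (1 - a)` is `0` for `a = 0` and `1` otherwise, so this is a logical or.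
  .set 0 (1 - (1 - (.reg 0 + .reg 16)))

/-- The random number `ρ` makes a trial of the main test succeed. -/
def MainGood (F : (ℕ → ℤ) → ℤ) (inp : ℕ → ℕ) (n j B ρ : ℕ) : Prop :=
  ¬ ((ρ % B + 1 : ℕ) : ℤ) ^ (j + 1) ∣
    mainSum F inp j B (ρ % B + 1) (ρ / B % B ^ (n * j)) (ρ / B / B ^ (n * j))

/-- One trial of the degree test, which raises the flag in register `25` if it succeeds. -/
def degreeTrial : Cmd :=
  .set 12 (.reg 10 % .reg 9 + 1) ;; .set 13 (.reg 10 / .reg 9) ;;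
  .set 16 0 ;; .set 29 1 ;; .set 45 0 ;; .set 46 (.reg 4 + 2) ;;
  (circuitProg degreeVar ;;
    .set 16 ((.reg 16 + .reg 29 * .reg 19 * (1 + (.reg 12 - 2) * (.reg 45 % 2))) % .reg 12) ;;
    -- The recursion `C(j+1, t+1) = C(j+1, t) (j+1-t) / (t+1)`, whose division is exact.
    .set 29 (.reg 29 * (.reg 4 + 1 - .reg 45) / (.reg 45 + 1)) ;;
    .set 45 (.reg 45 + 1)).rep 46 ;;
  .set 25 (1 - (1 - (.reg 25 + .reg 16)))

/-- The number computed by one trial of the degree test. -/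
def degreeSum (F : (ℕ → ℤ) → ℤ) (j B ζ : ℕ) : ℤ :=
  ∑ t ∈ Finset.range (j + 2), (-1) ^ t * ((j + 1).choose t : ℤ) * F fun v => t * digit B ζ v

/-- The random number `ρ` makes a trial of the degree test succeed. -/
def DegreeGood (F : (ℕ → ℤ) → ℤ) (j B ρ : ℕ) : Prop :=
  ¬ ((ρ % B + 1 : ℕ) : ℤ) ∣ degreeSum F j B (ρ / B)

section

variable {W : ℕ} {ω : ℕ → Bool} {m : ℕ → ℕ} {c n G j B : ℕ} {inp : ℕ → ℕ} {F : (ℕ → ℤ) → ℤ}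

/-- The trial itself tosses no coins, so trial `t` depends on exactly the `L` coins from `c + t * L`
on. These blocks are disjoint, which is what makes the trials independent. -/
theorem trialsProg_ht {cnt len : Exp} {trial : Cmd} {fr T L Tc : ℕ} {good : ℕ → Prop}
    (hcnt : cnt.ev m = T) (hT : T < 2 ^ W) (hL : L ≤ W) (hW : 0 < W)
    (hlen : ∀ m₁, (∀ a, a ≠ 24 → ((drawProg len ;; trial).rep 24).wr a = false → m₁ a = m a) →
      (∀ a, 64 ≤ a → m₁ a = m a) → len.ev m₁ = L)
    (hfr : fr ≠ 24 ∧ fr ≠ 10 ∧ fr ≠ 43 ∧ fr ≠ 44) (htoss : trial.tosses = false)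
    (hwr : trial.wr 24 = false) (hm : m fr ≤ 1)
    (htrial : ∀ m₁ c₁, m₁ fr ≤ 1 → m₁ 10 < 2 ^ L →
      (∀ a, a ≠ 10 → a ≠ 24 → ((drawProg len ;; trial).rep 24).wr a = false → m₁ a = m a) →
      (∀ a, 64 ≤ a → m₁ a = m a) →
      Ht W ω trial m₁ c₁ Tc fun m' _ => m' fr ≤ 1 ∧ (m' fr ≠ 0 ↔ m₁ fr ≠ 0 ∨ good (m₁ 10))) :
    Ht W ω (trialsProg cnt len trial) m c (T * (Tc + 4 * L + 5) + 2) fun m' c' =>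
      c' = c + T * L ∧ m' fr ≤ 1 ∧
      (m' fr ≠ 0 ↔ m fr ≠ 0 ∨ ∃ t < T, good (coinNumber ω (c + t * L) L)) := by
  obtain ⟨h24, h10, h43, h44⟩ := hfr
  apply Ht.le
  · apply Ht.set_seq (by norm_num) (by rwa [hcnt])
    refine Ht.mono (Ht.rep (N := T) (T := Tc + 4 * L + 3) (fun i m' c' =>
      c' = c + i * L ∧ m' fr ≤ 1 ∧
      (m' fr ≠ 0 ↔ m fr ≠ 0 ∨ ∃ t < i, good (coinNumber ω (c + t * L) L))) (by simp [hcnt])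
      (by norm_num) hT (by simp [drawProg, Cmd.rep, Cmd.wr, Exp.hits, hwr])
      (by simpa [h24] using hm) ?_) le_rfl fun _ _ h => h
    rintro i hi m₁ c₁ ⟨rfl, hle, hiff⟩ hf hin
    have hf' : ∀ a, a ≠ 24 → ((drawProg len ;; trial).rep 24).wr a = false → m₁ a = m a := by
      intro a h1 h2
      rw [hf a h2, Function.update_of_ne h1]
    have hin' : ∀ a, 64 ≤ a → m₁ a = m a := by
      intro a h
      rw [hin a h, Function.update_of_ne (by omega)]
    apply Ht.le
    · apply Ht.seq (drawProg_ht (hlen m₁ hf' hin') hL hW)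
      rintro m₂ c₂ ⟨k10, rfl⟩ hf₂ hi₂ _
      have kfr : m₂ fr = m₁ fr := hf₂ fr (by
        simp [drawProg, Cmd.rep, Cmd.wr, Exp.hits, h10, h43, h44])
      refine Ht.frame (htrial m₂ _ (by rwa [kfr]) (by rw [k10]; exact coinNumber_lt _ _ _) ?_ ?_) ?_
      · intro a h1 h2 h3
        rw [hf₂ a, hf' a h2 h3]
        simp only [Cmd.rep, Cmd.wr, Bool.or_eq_false_iff] at h3
        exact h3.1.1
      · intro a h
        rw [hi₂ a h, hin' a h]
      · rintro m₃ c₃ ⟨h1, h2⟩ _ _ hc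
        have hc' := hc htoss
        refine ⟨by rw [hc']; ring, ?_, ?_⟩
        · rwa [Function.update_of_ne h24]
        · rw [Function.update_of_ne h24, h2, kfr, hiff, k10, or_assoc]
          refine or_congr_right ⟨?_, ?_⟩
          · rintro (⟨t, ht, hg⟩ | hg)
            · exact ⟨t, by omega, hg⟩
            · exact ⟨i, by omega, hg⟩
          · rintro ⟨t, ht, hg⟩
            rcases Nat.lt_succ_iff_lt_or_eq.1 ht with h | rfl
            · exact Or.inl ⟨t, h, hg⟩
            · exact Or.inr hg
    · omega
  · ring_nf; omega

theorem flag_le (x : ℕ) : 1 - (1 - x) ≤ 1 := by omega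

structure StageEnv (n G j B : ℕ) (inp m : ℕ → ℕ) : Prop where
  h1 : m 1 = n
  h2 : m 2 = G
  h4 : m 4 = j
  h6 : m 6 = j / 2
  h7 : m 7 = j + j / 2
  h9 : m 9 = B
  h26 : m 26 = 2 ^ (3 * (j / 2) + 1)
  h27 : m 27 = 3 * (j / 2) + 1
  input : ∀ a, 64 ≤ a → m a = inp a

structure TrialBounds (W n G j B : ℕ) (inp : ℕ → ℕ) : Prop where
  hG : 0 < G
  hB : 0 < B
  hQW : (B ^ (j + 1)) ^ G < 2 ^ W
  hGW : G < 2 ^ W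
  hj : j + 2 < 2 ^ W
  hn : n < 2 ^ W
  hnj : n * j < 2 ^ W
  hBn : B ^ n < 2 ^ W
  hBW : B ^ (n * j) < 2 ^ W
  hm : 3 * (j / 2) + 3 ≤ W
  hq : (2 * (j / 2)) ^ (j / 2) < 2 ^ W
  hin : ∀ a, 64 ≤ a → inp a < 2 ^ W

theorem TrialBounds.pow_lt {P : ℕ} (hb : TrialBounds W n G j B inp) (hP : P ≤ B) :
    (P ^ (j + 1)) ^ G < 2 ^ W :=
  lt_of_le_of_lt (Nat.pow_le_pow_left (Nat.pow_le_pow_left hP _) _) hb.hQW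

/-- A bound for the number of steps of a trial of the main test. -/
def mainTrialCost (n G j : ℕ) : ℕ :=
  ((Finset.range (2 ^ (3 * (j / 2) + 1))).filter
    (fun x => bitSum (3 * (j / 2) + 1) x ≤ j / 2 + 1)).card * (stepCost n G j + 1) +
    3 * (n * j) + 3 * j + 16

theorem mainTrial_ht (hb : TrialBounds W n G j B inp) (he : StageEnv n G j B inp m)
    (hF : Computes n G inp F) (h0 : m 0 ≤ 1) (h10 : m 10 < 2 ^ W) :
    Ht W ω mainTrial m c (mainTrialCost n G j) fun m' _ => m' 0 ≤ 1 ∧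
      (m' 0 ≠ 0 ↔ m 0 ≠ 0 ∨ MainGood F inp n j B (m 10)) := by
  generalize hρ : m 10 = ρ at h10
  have hPB : ρ % B + 1 ≤ B := Nat.mod_lt _ hb.hB
  have hBW1 : B < 2 ^ W := lt_of_le_of_lt ((Nat.le_self_pow (by omega) B).trans
    (Nat.le_self_pow hb.hG.ne' _)) hb.hQW
  have hQ1 : 0 < (ρ % B + 1) ^ (j + 1) := by positivity
  have hQW := hb.pow_lt hPB
  have hW : 1 < 2 ^ W := lt_of_le_of_lt (Nat.one_le_pow _ _ hQ1) hQW
  apply Ht.le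
  · apply Ht.set_seq (by norm_num)
    · simp only [Exp.ev_add, Exp.ev_mod, Exp.ev_mem, Exp.ev_lit, Exp.ev_ofNat, hρ, he.h9]
      omega
    have e11 : (Exp.reg 10 % .reg 9 + 1).ev m = ρ % B + 1 := by simp [hρ, he.h9]
    rw [e11]
    apply Ht.seq (powProg_ht (b := B) (e := n * j) (by norm_num) (by norm_num)
      (by simp [he.h1, he.h4]) (fun m' h' => by simp [h' 9, he.h9]) (fun _ => hb.hB) hb.hnj hb.hBW)
    intro m₁ c₁ k31 hf₁ hi₁ _
    have k10 : m₁ 10 = ρ := by rw [hf₁ 10 rfl]; simp [hρ]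
    have k9 : m₁ 9 = B := by rw [hf₁ 9 rfl]; simp [he.h9]
    have e13 : (Exp.reg 10 / .reg 9 % .reg 31).ev m₁ = ρ / B % B ^ (n * j) := by
      simp [k10, k9, k31]
    apply Ht.set_seq (by norm_num)
    · rw [e13]
      exact lt_of_le_of_lt ((Nat.mod_le _ _).trans (Nat.div_le_self _ _)) h10
    rw [e13]
    have e14 : (Exp.reg 10 / .reg 9 / .reg 31).ev
        (Function.update m₁ 13 (ρ / B % B ^ (n * j))) = ρ / B / B ^ (n * j) := by
      simp [k10, k9, k31]
    apply Ht.set_seq (by norm_num)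
    · rw [e14]
      exact lt_of_le_of_lt ((Nat.div_le_self _ _).trans (Nat.div_le_self _ _)) h10
    rw [e14]
    apply Ht.seq (powProg_ht (b := ρ % B + 1) (e := j + 1) (by norm_num) (by norm_num)
      (by simp [hf₁ 4 rfl, he.h4]) (fun m' h' => by simp [h' 11, hf₁ 11 rfl]) (fun _ => by omega)
      (by have := hb.hj; omega) (lt_of_le_of_lt (Nat.le_self_pow hb.hG.ne' _) hQW))
    intro m₂ c₂ k12 hf₂ hi₂ _
    have he₂ : MainEnv n G j B (ρ % B + 1) ((ρ % B + 1) ^ (j + 1)) (ρ / B % B ^ (n * j))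
        (ρ / B / B ^ (n * j)) inp m₂ :=
      { h1 := by rw [hf₂ 1 rfl]; simp [hf₁ 1 rfl, he.h1]
        h2 := by rw [hf₂ 2 rfl]; simp [hf₁ 2 rfl, he.h2]
        h4 := by rw [hf₂ 4 rfl]; simp [hf₁ 4 rfl, he.h4]
        h6 := by rw [hf₂ 6 rfl]; simp [hf₁ 6 rfl, he.h6]
        h7 := by rw [hf₂ 7 rfl]; simp [hf₁ 7 rfl, he.h7]
        h9 := by rw [hf₂ 9 rfl]; simp [hf₁ 9 rfl, he.h9]
        h11 := by rw [hf₂ 11 rfl]; simp [hf₁ 11 rfl]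
        h12 := k12
        h13 := by rw [hf₂ 13 rfl]; simp
        h14 := by rw [hf₂ 14 rfl]; simp
        h26 := by rw [hf₂ 26 rfl]; simp [hf₁ 26 rfl, he.h26]
        h27 := by rw [hf₂ 27 rfl]; simp [hf₁ 27 rfl, he.h27]
        input := fun a ha => by
          rw [hi₂ a ha, Function.update_of_ne (by omega), Function.update_of_ne (by omega),
            hi₁ a ha, Function.update_of_ne (by omega), he.input a ha] }
    have hmb : MainBounds W n G j B ((ρ % B + 1) ^ (j + 1)) inp :=
      ⟨hb.hG, hb.hB, hQ1, hQW, hb.hGW, by have := hb.hj; omega, hb.hnj, hb.hBW, by have := hb.hm; omega, hb.hq,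
        hb.hin⟩
    apply Ht.seq (sumProg_ht hmb he₂ hF)
    rintro m₃ c₃ ⟨q16, q16'⟩ hf₃ hi₃ _
    have p0 : m₃ 0 = m 0 := by rw [hf₃ 0 rfl, hf₂ 0 rfl]; simp [hf₁ 0 rfl]
    have e0 : (1 - (1 - (Exp.reg 0 + .reg 16))).ev m₃ = 1 - (1 - (m 0 + m₃ 16)) := by simp [p0]
    have h16 : m₃ 16 = 0 ↔ ((ρ % B + 1 : ℕ) : ℤ) ^ (j + 1) ∣ mainSum F inp j B (ρ % B + 1)
        (ρ / B % B ^ (n * j)) (ρ / B / B ^ (n * j)) := by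
      rw [← Nat.cast_pow, ← ZMod.intCast_zmod_eq_zero_iff_dvd, ← q16', ZMod.natCast_eq_zero_iff]
      exact ⟨fun h => by simp [h], fun h => Nat.eq_zero_of_dvd_of_lt h q16⟩
    refine Ht.set (by norm_num) ?_ ⟨?_, ?_⟩
    · rw [e0]; exact lt_of_le_of_lt (flag_le _) hW
    · rw [e0]; simp
    · rw [e0, Function.update_self, MainGood, ← h16]
      omega
  · unfold mainTrialCost; omega

/-- A bound for the number of steps of a trial of the degree test. -/
def degreeTrialCost (n G j : ℕ) : ℕ := (j + 2) * (G * (3 * n + 6 * G + 25) + 10) + 10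

theorem degreeTrial_ht (hb : TrialBounds W n G j B inp) (he : StageEnv n G j B inp m)
    (hF : Computes n G inp F) (h25 : m 25 ≤ 1) (h10 : m 10 < 2 ^ W) :
    Ht W ω degreeTrial m c (degreeTrialCost n G j) fun m' _ => m' 25 ≤ 1 ∧
      (m' 25 ≠ 0 ↔ m 25 ≠ 0 ∨ DegreeGood F j B (m 10)) := by
  generalize hρ : m 10 = ρ at h10
  have hPB : ρ % B + 1 ≤ B := Nat.mod_lt _ hb.hB
  have hBW1 : B < 2 ^ W := lt_of_le_of_lt ((Nat.le_self_pow (by omega) B).trans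
    (Nat.le_self_pow hb.hG.ne' _)) hb.hQW
  obtain ⟨Q, hQ⟩ : ∃ Q, ρ % B + 1 = Q := ⟨_, rfl⟩
  have hQ1 : 0 < Q := by omega
  have hQW : Q ^ G < 2 ^ W := by
    refine lt_of_le_of_lt (Nat.pow_le_pow_left ?_ _) (hb.pow_lt hPB)
    rw [← hQ]; exact Nat.le_self_pow (by omega) _
  have hQle : Q ≤ 2 ^ W := (Nat.le_self_pow hb.hG.ne' _).trans hQW.le
  have hW : 1 < 2 ^ W := lt_of_le_of_lt (Nat.one_le_pow _ _ hQ1) hQW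
  have hjW : 2 ^ (j + 1) < 2 ^ W := by
    have := hb.hm
    exact Nat.pow_lt_pow_right (by norm_num) (by omega)
  apply Ht.le
  · have e12 : (Exp.reg 10 % .reg 9 + 1).ev m = Q := by simp [hρ, he.h9, hQ]
    apply Ht.set_seq (by norm_num) (by rw [e12]; omega)
    rw [e12]
    have e13 : (Exp.reg 10 / .reg 9).ev (Function.update m 12 Q) = ρ / B := by simp [hρ, he.h9]
    apply Ht.set_seq (by norm_num)
      (by rw [e13]; exact lt_of_le_of_lt (Nat.div_le_self _ _) h10)
    rw [e13]
    apply Ht.set_seq (by norm_num) (by simp)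
    apply Ht.set_seq (by norm_num) (by simpa using hW)
    apply Ht.set_seq (by norm_num) (by simp)
    apply Ht.set_seq (by norm_num) (by simpa [he.h4] using hb.hj)
    apply Ht.seq (T₁ := (j + 2) * (G * (3 * n + 6 * G + 25) + 8 + 2) + 1) (T₂ := 1)
      (R := fun m' _ => m' 16 < Q ∧
        ((m' 16 : ℕ) : ZMod Q) = ((degreeSum F j B (ρ / B) : ℤ) : ZMod Q))
    · refine Ht.mono (Ht.rep (N := j + 2) (T := G * (3 * n + 6 * G + 25) + 8) (fun i m' _ =>
        m' 45 = i ∧ m' 29 = (j + 1).choose i ∧ m' 16 < Q ∧ ((m' 16 : ℕ) : ZMod Q) =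
          ((∑ t ∈ Finset.range i, (-1) ^ t * ((j + 1).choose t : ℤ) *
            F fun v => t * digit B (ρ / B) v : ℤ) : ZMod Q)) (by simp [he.h4]) (by norm_num) hb.hj
          rfl (by simp [hQ1]) ?_) le_rfl fun _ _ h => h.2.2
      rintro i hi m₁ c₁ ⟨k45, k29, k16, ks⟩ hf hin
      have k12 : m₁ 12 = Q := by rw [hf 12 rfl]; simp
      have k13 : m₁ 13 = ρ / B := by rw [hf 13 rfl]; simp
      have k1 : m₁ 1 = n := by rw [hf 1 rfl]; simp [he.h1]
      have k2 : m₁ 2 = G := by rw [hf 2 rfl]; simp [he.h2]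
      have k4 : m₁ 4 = j := by rw [hf 4 rfl]; simp [he.h4]
      have k9 : m₁ 9 = B := by rw [hf 9 rfl]; simp [he.h9]
      have ki : ∀ a, 64 ≤ a → m₁ a = inp a := by
        intro a ha
        rw [hin a ha, Function.update_of_ne (by omega), Function.update_of_ne (by omega),
          Function.update_of_ne (by omega), Function.update_of_ne (by omega),
          Function.update_of_ne (by omega), Function.update_of_ne (by omega), he.input a ha]
      obtain ⟨val, hval, hlast⟩ := hF Q (fun v => i * digit B (ρ / B) v)
      apply Ht.le
      · apply Ht.seq (circuitProg_ht (T := 3 * n + 4)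
          (pt := fun v => (((i : ℤ) * digit B (ρ / B) v : ℤ) : ZMod Q)) (val := val)
          k1 k2 k12 hb.hG hQ1 hQW hb.hGW (fun a ha => by rw [ki a ha]; exact hb.hin a ha)
          (fun g hg => by
            rw [ki _ (by omega), ki _ (by omega), ki _ (by omega)]
            exact hval g hg)
          (fun r hr => by
            simp only [List.mem_cons, List.not_mem_nil, or_false] at hr
            rcases hr with rfl | rfl | rfl | rfl | rfl | rfl <;> rfl)
          (fun m₂ c₂ h22 hf₂ hi₂ => degreeVar_ht (by rw [hf₂ 9 rfl, k9]) (by rw [hf₂ 12 rfl, k12])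
            (by rw [hf₂ 13 rfl, k13]) rfl (by rw [hf₂ 45 rfl, k45]) h22 hb.hB hQ1 hb.hn hb.hBn
            hQle))
        rintro m₂ c₂ ⟨l19, l19'⟩ hf₂ hi₂ _
        rw [hlast] at l19'
        have l16 : m₂ 16 = m₁ 16 := hf₂ 16 rfl
        have l29 : m₂ 29 = (j + 1).choose i := by rw [hf₂ 29 rfl, k29]
        have l45 : m₂ 45 = i := by rw [hf₂ 45 rfl, k45]
        have l12 : m₂ 12 = Q := by rw [hf₂ 12 rfl, k12]
        have l4 : m₂ 4 = j := by rw [hf₂ 4 rfl, k4]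
        have e16 : ((Exp.reg 16 + .reg 29 * .reg 19 * (1 + (.reg 12 - 2) * (.reg 45 % 2))) %
            .reg 12).ev m₂ =
            (m₁ 16 + (j + 1).choose i * m₂ 19 * (1 + (Q - 2) * (i % 2))) % Q := by
          simp [l16, l29, l45, l12]
        apply Ht.set_seq (by norm_num) (by rw [e16]; exact (Nat.mod_lt _ hQ1).trans_le hQle)
        have e29 : (Exp.reg 29 * (.reg 4 + 1 - .reg 45) / (.reg 45 + 1)).ev
            (Function.update m₂ 16 (((Exp.reg 16 + .reg 29 * .reg 19 *
              (1 + (.reg 12 - 2) * (.reg 45 % 2))) % .reg 12).ev m₂)) =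
            (j + 1).choose (i + 1) := by
          simp only [Exp.ev_div, Exp.ev_mul, Exp.ev_sub, Exp.ev_add, Exp.ev_mem, Exp.ev_lit,
            Exp.ev_ofNat, Function.update_of_ne (show (29 : ℕ) ≠ 16 by norm_num),
            Function.update_of_ne (show (4 : ℕ) ≠ 16 by norm_num),
            Function.update_of_ne (show (45 : ℕ) ≠ 16 by norm_num), l29, l45, l4]
          rw [← Nat.choose_succ_right_eq, Nat.mul_div_cancel _ (by omega)]
        apply Ht.set_seq (by norm_num)
        · rw [e29]; exact lt_of_le_of_lt (Nat.choose_le_two_pow _ _) hjW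
        rw [e29]
        refine Ht.set (by norm_num) ?_ ⟨?_, ?_, ?_, ?_⟩
        · have := hb.hj; simp [l45]; omega
        · simp [l45]
        · simp
        · rw [e16]; simpa using Nat.mod_lt _ hQ1
        · rw [e16, Function.update_of_ne (by norm_num), Function.update_of_ne (by norm_num),
            Function.update_of_ne (by norm_num), Function.update_self, ZMod.natCast_mod,
            Nat.cast_add, Nat.cast_mul, Nat.cast_mul, natCast_signFactor hQ1, l19', ks,
            Finset.sum_range_succ]
          push_cast
          ring
      · ring_nf; omega
    · rintro m₃ c₃ ⟨q16, q16'⟩ hf₃ hi₃ _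
      have p25 : m₃ 25 = m 25 := by rw [hf₃ 25 rfl]; simp
      have e25 : (1 - (1 - (Exp.reg 25 + .reg 16))).ev m₃ = 1 - (1 - (m 25 + m₃ 16)) := by
        simp [p25]
      have h16 : m₃ 16 = 0 ↔ ((ρ % B + 1 : ℕ) : ℤ) ∣ degreeSum F j B (ρ / B) := by
        rw [hQ, ← ZMod.intCast_zmod_eq_zero_iff_dvd, ← q16', ZMod.natCast_eq_zero_iff]
        exact ⟨fun h => by simp [h], fun h => Nat.eq_zero_of_dvd_of_lt h q16⟩
      refine Ht.set (by norm_num) ?_ ⟨?_, ?_⟩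
      · rw [e25]; exact lt_of_le_of_lt (flag_le _) hW
      · rw [e25]; simp
      · rw [e25, Function.update_self, DegreeGood, ← h16]
        omega
  · unfold degreeTrialCost; ring_nf; omega

end

/-! ### Stages -/

/-- The number of bits of each random number used in stage `j`. -/
def fieldBits (N j : ℕ) : ℕ := 8 * (N + j + 2)

/-- The product is `(j + j / 2).descFactorial j`, so the first factor is the inverse probability
that `j` slots get distinct colours, rounded up. Of the second, `16 * fieldBits` makes up for the
losses in colours, weights and primes, and the remaining `4` pushes the failure probability down to
`e⁻⁴`. -/
def mainTrials (N j : ℕ) : ℕ :=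
  ((j + j / 2) ^ j / ∏ t ∈ Finset.range j, (j / 2 + t + 1) + 1) * (64 * fieldBits N j)

/-- The number of coins tossed in a trial of the main test. -/
def mainLen (N n j : ℕ) : ℕ := fieldBits N j * (1 + 2 * (n * j))

/-- A trial succeeds with probability at least `1 / (8 * fieldBits)` if it should; the factor `j +
3` makes the failures over all stages summable to `1/4`. -/
def degreeTrials (N j : ℕ) : ℕ := 8 * fieldBits N j * (j + 3)

/-- The number of coins tossed in a trial of the degree test. -/
def degreeLen (N n j : ℕ) : ℕ := fieldBits N j * (1 + n)

/-- Compute the parameters of stage `reg 4`. -/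
def setupProg : Cmd :=
  .set 6 (.reg 4 / 2) ;; .set 7 (.reg 4 + .reg 6) ;; .set 27 (3 * .reg 6 + 1) ;;
  .set 5 (8 * (.reg 3 + .reg 4 + 2)) ;;
  powProg 9 2 (.reg 5) ;; powProg 26 2 (.reg 27) ;; powProg 49 (.reg 7) (.reg 4) ;;
  .set 50 1 ;; .set 37 (.reg 6) ;; .set 42 (.reg 4) ;;
  (.set 37 (.reg 37 + 1) ;; .set 50 (.reg 50 * .reg 37)).rep 42

/-- Stage `reg 4`: test for monomials of this degree outside the ideal, raising the flag in register
`0`, and for monomials of larger degree, raising the flag in register `25`. -/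
def stageProg : Cmd :=
  setupProg ;;
  trialsProg ((.reg 49 / .reg 50 + 1) * (64 * .reg 5)) (.reg 5 * (1 + 2 * (.reg 1 * .reg 4)))
    mainTrial ;;
  .set 25 0 ;;
  trialsProg (8 * .reg 5 * (.reg 4 + 3)) (.reg 5 * (1 + .reg 1)) degreeTrial ;;
  .set 4 (.reg 4 + 1)

structure StageBounds (W n G N j : ℕ) (inp : ℕ → ℕ) : Prop where
  trial : TrialBounds W n G j (2 ^ fieldBits N j) inp
  hmL : mainLen N n j ≤ W
  hdL : degreeLen N n j ≤ W
  hmT : mainTrials N j < 2 ^ W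
  hdT : degreeTrials N j < 2 ^ W
  hM : j + j / 2 < 2 ^ W
  hMj : (j + j / 2) ^ j < 2 ^ W
  hbits : fieldBits N j < W

structure LoopEnv (n G N : ℕ) (inp m : ℕ → ℕ) : Prop where
  h1 : m 1 = n
  h2 : m 2 = G
  h3 : m 3 = N
  input : ∀ a, 64 ≤ a → m a = inp a

theorem StageEnv.of_frame {n G j B : ℕ} {inp m m' : ℕ → ℕ} (h : StageEnv n G j B inp m)
    (hf : ∀ a ∈ [1, 2, 4, 6, 7, 9, 26, 27], m' a = m a) (hi : ∀ a, 64 ≤ a → m' a = m a) :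
    StageEnv n G j B inp m' where
  h1 := by rw [hf _ (by simp), h.h1]
  h2 := by rw [hf _ (by simp), h.h2]
  h4 := by rw [hf _ (by simp), h.h4]
  h6 := by rw [hf _ (by simp), h.h6]
  h7 := by rw [hf _ (by simp), h.h7]
  h9 := by rw [hf _ (by simp), h.h9]
  h26 := by rw [hf _ (by simp), h.h26]
  h27 := by rw [hf _ (by simp), h.h27]
  input := fun a ha => by rw [hi a ha, h.input a ha]

/-- A bound for the number of steps of stage `j`. -/
def stageCost (N n G j : ℕ) : ℕ :=
  mainTrials N j * (mainTrialCost n G j + 4 * mainLen N n j + 5) +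
  degreeTrials N j * (degreeTrialCost n G j + 4 * degreeLen N n j + 5) +
  (3 * fieldBits N j + 20 * j + 50)

/-- Some trial of the main test in stage `j` succeeds, if the stage starts with coin `c`. -/
def MainFlag (F : (ℕ → ℤ) → ℤ) (inp : ℕ → ℕ) (N n j : ℕ) (ω : ℕ → Bool) (c : ℕ) : Prop :=
  ∃ t < mainTrials N j, MainGood F inp n j (2 ^ fieldBits N j)
    (coinNumber ω (c + t * mainLen N n j) (mainLen N n j))

/-- Some trial of the degree test in stage `j` succeeds, if the stage starts with coin `c`. -/
def DegreeFlag (F : (ℕ → ℤ) → ℤ) (N n j : ℕ) (ω : ℕ → Bool) (c : ℕ) : Prop :=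
  ∃ t < degreeTrials N j, DegreeGood F j (2 ^ fieldBits N j)
    (coinNumber ω (c + mainTrials N j * mainLen N n j + t * degreeLen N n j) (degreeLen N n j))

/-- The number of coins tossed before stage `j`. -/
def stageOffset (N n : ℕ) : ℕ → ℕ
  | 0 => 0
  | j + 1 => stageOffset N n j + mainTrials N j * mainLen N n j +
      degreeTrials N j * degreeLen N n j

section

variable {W : ℕ} {ω : ℕ → Bool} {m : ℕ → ℕ} {c n G N j : ℕ} {inp : ℕ → ℕ} {F : (ℕ → ℤ) → ℤ}

theorem setupProg_ht (hb : StageBounds W n G N j inp) (he : LoopEnv n G N inp m) (h4 : m 4 = j) :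
    Ht W ω setupProg m c (3 * fieldBits N j + 20 * j + 30) fun m' _ =>
      StageEnv n G j (2 ^ fieldBits N j) inp m' ∧ m' 5 = fieldBits N j ∧
      m' 49 = (j + j / 2) ^ j ∧ m' 50 = ∏ t ∈ Finset.range j, (j / 2 + t + 1) := by
  have hm := hb.trial.hm
  have hM := hb.hM
  have hW2 : W < 2 ^ W := Nat.lt_two_pow_self
  have hbW := hb.hbits
  apply Ht.le
  · apply Ht.set_seq (by norm_num) (by simp [h4]; omega)
    apply Ht.set_seq (by norm_num) (by simp [h4]; omega)
    apply Ht.set_seq (by norm_num) (by simp [h4]; omega)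
    have e5 : ∀ a b c, (8 * (Exp.reg 3 + .reg 4 + 2)).ev (Function.update (Function.update
        (Function.update m 6 a) 7 b) 27 c) = fieldBits N j := by
      intros; simp [h4, he.h3, fieldBits]
    apply Ht.set_seq (by norm_num) (by rw [e5]; omega)
    rw [e5]
    apply Ht.seq (powProg_ht (b := 2) (e := fieldBits N j) (by norm_num) (by norm_num)
      (by simp) (fun m' h' => by simp) (fun _ => by norm_num) (by omega)
      (Nat.pow_lt_pow_right (by norm_num) hbW))
    intro m₁ c₁ k9 hf₁ hi₁ _
    have k27 : m₁ 27 = 3 * (j / 2) + 1 := by rw [hf₁ 27 rfl]; simp [h4]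
    apply Ht.seq (powProg_ht (b := 2) (e := 3 * (j / 2) + 1) (by norm_num) (by norm_num)
      (by simpa using k27) (fun m' h' => by simp) (fun _ => by norm_num) (by omega)
      (Nat.pow_lt_pow_right (by norm_num) (by omega)))
    intro m₂ c₂ k26 hf₂ hi₂ _
    have k7 : m₂ 7 = j + j / 2 := by rw [hf₂ 7 rfl, hf₁ 7 rfl]; simp [h4]
    have k4 : m₂ 4 = j := by rw [hf₂ 4 rfl, hf₁ 4 rfl]; simp [h4]
    apply Ht.seq (powProg_ht (b := j + j / 2) (e := j) (by norm_num) (by norm_num)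
      (by simpa using k4) (fun m' h' => by simp [h' 7, k7]) (fun _ => by omega) (by omega) hb.hMj)
    intro m₃ c₃ k49 hf₃ hi₃ _
    have q4 : m₃ 4 = j := by rw [hf₃ 4 rfl, k4]
    have q6 : m₃ 6 = j / 2 := by rw [hf₃ 6 rfl, hf₂ 6 rfl, hf₁ 6 rfl]; simp [h4]
    apply Ht.set_seq (by norm_num) (by simp; omega)
    apply Ht.set_seq (by norm_num) (by simp [q6]; omega)
    apply Ht.set_seq (by norm_num) (by simp [q4]; omega)
    refine Ht.frame (Ht.rep (N := j) (T := 2) (fun i m' _ => m' 37 = j / 2 + i ∧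
      m' 50 = ∏ t ∈ Finset.range i, (j / 2 + t + 1)) (by simp [q4]) (by norm_num) (by omega) rfl
      (by simp [q6]) ?_) ?_
    · rintro i hi m' c' ⟨h₁, h₂⟩ hf _
      have hle : ∏ t ∈ Finset.range (i + 1), (j / 2 + t + 1) ≤ (j + j / 2) ^ j := by
        refine (Finset.prod_le_pow_card _ _ (j + j / 2) fun t ht => ?_).trans
          (Nat.pow_le_pow_right (by omega) (by simpa using hi))
        have := Finset.mem_range.1 ht; omega
      rw [Finset.prod_range_succ] at hle
      apply Ht.set_seq (by norm_num) (by simp [h₁]; omega)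
      refine Ht.set (by norm_num) ?_ ⟨?_, ?_⟩
      · simpa [h₁, h₂] using lt_of_le_of_lt hle hb.hMj
      · simp [h₁]; omega
      · simp [h₁, h₂, Finset.prod_range_succ]
    · rintro m' c' ⟨-, h50⟩ hf hi _
      refine ⟨⟨?_, ?_, ?_, ?_, ?_, ?_, ?_, ?_, ?_⟩, ?_, ?_, h50⟩
      · rw [hf 1 rfl]; simp [hf₃ 1 rfl, hf₂ 1 rfl, hf₁ 1 rfl, he.h1]
      · rw [hf 2 rfl]; simp [hf₃ 2 rfl, hf₂ 2 rfl, hf₁ 2 rfl, he.h2]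
      · rw [hf 4 rfl]; simp [q4]
      · rw [hf 6 rfl]; simp [q6]
      · rw [hf 7 rfl]; simp [hf₃ 7 rfl, k7]
      · rw [hf 9 rfl]; simp [hf₃ 9 rfl, hf₂ 9 rfl, k9]
      · rw [hf 26 rfl]; simp [hf₃ 26 rfl, k26]
      · rw [hf 27 rfl]; simp [hf₃ 27 rfl, hf₂ 27 rfl, k27]
      · intro a ha
        rw [hi a ha, Function.update_of_ne (by omega), Function.update_of_ne (by omega),
          Function.update_of_ne (by omega), hi₃ a ha, hi₂ a ha, hi₁ a ha,
          Function.update_of_ne (by omega), Function.update_of_ne (by omega),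
          Function.update_of_ne (by omega), Function.update_of_ne (by omega), he.input a ha]
      · rw [hf 5 rfl]; simp [hf₃ 5 rfl, hf₂ 5 rfl, hf₁ 5 rfl]
      · rw [hf 49 rfl]; simp [k49]
  · omega

theorem stageProg_ht (hb : StageBounds W n G N j inp) (he : LoopEnv n G N inp m) (h4 : m 4 = j)
    (hF : Computes n G inp F) (h0 : m 0 ≤ 1) :
    Ht W ω stageProg m c (stageCost N n G j) fun m' c' =>
      m' 4 = j + 1 ∧ m' 0 ≤ 1 ∧ c' = c + mainTrials N j * mainLen N n j +
        degreeTrials N j * degreeLen N n j ∧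
      (m' 0 ≠ 0 ↔ m 0 ≠ 0 ∨ MainFlag F inp N n j ω c) ∧
      (m' 25 ≠ 0 ↔ DegreeFlag F N n j ω c) := by
  have hm := hb.trial.hm
  have hj := hb.trial.hj
  have hW : 0 < W := by omega
  apply Ht.le
  · apply Ht.seq (setupProg_ht hb he h4)
    rintro m₁ c₁ ⟨he₁, k5, k49, k50⟩ hf₁ hi₁ hc₁
    have hc₁' : c₁ = c := hc₁ rfl
    have k0 : m₁ 0 = m 0 := hf₁ 0 rfl
    apply Ht.seq (trialsProg_ht (fr := 0) (T := mainTrials N j) (L := mainLen N n j)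
      (Tc := mainTrialCost n G j) (good := MainGood F inp n j (2 ^ fieldBits N j))
      (by simp [k5, k49, k50, mainTrials]) hb.hmT hb.hmL hW
      (fun m' hf _ => by
        simp [hf 5 (by norm_num) rfl, hf 1 (by norm_num) rfl, hf 4 (by norm_num) rfl, k5, he₁.h1,
          he₁.h4, mainLen])
      (by norm_num) rfl rfl (by rwa [k0])
      (fun m' c' hle h10 hf hi => mainTrial_ht hb.trial (he₁.of_frame (fun a ha => hf a (by
          rintro rfl; simp at ha) (by rintro rfl; simp at ha) (by
          simp only [List.mem_cons, List.not_mem_nil, or_false] at ha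
          rcases ha with rfl | rfl | rfl | rfl | rfl | rfl | rfl | rfl <;> rfl)) hi) hF hle
        (h10.trans_le (Nat.pow_le_pow_right (by norm_num) hb.hmL))))
    rintro m₂ c₂ ⟨hc₂, l0, l0'⟩ hf₂ hi₂ _
    have he₂ := he₁.of_frame (fun a ha => hf₂ a (by
      simp only [List.mem_cons, List.not_mem_nil, or_false] at ha
      rcases ha with rfl | rfl | rfl | rfl | rfl | rfl | rfl | rfl <;> rfl)) hi₂
    have l5 : m₂ 5 = fieldBits N j := by rw [hf₂ 5 rfl, k5]
    apply Ht.set_seq (by norm_num) (by simp)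
    have he₃ := he₂.of_frame (m' := Function.update m₂ 25 (Exp.ev m₂ 0)) (fun a ha => by
      simp only [List.mem_cons, List.not_mem_nil, or_false] at ha
      rcases ha with rfl | rfl | rfl | rfl | rfl | rfl | rfl | rfl <;> rfl)
      (fun a ha => Function.update_of_ne (by omega) _ _)
    apply Ht.seq (T₂ := 1) (trialsProg_ht (fr := 25) (T := degreeTrials N j) (L := degreeLen N n j)
      (Tc := degreeTrialCost n G j) (good := DegreeGood F j (2 ^ fieldBits N j))
      (by simp [l5, he₂.h4, degreeTrials]) hb.hdT hb.hdL hW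
      (fun m' hf _ => by
        rw [Exp.ev_mul, Exp.ev_add, Exp.ev_mem, Exp.ev_mem, Exp.ev_lit, Exp.ev_lit,
          hf 5 (by norm_num) rfl, hf 1 (by norm_num) rfl]
        simp [l5, he₂.h1, degreeLen])
      (by norm_num) rfl rfl (by simp)
      (fun m' c' hle h10 hf hi => degreeTrial_ht hb.trial (he₃.of_frame (fun a ha => hf a (by
          rintro rfl; simp at ha) (by rintro rfl; simp at ha) (by
          simp only [List.mem_cons, List.not_mem_nil, or_false] at ha
          rcases ha with rfl | rfl | rfl | rfl | rfl | rfl | rfl | rfl <;> rfl)) hi) hF hle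
        (h10.trans_le (Nat.pow_le_pow_right (by norm_num) hb.hdL))))
    rintro m₄ c₄ ⟨hc₄, q25, q25'⟩ hf₄ hi₄ _
    have q4 : m₄ 4 = j := by rw [hf₄ 4 rfl, he₃.h4]
    have q0 : m₄ 0 = m₂ 0 := by rw [hf₄ 0 rfl]; simp
    refine Ht.set (by norm_num) (by simp [q4]; omega) ⟨by simp [q4], by simpa [q0] using l0,
      by rw [hc₄, hc₂, hc₁'], ?_, ?_⟩
    · rw [Function.update_of_ne (by norm_num), q0, l0', k0, hc₁', MainFlag]
    · rw [Function.update_of_ne (by norm_num), q25', hc₂, hc₁', DegreeFlag]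
      simp
  · unfold stageCost; omega

end

/-! ### The algorithm -/

/-- Load the input length and test whether all exponents are positive. -/
def initProg : Cmd :=
  .set 1 (.mem 64) ;; .set 2 (.mem 65) ;; .set 3 0 ;; .set 52 64 ;;
  .set 42 (2 + .reg 1 + 3 * .reg 2) ;;
  (.set 37 (.mem (.reg 52)) ;; .set 3 (.reg 3 + 1) ;;
    -- The number of halvings until `0` is the bit length; the `1` added before is the separator.
    .loop (.reg 37) (.set 37 (.reg 37 / 2) ;; .set 3 (.reg 3 + 1)) ;;
    .set 52 (.reg 52 + 1)).rep 42 ;;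
  .set 8 1 ;; .set 34 0 ;; .set 42 (.reg 1) ;;
  (.set 8 (.reg 8 * (1 - (1 - .mem (66 + .reg 34)))) ;; .set 34 (.reg 34 + 1)).rep 42 ;;
  .set 4 0 ;; .set 25 1

def mainProg : Cmd :=
  initProg ;; .loop (.reg 25) stageProg ;; .set 0 (.reg 0 * .reg 8)

theorem size_eq_size_half_add_one {x : ℕ} (hx : x ≠ 0) : Nat.size x = Nat.size (x / 2) + 1 := by
  apply le_antisymm
  · rw [Nat.size_le, pow_succ]
    have := Nat.lt_size_self (x / 2)
    omega
  · rw [Nat.succ_le_iff, Nat.lt_size]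
    rcases Nat.eq_zero_or_pos (x / 2) with h | h
    · rw [h]; simp; omega
    · have h1 : Nat.size (x / 2) - 1 < Nat.size (x / 2) := by
        have := Nat.size_pos.2 h; omega
      have h2 := Nat.lt_size.1 h1
      have h3 : 2 ^ Nat.size (x / 2) = 2 * 2 ^ (Nat.size (x / 2) - 1) := by
        rw [← pow_succ']
        congr 1
        have := Nat.size_pos.2 h; omega
      omega

section

variable {W : ℕ} {ω : ℕ → Bool} {m : ℕ → ℕ} {c n G N : ℕ} {inp : ℕ → ℕ} {F : (ℕ → ℤ) → ℤ}

theorem halvingLoop_ht {x y : ℕ} (h37 : m 37 = x) (h3 : m 3 = y) (hx : x < 2 ^ W)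
    (hN : y + Nat.size x < 2 ^ W) :
    Ht W ω (.loop (.reg 37) (.set 37 (.reg 37 / 2) ;; .set 3 (.reg 3 + 1))) m c
      (3 * Nat.size x + 1) fun m' _ => m' 3 = y + Nat.size x := by
  refine Ht.mono (Ht.loop (T := 2) (v := Nat.size x) (fun v m' _ =>
    Nat.size (m' 37) = v ∧ m' 3 + v = y + Nat.size x ∧ m' 37 < 2 ^ W)
    ⟨by rw [h37], by rw [h3], by rwa [h37]⟩ ?_) (by omega) ?_
  · rintro v m₁ c₁ ⟨h₁, h₂, h₃⟩ hne _ _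
    have hs := size_eq_size_half_add_one (x := m₁ 37) (by simpa using hne)
    apply Ht.set_seq (by norm_num)
    · simpa using lt_of_le_of_lt (Nat.div_le_self _ _) h₃
    refine Ht.set (by norm_num) (by simp; omega) ⟨v - 1, by omega, ?_, ?_, ?_⟩
    · simp; omega
    · simp; omega
    · simpa using lt_of_le_of_lt (Nat.div_le_self _ _) h₃
  · rintro m' _ ⟨hne, v, h₁, h₂, -⟩
    have h37 : m' 37 = 0 := by simpa using hne
    rw [h37, Nat.size_zero] at h₁
    omega

theorem initProg_ht (hi : ∀ a, 64 ≤ a → m a = inp a) (hn : inp 64 = n) (hG : inp 65 = G)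
    (hN : N = ∑ i ∈ Finset.range (2 + n + 3 * G), (Nat.size (inp (64 + i)) + 1))
    (hin : ∀ a, 64 ≤ a → inp a < 2 ^ W) (hNW : N + 64 < 2 ^ W) :
    Ht W ω initProg m c ((2 + n + 3 * G) * (3 * W + 7) + 4 * n + 12) fun m' _ =>
      LoopEnv n G N inp m' ∧ m' 4 = 0 ∧ m' 25 = 1 ∧ m' 8 ≤ 1 ∧
      (m' 8 ≠ 0 ↔ ∀ i < n, inp (66 + i) ≠ 0) := by
  have hW1 : 1 < 2 ^ W := by omega
  have hlen : 2 + n + 3 * G ≤ N := by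
    rw [hN]
    refine le_trans ?_ (Finset.sum_le_sum fun i _ => Nat.le_add_left 1 _)
    simp
  apply Ht.le
  · apply Ht.set_seq (by norm_num) (by simpa [hi 64 le_rfl] using hin 64 le_rfl)
    apply Ht.set_seq (by norm_num) (by simpa [hi 65 (by norm_num)] using hin 65 (by norm_num))
    apply Ht.set_seq (by norm_num) (by simp)
    apply Ht.set_seq (by norm_num) (by simp; omega)
    apply Ht.set_seq (by norm_num) (by simp [hi 64 le_rfl, hi 65 (by norm_num), hn, hG]; omega)
    apply Ht.seq (Ht.rep (N := 2 + n + 3 * G) (T := 3 * W + 5) (fun i m' _ => m' 52 = 64 + i ∧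
      m' 3 = ∑ i ∈ Finset.range i, (Nat.size (inp (64 + i)) + 1)) (by
        simp [hi 64 le_rfl, hi 65 (by norm_num), hn, hG]) (by norm_num) (by omega) rfl
      (by simp) (by
        rintro i hi' m₁ c₁ ⟨k52, k3⟩ hf hin'
        have hv : m₁ (64 + i) = inp (64 + i) := by
          rw [hin' _ (by omega)]; simp [hi (64 + i) (by omega)]
        have hle : ∑ i ∈ Finset.range (i + 1), (Nat.size (inp (64 + i)) + 1) ≤ N := by
          rw [hN]
          exact Finset.sum_le_sum_of_subset (Finset.range_subset_range.2 hi')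
        rw [Finset.sum_range_succ, ← k3] at hle
        have hsz : Nat.size (inp (64 + i)) ≤ W := Nat.size_le.2 (hin _ (by omega))
        apply Ht.le
        · apply Ht.set_seq (by norm_num) (by simpa [k52, hv] using hin _ (by omega))
          apply Ht.set_seq (by norm_num) (by simp; omega)
          apply Ht.seq (halvingLoop_ht (x := inp (64 + i)) (y := m₁ 3 + 1) (by simp [k52, hv])
            (by simp) (hin _ (by omega)) (by omega))
          intro m₂ c₂ l3 hf₂ _ _
          have l52 : m₂ 52 = 64 + i := by rw [hf₂ 52 rfl]; simp [k52]
          refine Ht.set (by norm_num) (by simp [l52]; omega) ⟨by simp [l52]; omega, ?_⟩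
          simp [l3, Finset.sum_range_succ, k3]; omega
        · omega))
    rintro m₁ c₁ ⟨-, k3⟩ hf₁ hi₁ _
    have k1 : m₁ 1 = n := by rw [hf₁ 1 rfl]; simp [hi 64 le_rfl, hn]
    have k2 : m₁ 2 = G := by rw [hf₁ 2 rfl]; simp [hi 65 (by norm_num), hG]
    have ki : ∀ a, 64 ≤ a → m₁ a = inp a := by
      intro a ha
      rw [hi₁ a ha, Function.update_of_ne (by omega), Function.update_of_ne (by omega),
        Function.update_of_ne (by omega), Function.update_of_ne (by omega),
        Function.update_of_ne (by omega), hi a ha]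
    apply Ht.set_seq (by norm_num) (by simpa using hW1)
    apply Ht.set_seq (by norm_num) (by simp)
    apply Ht.set_seq (by norm_num) (by simp [k1]; omega)
    apply Ht.seq (Ht.rep (N := n) (T := 2) (fun i m' _ => m' 34 = i ∧ m' 8 ≤ 1 ∧
      (m' 8 ≠ 0 ↔ ∀ l < i, inp (66 + l) ≠ 0)) (by simp [k1]) (by norm_num) (by omega) rfl
      (by simp) (by
        rintro i hi' m₂ c₂ ⟨l34, l8, l8'⟩ hf hin'
        have hv : m₂ (66 + i) = inp (66 + i) := by
          rw [hin' _ (by omega)]; simp [ki (66 + i) (by omega)]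
        have e8 : (Exp.reg 8 * (1 - (1 - .mem (66 + .reg 34)))).ev m₂ =
            m₂ 8 * (1 - (1 - inp (66 + i))) := by simp [l34, hv]
        have h1 : m₂ 8 * (1 - (1 - inp (66 + i))) ≤ 1 := by
          calc _ ≤ 1 * 1 := Nat.mul_le_mul l8 (flag_le _)
            _ = 1 := rfl
        apply Ht.set_seq (by norm_num) (by rw [e8]; omega)
        refine Ht.set (by norm_num) (by simp [l34]; omega) ⟨by simp [l34], by rw [e8]; simpa using h1,
          ?_⟩
        rw [e8, Function.update_of_ne (by norm_num), Function.update_of_ne (by norm_num),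
          Function.update_self, mul_ne_zero_iff, l8']
        constructor
        · rintro ⟨h2, h3⟩ l hl
          rcases Nat.lt_succ_iff_lt_or_eq.1 hl with h | rfl
          · exact h2 l h
          · omega
        · intro h
          refine ⟨fun l hl => h l (by omega), ?_⟩
          have := h i (by omega); omega))
    rintro m₂ c₂ ⟨-, l8, l8'⟩ hf₂ hi₂ _
    apply Ht.set_seq (by norm_num) (by simp)
    refine Ht.set (by norm_num) (by simpa using hW1) ⟨⟨?_, ?_, ?_, ?_⟩, ?_, ?_, ?_, ?_⟩
    · simp [hf₂ 1 rfl, k1]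
    · simp [hf₂ 2 rfl, k2]
    · simp [hf₂ 3 rfl, k3, hN]
    · intro a ha
      rw [Function.update_of_ne (by omega), Function.update_of_ne (by omega), hi₂ a ha,
        Function.update_of_ne (by omega), Function.update_of_ne (by omega),
        Function.update_of_ne (by omega), ki a ha]
    · simp
    · simp
    · simpa using l8
    · simpa using l8'
  · ring_nf; omega

/-- `J` is the stage after which the algorithm stops. By `hk` no draw lets the degree test succeed
at stage `k`, so `J ≤ k` whatever the coins are, and the program need not know `k`. The final
product with register 8 rejects when some exponent is `0`, where the ideal is the whole ring. -/
theorem mainProg_ht {k TS : ℕ} (hi : ∀ a, 64 ≤ a → m a = inp a) (h0 : m 0 = 0)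
    (hn : inp 64 = n) (hG : inp 65 = G)
    (hN : N = ∑ i ∈ Finset.range (2 + n + 3 * G), (Nat.size (inp (64 + i)) + 1))
    (hin : ∀ a, 64 ≤ a → inp a < 2 ^ W) (hNW : N + 64 < 2 ^ W)
    (hF : Computes n G inp F) (hb : ∀ j ≤ k, StageBounds W n G N j inp)
    (hTS : ∀ j ≤ k, stageCost N n G j ≤ TS)
    (hk : ∀ ρ, ¬ DegreeGood F k (2 ^ fieldBits N k) ρ) :
    Ht W ω mainProg m 0 ((k + 1) * (TS + 1) + ((2 + n + 3 * G) * (3 * W + 7) + 4 * n + 14))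
      fun m' _ => ∃ J ≤ k, (∀ j < J, DegreeFlag F N n j ω (stageOffset N n j)) ∧
        ¬ DegreeFlag F N n J ω (stageOffset N n J) ∧
        (m' 0 ≠ 0 ↔ (∃ j ≤ J, MainFlag F inp N n j ω (stageOffset N n j)) ∧
          ∀ i < n, inp (66 + i) ≠ 0) := by
  apply Ht.le
  · apply Ht.seq (initProg_ht (c := 0) hi hn hG hN hin hNW)
    rintro m₁ c₁ ⟨he₁, k4, k25, k8, k8'⟩ hf₁ hi₁ hc₁
    have hc₁' : c₁ = 0 := hc₁ rfl
    have k0 : m₁ 0 = 0 := by rw [hf₁ 0 rfl, h0]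
    apply Ht.seq (T₂ := 1) (Ht.loop (T := TS) (v := k + 1) (fun v m' c' => ∃ j ≤ k + 1,
      v = k + 1 - j ∧ LoopEnv n G N inp m' ∧ m' 4 = j ∧ c' = stageOffset N n j ∧ m' 0 ≤ 1 ∧
      (m' 0 ≠ 0 ↔ ∃ i < j, MainFlag F inp N n i ω (stageOffset N n i)) ∧
      (∀ i, i + 1 < j → DegreeFlag F N n i ω (stageOffset N n i)) ∧
      (m' 25 ≠ 0 ↔ ∀ i, i + 1 = j → DegreeFlag F N n i ω (stageOffset N n i)))
      ⟨0, by omega, rfl, he₁, k4, hc₁', by omega, by simp [k0], by simp, by simp [k25]⟩ (by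
        rintro v m₂ c₂ ⟨j, hj, rfl, he₂, l4, rfl, l0, l0', hd, l25⟩ hne hf hin'
        have h25 := l25.1 (by simpa using hne)
        have hjk : j ≤ k := by
          by_contra hcon
          obtain rfl : j = k + 1 := by omega
          obtain ⟨t, _, ht⟩ := h25 k rfl
          exact hk _ ht
        refine Ht.frame (Ht.le (stageProg_ht (hb j hjk) he₂ l4 hF l0) (hTS j hjk)) ?_
        rintro m₃ c₃ ⟨p4, p0, rfl, p0', p25⟩ hf₃ hi₃ _
        refine ⟨k - j, by omega, j + 1, by omega, by omega, ⟨?_, ?_, ?_, ?_⟩, p4, rfl, p0, ?_, ?_, ?_⟩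
        · rw [hf₃ 1 rfl, he₂.h1]
        · rw [hf₃ 2 rfl, he₂.h2]
        · rw [hf₃ 3 rfl, he₂.h3]
        · intro a ha; rw [hi₃ a ha, he₂.input a ha]
        · rw [p0', l0']
          constructor
          · rintro (⟨i, hi, h⟩ | h)
            · exact ⟨i, by omega, h⟩
            · exact ⟨j, by omega, h⟩
          · rintro ⟨i, hi, h⟩
            rcases Nat.lt_succ_iff_lt_or_eq.1 hi with hi' | rfl
            · exact Or.inl ⟨i, hi', h⟩
            · exact Or.inr h
        · intro i hi
          rcases Nat.lt_succ_iff_lt_or_eq.1 hi with hi' | hi'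
          · exact hd i hi'
          · exact h25 i hi'
        · rw [p25]
          constructor
          · rintro h i hi
            obtain rfl : i = j := by omega
            exact h
          · intro h; exact h j rfl))
    rintro m₂ c₂ ⟨hne, v, j, hj, -, he₂, l4, -, l0, l0', hd, l25⟩ hf₂ hi₂ _
    have l8 : m₂ 8 = m₁ 8 := hf₂ 8 rfl
    have h25 : ¬ ∀ i, i + 1 = j → DegreeFlag F N n i ω (stageOffset N n i) := by
      rw [← l25]; simpa using hne
    push Not at h25
    obtain ⟨J, rfl, hJ⟩ := h25
    have hW1 : 1 < 2 ^ W := by omega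
    have hle : m₂ 0 * m₂ 8 ≤ 1 := by
      rw [l8]
      calc _ ≤ 1 * 1 := Nat.mul_le_mul l0 k8
        _ = 1 := rfl
    refine Ht.set (by norm_num) (by simp; omega) ⟨J, by omega, fun i hi => hd i (by omega),
      hJ, ?_⟩
    rw [Function.update_self, Exp.ev_mul, Exp.ev_mem, Exp.ev_mem, Exp.ev_lit, Exp.ev_lit,
      mul_ne_zero_iff, l0', l8, k8']
    refine and_congr_left fun _ => ?_
    constructor
    · rintro ⟨i, hi, h⟩; exact ⟨i, by omega, h⟩
    · rintro ⟨i, hi, h⟩; exact ⟨i, by omega, h⟩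
  · omega

end

/-! ### The algebra of the two tests. -/

/-! ### The alternating sum over low levels of the cube -/

theorem two_pow_add_div_mod_two {m x c : ℕ} (hc : c < m) :
    (2 ^ m + x) / 2 ^ c % 2 = x / 2 ^ c % 2 := by
  obtain ⟨d, rfl⟩ := Nat.exists_eq_add_of_lt hc
  rw [show 2 ^ (c + d + 1) + x = 2 ^ c * (2 * 2 ^ d) + x by ring,
    Nat.mul_add_div (by positivity)]
  omega

/-- The distributive law: the bits of `x` choose a summand in each factor. -/
theorem sum_range_two_pow_prod {R : Type*} [CommSemiring R] (m : ℕ) (a : ℕ → ℕ → R) :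
    ∑ x ∈ Finset.range (2 ^ m), ∏ c ∈ Finset.range m, a c (x / 2 ^ c % 2) =
      ∏ c ∈ Finset.range m, (a c 0 + a c 1) := by
  induction m with
  | zero => simp
  | succ m ih =>
    rw [Finset.prod_range_succ, mul_add, ← ih, pow_succ, mul_two, Finset.sum_range_add,
      Finset.sum_mul, Finset.sum_mul]
    congr 1
    · refine Finset.sum_congr rfl fun x hx => ?_
      rw [Finset.prod_range_succ, Nat.div_eq_of_lt (Finset.mem_range.1 hx)]
    · refine Finset.sum_congr rfl fun x hx => ?_
      rw [Finset.prod_range_succ]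
      congr 1
      · exact Finset.prod_congr rfl fun c hc => by
          rw [two_pow_add_div_mod_two (Finset.mem_range.1 hc)]
      · rw [Nat.add_div_of_dvd_right dvd_rfl, Nat.div_self (by positivity),
          Nat.div_eq_of_lt (Finset.mem_range.1 hx)]

/-- For `p ≤ q` this is `q!` times the coefficient of `X^(q-p)` in `(1 - X)^(-(q+1))`; the factor
`q!` lets the program compute it without division. -/
theorem levelWeight_eq (q p : ℕ) :
    levelWeight q p = q.factorial * (q + (q - p)).choose q := by
  rw [add_comm q, ← Nat.ascFactorial_eq_factorial_mul_choose, Nat.ascFactorial_eq_prod_range]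
  exact Finset.prod_congr rfl fun t _ => by omega

open Polynomial in
-- Reversing the coefficients multiplies `(1 - X)^a` by `(-1)^a` and fixes `(1 + X)^b`. For odd `a`
-- the product is antisymmetric, so its middle coefficient vanishes.
theorem coeff_one_sub_pow_mul_one_add_pow {a b q : ℕ} (ha : Odd a) (h : a + b = 2 * q) :
    ((1 - X : ℤ[X]) ^ a * (1 + X) ^ b).coeff q = 0 := by
  have d1 : (1 - X : ℤ[X]).natDegree ≤ 1 := by compute_degree
  have d2 : (1 + X : ℤ[X]).natDegree ≤ 1 := by compute_degree
  have hX : reflect 1 (X : ℤ[X]) = 1 := by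
    simp
  have h1 : reflect 1 (1 : ℤ[X]) = X := by
    simp
  have r1 : ∀ a, reflect a ((1 - X : ℤ[X]) ^ a) = (-1) ^ a * (1 - X) ^ a := by
    intro a
    induction a with
    | zero => simp
    | succ a ih =>
      rw [pow_succ, reflect_mul _ _ (natDegree_pow_le_of_le a d1 |>.trans (by omega)) d1, ih,
        reflect_sub, hX, h1]
      ring
  have r2 : ∀ b, reflect b ((1 + X : ℤ[X]) ^ b) = (1 + X) ^ b := by
    intro b
    induction b with
    | zero => simp
    | succ b ih =>
      rw [pow_succ, reflect_mul _ _ (natDegree_pow_le_of_le b d2 |>.trans (by omega)) d2, ih,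
        reflect_add, hX, h1]
      ring
  have hr := reflect_mul ((1 - X : ℤ[X]) ^ a) ((1 + X) ^ b)
    (natDegree_pow_le_of_le a d1 |>.trans (by omega : a * 1 ≤ a))
    (natDegree_pow_le_of_le b d2 |>.trans (by omega : b * 1 ≤ b))
  rw [r1, r2, ha.neg_one_pow, h] at hr
  have := congr_arg (fun p => coeff p q) hr
  simp only [coeff_reflect, revAt_le (show q ≤ 2 * q by omega), neg_mul, one_mul, coeff_neg] at this
  rw [show 2 * q - q = q by omega] at this
  omega

open Polynomial in
/-- The weighted sum of the first coefficients of a polynomial is a coefficient of its product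
with a power of the geometric series. -/
theorem sum_levelWeight_mul_coeff (q : ℕ) (p : ℤ[X]) :
    ∑ i ∈ Finset.range (q + 1), (levelWeight q i : ℤ) * p.coeff i =
      q.factorial * PowerSeries.coeff q
        ((p : PowerSeries ℤ) * (PowerSeries.invOneSubPow ℤ (q + 1)).val) := by
  rw [PowerSeries.coeff_mul, Finset.Nat.sum_antidiagonal_eq_sum_range_succ_mk, Finset.mul_sum]
  refine Finset.sum_congr rfl fun i _ => ?_
  rw [levelWeight_eq, Polynomial.coeff_coe,
    PowerSeries.invOneSubPow_val_succ_eq_mk_add_choose, PowerSeries.coeff_mk]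
  push_cast; ring

open Polynomial in
-- The weighted sum is `q!` times the coefficient of `X^q` in `(1 + X)^r (1 - X)^(2q-r)`. For odd `r
-- ≤ 2q` this is an antisymmetric middle coefficient, hence `0`. For `r = 2q + 1` the second factor
-- is the geometric series, and half a row of binomials sums to `4^q`.
theorem sum_levelWeight_mul_coeff_pow {q r : ℕ} (hr : Odd r) (hrq : r ≤ 2 * q + 1) :
    ∑ i ∈ Finset.range (q + 1), (levelWeight q i : ℤ) *
      ((1 + X : ℤ[X]) ^ r * (1 - X) ^ (3 * q + 1 - r)).coeff i =
      if r = 2 * q + 1 then (q.factorial * 4 ^ q : ℕ) else 0 := by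
  have hinv := (PowerSeries.invOneSubPow ℤ (q + 1)).inv_val
  rw [PowerSeries.invOneSubPow_inv_eq_one_sub_pow] at hinv
  rw [sum_levelWeight_mul_coeff]
  split_ifs with h
  · have hsplit : (((1 + X : ℤ[X]) ^ r * (1 - X) ^ (3 * q + 1 - r) : ℤ[X]) : PowerSeries ℤ) *
        (PowerSeries.invOneSubPow ℤ (q + 1)).val =
        (((1 + X : ℤ[X]) ^ (2 * q + 1) : ℤ[X]) : PowerSeries ℤ) * PowerSeries.mk 1 := by
      subst h
      have h1 := PowerSeries.mk_one_mul_one_sub_eq_one ℤ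
      rw [show 3 * q + 1 - (2 * q + 1) = q by omega]
      push_cast
      rw [pow_succ] at hinv
      linear_combination (1 + PowerSeries.X : PowerSeries ℤ) ^ (2 * q + 1) * PowerSeries.mk 1 *
        hinv - (1 + PowerSeries.X : PowerSeries ℤ) ^ (2 * q + 1) * (1 - PowerSeries.X) ^ q *
        (PowerSeries.invOneSubPow ℤ (q + 1)).val * h1
    rw [hsplit, PowerSeries.coeff_mul, Finset.Nat.sum_antidiagonal_eq_sum_range_succ_mk]
    push_cast
    congr 1
    rw [show (4 : ℤ) ^ q = ((4 ^ q : ℕ) : ℤ) by push_cast; rfl, ← Nat.sum_range_choose_halfway]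
    push_cast
    refine Finset.sum_congr rfl fun i _ => ?_
    simp only [PowerSeries.coeff_mk, Pi.one_apply, mul_one]
    rw [← Polynomial.coeff_one_add_X_pow ℤ, ← Polynomial.coeff_coe]
    push_cast; rfl
  · have hr' : r ≤ 2 * q := by omega
    have hsplit : (((1 + X : ℤ[X]) ^ r * (1 - X) ^ (3 * q + 1 - r) : ℤ[X]) : PowerSeries ℤ) *
        (PowerSeries.invOneSubPow ℤ (q + 1)).val =
        (((1 - X : ℤ[X]) ^ (2 * q - r) * (1 + X) ^ r : ℤ[X]) : PowerSeries ℤ) := by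
      rw [show 3 * q + 1 - r = (2 * q - r) + (q + 1) by omega, pow_add]
      push_cast
      linear_combination (1 + PowerSeries.X : PowerSeries ℤ) ^ r *
        (1 - PowerSeries.X) ^ (2 * q - r) * hinv
    rw [hsplit, Polynomial.coeff_coe, coeff_one_sub_pow_mul_one_add_pow]
    · simp
    · obtain ⟨t, ht⟩ := hr
      exact ⟨q - t - 1, by omega⟩
    · omega

/-- A weighted alternating sum over the points of the cube with few ones. -/
def levelSum (j : ℕ) (g : ℕ → ℤ) : ℤ :=
  ∑ x ∈ (Finset.range (2 ^ (3 * (j / 2) + 1))).filter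
    (fun x => bitSum (3 * (j / 2) + 1) x ≤ j / 2),
    (levelWeight (j / 2) (bitSum (3 * (j / 2) + 1) x) : ℤ) * (-1) ^ mainSign j x 0 * g x

open Polynomial in
-- `∏ (1 + s c X)` is the generating function of the sign products by the number of ones.
theorem sum_levelWeight_mul_prod (q : ℕ) (s : ℕ → ℤ) :
    ∑ x ∈ (Finset.range (2 ^ (3 * q + 1))).filter (fun x => bitSum (3 * q + 1) x ≤ q),
      (levelWeight q (bitSum (3 * q + 1) x) : ℤ) *
        ∏ c ∈ Finset.range (3 * q + 1), s c ^ (x / 2 ^ c % 2) =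
      ∑ i ∈ Finset.range (q + 1), (levelWeight q i : ℤ) *
        (∏ c ∈ Finset.range (3 * q + 1), (1 + C (s c) * X)).coeff i := by
  have h := sum_range_two_pow_prod (3 * q + 1) fun c b => (C (s c) * X : ℤ[X]) ^ b
  simp only [pow_zero, pow_one] at h
  rw [← h]
  simp only [Polynomial.finsetSum_coeff, Finset.mul_sum]
  rw [Finset.sum_comm, Finset.sum_filter]
  refine Finset.sum_congr rfl fun x _ => ?_
  have hx : ∏ c ∈ Finset.range (3 * q + 1), (C (s c) * X : ℤ[X]) ^ (x / 2 ^ c % 2) =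
      C (∏ c ∈ Finset.range (3 * q + 1), s c ^ (x / 2 ^ c % 2)) * X ^ bitSum (3 * q + 1) x := by
    simp only [mul_pow, Finset.prod_mul_distrib, bitSum, Finset.prod_pow_eq_pow_sum, map_prod,
      map_pow]
  rw [hx]
  simp only [coeff_C_mul, coeff_X_pow, mul_ite, mul_one, mul_zero]
  split_ifs with hq
  · rw [Finset.sum_eq_single_of_mem _ (Finset.mem_range.2 (Nat.lt_succ_iff.2 hq))
      (fun i _ hi => if_neg hi), if_pos rfl]
  · refine (Finset.sum_eq_zero fun i hi => if_neg ?_).symm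
    rintro rfl
    exact hq (by simpa [Nat.lt_succ_iff] using hi)

theorem neg_one_pow_mod_two (a : ℕ) : (-1 : ℤ) ^ (a % 2) = (-1) ^ a :=
  (neg_one_pow_eq_pow_mod_two a).symm

/-- Let `μ d` count the factors of colour `d`, plus one at the spare position `3q` if `j` is even;
this makes the total odd and at most `2q + 1`. Together with the alternating sign, a position
contributes `1 + X` if `μ d` is odd and `1 - X` if it is even. So only the number `r` of odd
positions matters, and the sum vanishes unless `r = 2q + 1`. -/
theorem levelSum_prod_sign {T : Type*} [Fintype T] {j : ℕ} (c : T → ℕ)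
    (hc : ∀ t, c t < j + j / 2) (hT : Fintype.card T ≤ j) (hT' : Fintype.card T % 2 = j % 2) :
    levelSum j (fun x => ∏ t, (-1) ^ (x / 2 ^ c t)) =
      if Fintype.card T = j ∧ Function.Injective c then
        ((j / 2).factorial * 4 ^ (j / 2) : ℕ) else 0 := by
  classical
  set q := j / 2 with hq
  set μ : ℕ → ℕ := fun d => (Finset.univ.filter fun t => c t = d).card +
    (if d = 3 * q then 1 - j % 2 else 0) with hμ
  set r := ((Finset.range (3 * q + 1)).filter fun d => Odd (μ d)).card with hr
  have hmaps : ∀ t ∈ (Finset.univ : Finset T), c t ∈ Finset.range (3 * q + 1) := by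
    intro t _
    have := hc t
    rw [Finset.mem_range]; omega
  have hμsum : ∑ d ∈ Finset.range (3 * q + 1), μ d = Fintype.card T + (1 - j % 2) := by
    rw [hμ, Finset.sum_add_distrib, ← Finset.card_eq_sum_card_fiberwise hmaps, Finset.card_univ,
      Finset.sum_ite_eq', if_pos (by simp)]
  have hodd : Odd r := by
    rw [hr, ← Finset.odd_sum_iff_odd_card_odd, hμsum, Nat.odd_iff]
    omega
  have hite : r = ∑ d ∈ Finset.range (3 * q + 1), if Odd (μ d) then 1 else 0 := by
    rw [hr, Finset.card_filter]
  have hle : ∀ d ∈ Finset.range (3 * q + 1), (if Odd (μ d) then 1 else 0) ≤ μ d := by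
    intro d _
    split_ifs with h
    · exact h.pos
    · exact Nat.zero_le _
  have hrle : r ≤ Fintype.card T + (1 - j % 2) := by
    rw [hite, ← hμsum]; exact Finset.sum_le_sum hle
  have hmain : levelSum j (fun x => ∏ t, (-1) ^ (x / 2 ^ c t)) =
      ∑ x ∈ (Finset.range (2 ^ (3 * q + 1))).filter (fun x => bitSum (3 * q + 1) x ≤ q),
      (levelWeight q (bitSum (3 * q + 1) x) : ℤ) *
        ∏ d ∈ Finset.range (3 * q + 1), ((-1) ^ (1 + μ d)) ^ (x / 2 ^ d % 2) := by
    refine Finset.sum_congr rfl fun x _ => ?_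
    rw [mul_assoc]
    congr 1
    have h1 : ∏ t, (-1 : ℤ) ^ (x / 2 ^ c t) =
        (-1) ^ ∑ d ∈ Finset.range (3 * q + 1),
          (Finset.univ.filter fun t => c t = d).card * (x / 2 ^ d % 2) := by
      rw [← Finset.prod_pow_eq_pow_sum, ← Finset.prod_fiberwise_of_maps_to hmaps]
      refine Finset.prod_congr rfl fun d _ => ?_
      rw [Finset.prod_congr rfl (g := fun _ => (-1 : ℤ) ^ (x / 2 ^ d % 2)), Finset.prod_const,
        ← pow_mul, mul_comm]
      intro t ht
      rw [(Finset.mem_filter.1 ht).2, neg_one_pow_mod_two]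
    have h2 : (-1 : ℤ) ^ mainSign j x 0 = (-1) ^ (bitSum (3 * q + 1) x +
        (1 - j % 2) * (x / 2 ^ (3 * q) % 2)) := by
      rw [mainSign, zero_mul, add_zero, pow_add, pow_add, mul_comm (1 - j % 2),
        pow_mul _ (x / 2 ^ (3 * (j / 2))), mul_comm (1 - j % 2), pow_mul _ (x / 2 ^ (3 * q) % 2),
        neg_one_pow_mod_two]
    beta_reduce
    rw [h1, h2, ← pow_add]
    simp only [← pow_mul, Finset.prod_pow_eq_pow_sum]
    congr 1
    simp only [hμ, add_mul, ite_mul, zero_mul, one_mul, Finset.sum_add_distrib, bitSum]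
    rw [Finset.sum_ite_eq', if_pos (by simp)]
    ring
  have hprod : ∏ d ∈ Finset.range (3 * q + 1), (1 + Polynomial.C ((-1 : ℤ) ^ (1 + μ d)) *
      Polynomial.X) = (1 + Polynomial.X) ^ r * (1 - Polynomial.X) ^ (3 * q + 1 - r) := by
    rw [← Finset.prod_filter_mul_prod_filter_not _ fun d => Odd (μ d)]
    congr 1
    · rw [Finset.prod_congr rfl (g := fun _ => (1 + Polynomial.X : Polynomial ℤ)),
        Finset.prod_const]
      intro d hd
      rw [Even.neg_one_pow (by have := (Finset.mem_filter.1 hd).2; grind)]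
      simp
    · rw [Finset.prod_congr rfl (g := fun _ => (1 - Polynomial.X : Polynomial ℤ)),
        Finset.prod_const, Finset.filter_not, Finset.card_sdiff_of_subset (Finset.filter_subset _ _),
        Finset.card_range]
      intro d hd
      rw [Odd.neg_one_pow (by have := (Finset.mem_filter.1 hd).2; grind)]
      simp [sub_eq_add_neg]
  rw [hmain, sum_levelWeight_mul_prod, hprod, sum_levelWeight_mul_coeff_pow hodd (by omega)]
  refine congr_arg _ (if_congr ?_ rfl rfl)
  constructor
  · intro h
    refine ⟨by omega, fun t t' htt => ?_⟩
    -- The total of `μ` is at most `2q + 1 = r`, so the bound of each parity indicator by `μ d` is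
    -- an equality and every `μ d` is at most `1`.
    have heq := (Finset.sum_eq_sum_iff_of_le hle).1 (by rw [← hite, hμsum]; omega) (c t)
      (hmaps t (Finset.mem_univ t))
    have h1 : (Finset.univ.filter fun t' => c t' = c t).card ≤ 1 := by
      have : μ (c t) ≤ 1 := by rw [← heq]; split_ifs <;> simp
      simp only [hμ] at this
      omega
    exact Finset.card_le_one.1 h1 _ (by simp) _ (by simp [htt])
  · rintro ⟨h1, h2⟩
    have : r = Fintype.card T + (1 - j % 2) := by
      rw [hite, ← hμsum]
      refine Finset.sum_congr rfl fun d _ => ?_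
      have hf : (Finset.univ.filter fun t => c t = d).card ≤ 1 := by
        rw [Finset.card_le_one]
        intro a ha b hb
        simp only [Finset.mem_filter, Finset.mem_univ, true_and] at ha hb
        exact h2 (ha.trans hb.symm)
      have : μ d ≤ 1 := by
        simp only [hμ]
        split_ifs with hd
        -- For even `j` all colours are below `3q`, so the spare position has no other contribution.
        · rcases Nat.eq_zero_or_pos (1 - j % 2) with h0 | h0
          · omega
          · rw [Finset.card_eq_zero.2]
            · omega
            · refine Finset.filter_eq_empty_iff.2 fun t _ => ?_
              have := hc t
              omega
        · omega
      interval_cases μ d <;> simp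
    omega

/-! ### What the main test computes -/

theorem levelSum_sum {ι : Type*} (j : ℕ) (s : Finset ι) (g : ι → ℕ → ℤ) :
    levelSum j (fun x => ∑ i ∈ s, g i x) = ∑ i ∈ s, levelSum j (g i) := by
  simp only [levelSum, Finset.mul_sum]
  exact Finset.sum_comm

theorem levelSum_mul (j : ℕ) (a : ℤ) (g : ℕ → ℤ) :
    levelSum j (fun x => a * g x) = a * levelSum j g := by
  simp only [levelSum, Finset.mul_sum]
  exact Finset.sum_congr rfl fun x _ => by ring

/-- The factor by which `levelSum` multiplies products of `j` distinct signs. -/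
def levelFactor (j : ℕ) : ℕ := (j / 2).factorial * 4 ^ (j / 2)

theorem levelFactor_pos (j : ℕ) : 0 < levelFactor j :=
  Nat.mul_pos (Nat.factorial_pos _) (by positivity)

section

variable {n : ℕ}

theorem card_sigma_fin (α : Fin n →₀ ℕ) : Fintype.card ((i : Fin n) × Fin (α i)) = α.degree := by
  simp [Finsupp.degree_eq_sum]

/-- The map `φ` chooses a slot for each of the `α.degree` linear factors; `levelSum_prod_sign` then
applies to each choice. -/
theorem levelSum_monomial {j : ℕ} (w : Fin n → Fin j → ℤ) (col : Fin n → Fin j → ℕ)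
    (hcol : ∀ i l, col i l < j + j / 2) (α : Fin n →₀ ℕ) (hα : α.degree ≤ j)
    (hα' : α.degree % 2 = j % 2) [∀ φ : (i : Fin n) × Fin (α i) → Fin j,
      Decidable (Function.Injective fun t => col t.1 (φ t))] :
    levelSum j (fun x => ∏ i, (∑ l, w i l * (-1) ^ (x / 2 ^ col i l)) ^ α i) =
      ∑ φ : (i : Fin n) × Fin (α i) → Fin j, (∏ t, w t.1 (φ t)) *
        if α.degree = j ∧ Function.Injective (fun t => col t.1 (φ t)) then
          (levelFactor j : ℤ) else 0 := by
  have hexp : ∀ x, ∏ i, (∑ l, w i l * (-1) ^ (x / 2 ^ col i l)) ^ α i =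
      ∑ φ : (i : Fin n) × Fin (α i) → Fin j, (∏ t, w t.1 (φ t)) *
        ∏ t, (-1) ^ (x / 2 ^ col t.1 (φ t)) := by
    intro x
    have h : ∏ i, (∑ l, w i l * (-1) ^ (x / 2 ^ col i l)) ^ α i =
        ∏ t : (i : Fin n) × Fin (α i), ∑ l, w t.1 l * (-1) ^ (x / 2 ^ col t.1 l) := by
      rw [Fintype.prod_sigma]
      simp
    rw [h, Finset.prod_univ_sum, Fintype.piFinset_univ]
    simp only [Finset.prod_mul_distrib]
  simp only [hexp]
  rw [levelSum_sum]
  refine Finset.sum_congr rfl fun φ _ => ?_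
  rw [levelSum_mul, levelSum_prod_sign _ (fun t => hcol _ _) (by rwa [card_sigma_fin])
    (by rwa [card_sigma_fin]), card_sigma_fin]
  congr 1
  push_cast [levelFactor]
  split_ifs <;> simp_all

/-- The integer that the main test for degree `j` tests for being nonzero. -/
noncomputable def residue (f : MvPolynomial (Fin n) ℤ) (j : ℕ) (w : Fin n → Fin j → ℤ)
    (col : Fin n → Fin j → ℕ) : ℤ :=
  ∑ α ∈ f.support.filter fun α => α.degree = j, f.coeff α *
    levelSum j fun x => ∏ i, (∑ l, w i l * (-1) ^ (x / 2 ^ col i l)) ^ α i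

/-- The polynomial function on sequences defined by a polynomial in finitely many variables. -/
noncomputable def evalSeq (f : MvPolynomial (Fin n) ℤ) (pt : ℕ → ℤ) : ℤ :=
  MvPolynomial.eval (fun i : Fin n => pt i) f

theorem evalSeq_eq (f : MvPolynomial (Fin n) ℤ) (pt : ℕ → ℤ) :
    evalSeq f pt = ∑ α ∈ f.support, f.coeff α * ∏ i : Fin n, pt i ^ α i :=
  MvPolynomial.eval_eq' _ _

/-- The weight of a slot in the main test. -/
def slotWeight (inp : ℕ → ℕ) (j B ζ : ℕ) (i : Fin n) (l : Fin j) : ℤ :=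
  (digit B ζ (i * j + l) : ℤ) * if (l : ℕ) + 2 ≤ inp (66 + i) then 1 else 0

/-- The colour of a slot in the main test. -/
def slotColour (j B γ : ℕ) (i : Fin n) (l : Fin j) : ℕ := digit B γ (i * j + l) % (j + j / 2)

theorem mainSum_evalSeq (f : MvPolynomial (Fin n) ℤ) (inp : ℕ → ℕ) (j B P ζ γ : ℕ) :
    mainSum (evalSeq f) inp j B P ζ γ = ∑ α ∈ f.support, f.coeff α * P ^ α.degree *
      (1 + (-1) ^ (j + α.degree)) * levelSum j fun x => ∏ i : Fin n,
        (∑ l, slotWeight inp j B ζ i l * (-1) ^ (x / 2 ^ slotColour j B γ i l)) ^ α i := by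
  have hs : ∀ x (i : Fin n), signedForm (fun i => inp (66 + i)) j B (j + j / 2) ζ γ x i =
      ∑ l, slotWeight inp j B ζ i l * (-1) ^ (x / 2 ^ slotColour j B γ i l) := by
    intro x i
    rw [signedForm, Finset.sum_range]
    rfl
  have hF : ∀ x σ, evalSeq f (mainPoint inp j B P ζ γ x σ) = ∑ α ∈ f.support,
      f.coeff α * (P ^ α.degree * (-1) ^ (σ * α.degree)) * ∏ i : Fin n,
        (∑ l, slotWeight inp j B ζ i l * (-1) ^ (x / 2 ^ slotColour j B γ i l)) ^ α i := by
    intro x σ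
    rw [evalSeq_eq]
    refine Finset.sum_congr rfl fun α _ => ?_
    simp only [mainPoint, hs, mul_pow, Finset.prod_mul_distrib, Finset.prod_pow_eq_pow_sum,
      ← Finsupp.degree_eq_sum, ← pow_mul, ← Finset.mul_sum]
    ring
  rw [mainSum]
  simp only [levelSum, Finset.mul_sum]
  rw [Finset.sum_comm]
  refine Finset.sum_congr rfl fun x _ => ?_
  simp only [mainTerm, hF, Finset.mul_sum, ← Finset.sum_add_distrib]
  refine Finset.sum_congr rfl fun α _ => ?_
  have h1 : mainSign j x 1 = mainSign j x 0 + j := by simp [mainSign]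
  rw [h1, pow_add, pow_add, zero_mul, one_mul]
  ring

/-- By degree of the monomial: below `j`, the level sum kills the right parity and the two opposite
points the wrong one; above `j`, the factor `P ^ degree` is divisible by `P ^ (j + 1)`; degree `j`
gives the subtracted term. -/
theorem pow_dvd_mainSum_sub (f : MvPolynomial (Fin n) ℤ) (inp : ℕ → ℕ) (j B P ζ γ : ℕ) :
    (P : ℤ) ^ (j + 1) ∣ mainSum (evalSeq f) inp j B P ζ γ -
      2 * P ^ j * residue f j (slotWeight inp j B ζ) (slotColour j B γ) := by
  classical
  rw [mainSum_evalSeq, residue, Finset.mul_sum, Finset.sum_filter, ← Finset.sum_sub_distrib]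
  refine Finset.dvd_sum fun α _ => ?_
  rcases lt_trichotomy α.degree j with h | h | h
  · rw [if_neg h.ne, sub_zero]
    rcases Nat.even_or_odd (j + α.degree) with hp | hp
    · rw [levelSum_monomial _ _ _ _ h.le (by grind), Finset.sum_eq_zero, mul_zero]
      · exact dvd_zero _
      · intro φ _
        rw [if_neg fun h' => h.ne h'.1, mul_zero]
      · intro i l
        exact Nat.mod_lt _ (by have := l.2; omega)
    · rw [hp.neg_one_pow]
      simp
  · rw [if_pos h, h, (Even.add_self j).neg_one_pow]
    convert dvd_zero _ using 1
    ring
  · rw [if_neg h.ne', sub_zero, mul_assoc, mul_assoc]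
    exact Dvd.dvd.mul_left (Dvd.dvd.mul_right (pow_dvd_pow _ h) _) _

end

/-! ### Correctness of the main test -/

/-- The generators are monomials with coefficient `1`, so even over `ℤ` membership depends only on
the support. -/
theorem mem_span_X_pow_iff {n : ℕ} {e : Fin n → ℕ} {f : MvPolynomial (Fin n) ℤ} :
    f ∈ Ideal.span (Set.range fun i : Fin n => (MvPolynomial.X i : MvPolynomial (Fin n) ℤ) ^ e i) ↔
      ∀ α ∈ f.support, ∃ i, e i ≤ α i := by
  have h : (Set.range fun i : Fin n => (MvPolynomial.X i : MvPolynomial (Fin n) ℤ) ^ e i) =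
      (fun s => MvPolynomial.monomial s (1 : ℤ)) '' Set.range fun i => Finsupp.single i (e i) := by
    rw [← Set.range_comp]
    congr 1
    ext1 i
    simp [MvPolynomial.X_pow_eq_monomial]
  rw [h, MvPolynomial.mem_ideal_span_monomial_image]
  simp

section

variable {n : ℕ}

/-- If `e i ≤ α i`, then `α i` factors share the `e i - 1` usable slots of `x_i`; two of them take
the same slot, hence the same colour. This needs `e i ≠ 0`. -/
theorem residue_eq_zero {f : MvPolynomial (Fin n) ℤ} {e : Fin n → ℕ} {j : ℕ}
    {w : Fin n → Fin j → ℤ} {col : Fin n → Fin j → ℕ} (he : ∀ i, e i ≠ 0)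
    (hf : ∀ α ∈ f.support, ∃ i, e i ≤ α i) (hcol : ∀ i l, col i l < j + j / 2)
    (hw : ∀ i (l : Fin j), e i < (l : ℕ) + 2 → w i l = 0) : residue f j w col = 0 := by
  classical
  refine Finset.sum_eq_zero fun α hα => ?_
  obtain ⟨hα, hd⟩ := Finset.mem_filter.1 hα
  obtain ⟨i, hi⟩ := hf α hα
  rw [levelSum_monomial _ _ hcol _ hd.le (by rw [hd]), Finset.sum_eq_zero, mul_zero]
  intro φ _
  by_cases h : ∃ t, e t.1 < (φ t : ℕ) + 2
  · obtain ⟨t, ht⟩ := h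
    rw [Finset.prod_eq_zero (Finset.mem_univ t) (hw _ _ ht), zero_mul]
  · push Not at h
    have hmaps : ∀ s ∈ (Finset.univ : Finset (Fin (α i))),
        (φ ⟨i, s⟩ : ℕ) ∈ Finset.range (e i - 1) := by
      intro s _
      have := h ⟨i, s⟩
      rw [Finset.mem_range]
      dsimp only at this
      omega
    obtain ⟨s, _, s', _, hne, heq⟩ := Finset.exists_ne_map_eq_of_card_lt_of_maps_to
      (by rw [Finset.card_range, Finset.card_univ, Fintype.card_fin]; have := he i; omega) hmaps
    rw [if_neg, mul_zero]
    rintro ⟨-, hinj⟩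
    have := @hinj ⟨i, s⟩ ⟨i, s'⟩ (by simp only [Fin.ext heq])
    exact hne (by simpa using this)

/-- The residue as a polynomial in the weights of the slots. -/
noncomputable def residuePoly (f : MvPolynomial (Fin n) ℤ) (j : ℕ) (b : Fin n → Fin j → ℤ)
    (col : Fin n → Fin j → ℕ) : MvPolynomial (Fin (n * j)) ℤ :=
  open Classical in
  ∑ α ∈ f.support.filter fun α => α.degree = j, ∑ φ : (i : Fin n) × Fin (α i) → Fin j,
    MvPolynomial.C (f.coeff α * ((∏ t, b t.1 (φ t)) *
      if Function.Injective (fun t => col t.1 (φ t)) then (levelFactor j : ℤ) else 0)) *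
      ∏ t, MvPolynomial.X (finProdFinEquiv (t.1, φ t))

theorem eval_residuePoly (f : MvPolynomial (Fin n) ℤ) {j : ℕ} (b : Fin n → Fin j → ℤ)
    {col : Fin n → Fin j → ℕ} (hcol : ∀ i l, col i l < j + j / 2) (z : Fin (n * j) → ℤ) :
    MvPolynomial.eval z (residuePoly f j b col) =
      residue f j (fun i l => z (finProdFinEquiv (i, l)) * b i l) col := by
  classical
  simp only [residuePoly, residue, map_sum, map_mul, MvPolynomial.eval_C, map_prod,
    MvPolynomial.eval_X]
  refine Finset.sum_congr rfl fun α hα => ?_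
  have hd := (Finset.mem_filter.1 hα).2
  rw [levelSum_monomial _ _ hcol _ hd.le (by rw [hd]), Finset.mul_sum]
  refine Finset.sum_congr rfl fun φ _ => ?_
  simp only [Finset.prod_mul_distrib, hd, true_and]
  ring

theorem totalDegree_residuePoly_le (f : MvPolynomial (Fin n) ℤ) (j : ℕ) (b : Fin n → Fin j → ℤ)
    (col : Fin n → Fin j → ℕ) : (residuePoly f j b col).totalDegree ≤ j := by
  classical
  refine MvPolynomial.totalDegree_finsetSum_le fun α hα => MvPolynomial.totalDegree_finsetSum_le
    fun φ _ => (MvPolynomial.totalDegree_mul _ _).trans ?_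
  rw [MvPolynomial.totalDegree_C, zero_add]
  refine (MvPolynomial.totalDegree_finsetProd _ _).trans ?_
  simp only [MvPolynomial.totalDegree_X, Finset.sum_const, Finset.card_univ, card_sigma_fin,
    (Finset.mem_filter.1 hα).2]
  simp

/-- Give weight `1` to the first `a i` slots of each variable and `0` to all others. Any other
monomial of degree `j` exceeds `a` in some variable and must reuse a slot there, so it drops out.
The choices belonging to `a` contribute nonnegatively up to the common factor `f.coeff a`, so they
cannot cancel. -/
theorem eval_residuePoly_indicator {f : MvPolynomial (Fin n) ℤ} {j : ℕ} {b : Fin n → Fin j → ℤ}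
    {col : Fin n → Fin j → ℕ} {a : Fin n →₀ ℕ} (ha : a.degree = j) (haf : a ∈ f.support)
    (hb : ∀ i l, b i l = 0 ∨ b i l = 1)
    (hba : ∀ i (l : Fin j), (l : ℕ) < a i → b i l = 1)
    (hinj : ∀ i (l : Fin j) i' (l' : Fin j), (l : ℕ) < a i → (l' : ℕ) < a i' →
      col i l = col i' l' → i = i' ∧ l = l') :
    MvPolynomial.eval (fun v => if ((finProdFinEquiv.symm v).2 : ℕ) < a (finProdFinEquiv.symm v).1
      then 1 else 0) (residuePoly f j b col) ≠ 0 := by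
  classical
  simp only [residuePoly, map_sum, map_mul, MvPolynomial.eval_C, map_prod, MvPolynomial.eval_X,
    Equiv.symm_apply_apply]
  rw [Finset.sum_eq_single_of_mem a (Finset.mem_filter.2 ⟨haf, ha⟩)]
  · simp only [mul_assoc, ← Finset.mul_sum]
    refine mul_ne_zero (MvPolynomial.mem_support_iff.1 haf) (ne_of_gt ?_)
    have hpos : ∀ i (l : Fin j), 0 ≤ b i l := fun i l => by rcases hb i l with h | h <;> simp [h]
    -- The strictly positive choice puts the `s`-th factor `x_i` into slot `s`.
    refine Finset.sum_pos' (fun φ _ => ?_) ⟨fun t => ⟨t.2, ?_⟩, Finset.mem_univ _, ?_⟩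
    · refine mul_nonneg (Finset.prod_nonneg fun t _ => hpos _ _) (mul_nonneg ?_
        (Finset.prod_nonneg fun t _ => ?_)) <;> split_ifs <;> simp
    · have h1 := t.2.2
      have h2 : a t.1 ≤ a.degree := Finsupp.le_degree _ _
      omega
    · rw [Finset.prod_eq_one fun t _ => hba _ _ t.2.2, one_mul,
        Finset.prod_eq_one fun t _ => if_pos t.2.2, mul_one, if_pos]
      · exact_mod_cast levelFactor_pos j
      · rintro ⟨i, s⟩ ⟨i', s'⟩ h
        obtain ⟨rfl, h2⟩ := hinj i _ i' _ s.2 s'.2 h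
        have h3 : s = s' := Fin.ext (by simpa using h2)
        rw [h3]
  · intro α hα hne
    have hd := (Finset.mem_filter.1 hα).2
    obtain ⟨i, hi⟩ : ∃ i, a i < α i := by
      by_contra! hcon
      apply hne
      have hle : α ≤ a := hcon
      obtain ⟨β, hβ⟩ := exists_add_of_le hle
      have h0 : β.degree = 0 := by
        have := congr_arg Finsupp.degree hβ
        rw [map_add] at this
        omega
      rw [hβ, (Finsupp.degree_eq_zero_iff _).1 h0, add_zero]
    refine Finset.sum_eq_zero fun φ _ => ?_
    by_cases h : ∃ t, a t.1 ≤ (φ t : ℕ)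
    · obtain ⟨t, ht⟩ := h
      exact mul_eq_zero_of_right _ (Finset.prod_eq_zero (Finset.mem_univ t) (if_neg (by omega)))
    · push Not at h
      have hmaps : ∀ s ∈ (Finset.univ : Finset (Fin (α i))), (φ ⟨i, s⟩ : ℕ) ∈ Finset.range (a i) :=
        fun s _ => Finset.mem_range.2 (h ⟨i, s⟩)
      obtain ⟨s, _, s', _, hs, heq⟩ := Finset.exists_ne_map_eq_of_card_lt_of_maps_to
        (by rw [Finset.card_range, Finset.card_univ, Fintype.card_fin]; exact hi) hmaps
      rw [if_neg]
      · simp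
      · intro hinj'
        have := @hinj' ⟨i, s⟩ ⟨i, s'⟩ (by simp only [Fin.ext heq])
        exact hs (by simpa using this)

/-- The sum of the absolute values of the coefficients. -/
def coeffNorm (f : MvPolynomial (Fin n) ℤ) : ℕ := ∑ α ∈ f.support, (f.coeff α).natAbs

theorem sum_natAbs_coeff_le (f : MvPolynomial (Fin n) ℤ) (s : Finset (Fin n →₀ ℕ)) :
    ∑ α ∈ s, (f.coeff α).natAbs ≤ coeffNorm f := by
  classical
  rw [coeffNorm, ← Finset.sum_filter_add_sum_filter_not s (· ∈ f.support)]
  rw [Finset.sum_eq_zero (s := s.filter (· ∉ f.support)) fun α hα => by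
    simpa using (Finset.mem_filter.1 hα).2, add_zero]
  exact Finset.sum_le_sum_of_subset fun α hα => (Finset.mem_filter.1 hα).2

theorem coeffNorm_add_le (f g : MvPolynomial (Fin n) ℤ) :
    coeffNorm (f + g) ≤ coeffNorm f + coeffNorm g := by
  calc coeffNorm (f + g) ≤ ∑ α ∈ (f + g).support, ((f.coeff α).natAbs + (g.coeff α).natAbs) :=
        Finset.sum_le_sum fun α _ => by rw [MvPolynomial.coeff_add]; exact Int.natAbs_add_le _ _
    _ ≤ _ := by
      rw [Finset.sum_add_distrib]
      exact add_le_add (sum_natAbs_coeff_le f _) (sum_natAbs_coeff_le g _)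

theorem coeffNorm_sum_le {ι : Type*} (s : Finset ι) (f : ι → MvPolynomial (Fin n) ℤ) :
    coeffNorm (∑ i ∈ s, f i) ≤ ∑ i ∈ s, coeffNorm (f i) := by
  classical
  induction s using Finset.induction_on with
  | empty => simp [coeffNorm]
  | insert i s hi ih =>
    rw [Finset.sum_insert hi, Finset.sum_insert hi]
    exact (coeffNorm_add_le _ _).trans (by omega)

theorem coeffNorm_monomial_le (α : Fin n →₀ ℕ) (c : ℤ) :
    coeffNorm (MvPolynomial.monomial α c) ≤ c.natAbs := by
  classical
  refine (Finset.sum_le_sum_of_subset MvPolynomial.support_monomial_subset).trans ?_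
  simp

theorem coeffNorm_mul_le (f g : MvPolynomial (Fin n) ℤ) :
    coeffNorm (f * g) ≤ coeffNorm f * coeffNorm g := by
  have h : f * g = ∑ α ∈ f.support, ∑ β ∈ g.support,
      MvPolynomial.monomial (α + β) (f.coeff α * g.coeff β) := by
    conv_lhs => rw [f.as_sum, g.as_sum, Finset.sum_mul_sum]
    simp only [MvPolynomial.monomial_mul]
  have hprod : coeffNorm f * coeffNorm g = ∑ α ∈ f.support, ∑ β ∈ g.support,
      (f.coeff α).natAbs * (g.coeff β).natAbs := Finset.sum_mul_sum _ _ _ _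
  rw [h, hprod]
  refine (coeffNorm_sum_le _ _).trans (Finset.sum_le_sum fun α _ =>
    (coeffNorm_sum_le _ _).trans (Finset.sum_le_sum fun β _ =>
    (coeffNorm_monomial_le _ _).trans ?_))
  rw [Int.natAbs_mul]

theorem natAbs_sum_le {ι : Type*} (s : Finset ι) (g : ι → ℤ) :
    (∑ i ∈ s, g i).natAbs ≤ ∑ i ∈ s, (g i).natAbs := by
  zify
  exact Finset.abs_sum_le_sum_abs _ _

theorem natAbs_prod {ι : Type*} (s : Finset ι) (g : ι → ℤ) :
    (∏ i ∈ s, g i).natAbs = ∏ i ∈ s, (g i).natAbs := map_prod Int.natAbsHom g s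

theorem natAbs_residue_le (f : MvPolynomial (Fin n) ℤ) {j B : ℕ} {w : Fin n → Fin j → ℤ}
    {col : Fin n → Fin j → ℕ} (hcol : ∀ i l, col i l < j + j / 2) (hw : ∀ i l, (w i l).natAbs ≤ B) :
    (residue f j w col).natAbs ≤ coeffNorm f * ((j * B) ^ j * levelFactor j) := by
  classical
  refine (natAbs_sum_le _ _).trans (le_trans ?_ (Nat.mul_le_mul_right _
    (sum_natAbs_coeff_le f (f.support.filter fun α => α.degree = j))))
  rw [Finset.sum_mul]
  refine Finset.sum_le_sum fun α hα => ?_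
  have hd := (Finset.mem_filter.1 hα).2
  rw [Int.natAbs_mul]
  refine Nat.mul_le_mul_left _ ?_
  rw [levelSum_monomial _ _ hcol _ hd.le (by rw [hd])]
  refine (natAbs_sum_le _ _).trans ((Finset.sum_le_card_nsmul _ _ (B ^ j * levelFactor j)
    fun φ _ => ?_).trans_eq ?_)
  · rw [Int.natAbs_mul, natAbs_prod]
    refine Nat.mul_le_mul ?_ ?_
    · refine (Finset.prod_le_pow_card _ _ B fun t _ => hw _ _).trans_eq ?_
      rw [Finset.card_univ, card_sigma_fin, hd]
    · split_ifs <;> simp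
  · rw [Finset.card_univ, Fintype.card_fun, card_sigma_fin, hd, Fintype.card_fin, smul_eq_mul]
    ring

end

/-! ### Sufficient conditions for the success of a trial -/

/-- One difference turns `x^r` into a nonnegative combination of lower powers. Iterated differences
of powers at `0` are therefore nonnegative, and positive if the order is at most `r`. -/
theorem fwdDiff_iter_succ_pow_zero (m r : ℕ) :
    (fwdDiff (1 : ℤ))^[m + 1] (fun x => x ^ r) 0 =
      ∑ i ∈ Finset.range r, (r.choose i : ℤ) * (fwdDiff (1 : ℤ))^[m] (fun x => x ^ i) 0 := by
  have h : (fwdDiff (1 : ℤ) fun x : ℤ => x ^ r) =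
      ∑ i ∈ Finset.range r, r.choose i • fun x : ℤ => x ^ i := by
    ext x
    simp [nsmul_eq_mul, fwdDiff, add_pow, Finset.sum_range_succ, mul_comm]
  rw [Function.iterate_succ_apply, h, fwdDiff_iter_finsetSum, Finset.sum_apply]
  refine Finset.sum_congr rfl fun i _ => ?_
  rw [fwdDiff_iter_const_smul, Pi.smul_apply, nsmul_eq_mul]

theorem fwdDiff_iter_pow_zero_nonneg (m r : ℕ) :
    0 ≤ (fwdDiff (1 : ℤ))^[m] (fun x => x ^ r) 0 := by
  induction m generalizing r with
  | zero => exact pow_nonneg le_rfl r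
  | succ m ih =>
    rw [fwdDiff_iter_succ_pow_zero]
    exact Finset.sum_nonneg fun i _ => mul_nonneg (Nat.cast_nonneg _) (ih i)

theorem fwdDiff_iter_pow_zero_pos {m r : ℕ} (h : m < r) :
    0 < (fwdDiff (1 : ℤ))^[m + 1] (fun x => x ^ r) 0 := by
  rw [fwdDiff_iter_succ_pow_zero]
  refine Finset.sum_pos' (fun i _ => mul_nonneg (Nat.cast_nonneg _)
    (fwdDiff_iter_pow_zero_nonneg m i)) ⟨m, Finset.mem_range.2 h, ?_⟩
  rw [fwdDiff_iter_eq_factorial]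
  have h1 := Nat.choose_pos h.le
  have h2 := m.factorial_pos
  simp only [Pi.natCast_apply]
  positivity

/-- The factor by which the degree test multiplies the coefficients of monomials of degree `r`. -/
def degreeFactor (j r : ℕ) : ℤ :=
  ∑ t ∈ Finset.range (j + 2), (-1) ^ t * ((j + 1).choose t : ℤ) * (t : ℤ) ^ r

theorem degreeFactor_eq (j r : ℕ) :
    degreeFactor j r = (-1) ^ (j + 1) * (fwdDiff (1 : ℤ))^[j + 1] (fun x => x ^ r) 0 := by
  rw [fwdDiff_iter_eq_sum_shift, Finset.mul_sum, degreeFactor]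
  refine Finset.sum_congr rfl fun t ht => ?_
  have h : (-1 : ℤ) ^ (j + 1) * (-1) ^ (j + 1 - t) = (-1) ^ t := by
    rw [← pow_add, neg_one_pow_eq_pow_mod_two, neg_one_pow_eq_pow_mod_two (n := t)]
    congr 1
    have := Finset.mem_range.1 ht
    omega
  rw [smul_eq_mul, ← mul_assoc, ← mul_assoc, h]
  simp

theorem degreeFactor_eq_zero {j r : ℕ} (h : r ≤ j) : degreeFactor j r = 0 := by
  rw [degreeFactor_eq, fwdDiff_iter_pow_eq_zero_of_lt (by omega)]
  simp

theorem degreeFactor_ne_zero {j r : ℕ} (h : j < r) : degreeFactor j r ≠ 0 := by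
  rw [degreeFactor_eq]
  exact mul_ne_zero (pow_ne_zero _ (by norm_num)) (fwdDiff_iter_pow_zero_pos h).ne'

theorem natAbs_degreeFactor_le (j r : ℕ) :
    (degreeFactor j r).natAbs ≤ 2 ^ (j + 1) * (j + 1) ^ r := by
  refine (natAbs_sum_le _ _).trans ?_
  rw [← Nat.sum_range_choose, Finset.sum_mul]
  refine Finset.sum_le_sum fun t ht => ?_
  have := Finset.mem_range.1 ht
  rw [Int.natAbs_mul, Int.natAbs_mul, Int.natAbs_pow, Int.natAbs_pow]
  simpa using Nat.mul_le_mul_left _ (Nat.pow_le_pow_left (by omega : t ≤ j + 1) r)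

section

variable {n : ℕ}

/-- The polynomial that the degree test evaluates. -/
noncomputable def degreePoly (f : MvPolynomial (Fin n) ℤ) (j : ℕ) : MvPolynomial (Fin n) ℤ :=
  ∑ α ∈ f.support, MvPolynomial.monomial α (f.coeff α * degreeFactor j α.degree)

theorem coeff_degreePoly (f : MvPolynomial (Fin n) ℤ) (j : ℕ) (α : Fin n →₀ ℕ) :
    (degreePoly f j).coeff α = f.coeff α * degreeFactor j α.degree := by
  classical
  rw [degreePoly, MvPolynomial.coeff_sum]
  simp only [MvPolynomial.coeff_monomial]
  rw [Finset.sum_ite_eq']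
  split_ifs with h
  · rfl
  · rw [MvPolynomial.notMem_support_iff.1 h, zero_mul]

theorem totalDegree_degreePoly_le (f : MvPolynomial (Fin n) ℤ) (j : ℕ) :
    (degreePoly f j).totalDegree ≤ f.totalDegree := by
  refine Finset.sup_mono fun α hα => ?_
  rw [MvPolynomial.mem_support_iff, coeff_degreePoly] at hα
  exact MvPolynomial.mem_support_iff.2 (left_ne_zero_of_mul hα)

theorem degree_le_totalDegree {f : MvPolynomial (Fin n) ℤ} {α : Fin n →₀ ℕ} (h : α ∈ f.support) :
    α.degree ≤ f.totalDegree := MvPolynomial.le_totalDegree h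

theorem degreePoly_ne_zero {f : MvPolynomial (Fin n) ℤ} {j : ℕ} (h : j < f.totalDegree) :
    degreePoly f j ≠ 0 := by
  obtain ⟨α, hα, hj⟩ := Finset.lt_sup_iff.1 h
  intro h0
  have := congr_arg (MvPolynomial.coeff α) h0
  rw [coeff_degreePoly, MvPolynomial.coeff_zero, mul_eq_zero] at this
  exact this.elim (MvPolynomial.mem_support_iff.1 hα) (degreeFactor_ne_zero hj)

theorem degreeSum_evalSeq (f : MvPolynomial (Fin n) ℤ) (j B ζ : ℕ) :
    degreeSum (evalSeq f) j B ζ =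
      MvPolynomial.eval (fun i : Fin n => (digit B ζ i : ℤ)) (degreePoly f j) := by
  rw [degreePoly, map_sum]
  simp only [degreeSum, evalSeq_eq, Finset.mul_sum, MvPolynomial.eval_monomial]
  rw [Finset.sum_comm]
  refine Finset.sum_congr rfl fun α _ => ?_
  rw [degreeFactor, Finset.mul_sum, Finset.sum_mul]
  refine Finset.sum_congr rfl fun t _ => ?_
  rw [Finsupp.prod_fintype _ _ (by simp)]
  simp only [mul_pow, Finset.prod_mul_distrib, Finset.prod_pow_eq_pow_sum,
    ← Finsupp.degree_eq_sum]
  ring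

theorem degreeSum_evalSeq_eq_zero {f : MvPolynomial (Fin n) ℤ} {j : ℕ} (h : f.totalDegree ≤ j)
    (B ζ : ℕ) : degreeSum (evalSeq f) j B ζ = 0 := by
  have h0 : degreePoly f j = 0 := Finset.sum_eq_zero fun α hα => by
    rw [degreeFactor_eq_zero ((degree_le_totalDegree hα).trans h), mul_zero, map_zero]
  rw [degreeSum_evalSeq, h0, map_zero]

theorem natAbs_degreeSum_le (f : MvPolynomial (Fin n) ℤ) (j : ℕ) {B : ℕ} (hB : 0 < B) (ζ : ℕ) :
    (degreeSum (evalSeq f) j B ζ).natAbs ≤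
      coeffNorm f * (2 ^ (j + 1) * ((j + 1) * B) ^ f.totalDegree) := by
  rw [degreeSum_evalSeq, degreePoly, map_sum]
  refine (natAbs_sum_le _ _).trans ?_
  rw [coeffNorm, Finset.sum_mul]
  refine Finset.sum_le_sum fun α hα => ?_
  rw [MvPolynomial.eval_monomial, Finsupp.prod_fintype _ _ (by simp), Int.natAbs_mul,
    Int.natAbs_mul, mul_assoc, natAbs_prod]
  refine Nat.mul_le_mul_left _ ?_
  calc _ ≤ 2 ^ (j + 1) * (j + 1) ^ α.degree * B ^ α.degree := by
        refine Nat.mul_le_mul (natAbs_degreeFactor_le _ _) ?_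
        rw [Finsupp.degree_eq_sum, ← Finset.prod_pow_eq_pow_sum]
        refine Finset.prod_le_prod' fun i _ => ?_
        rw [Int.natAbs_pow]
        exact Nat.pow_le_pow_left (Nat.mod_lt _ hB).le _
    _ = 2 ^ (j + 1) * ((j + 1) * B) ^ α.degree := by rw [mul_pow]; ring
    _ ≤ _ := Nat.mul_le_mul_left _ (Nat.pow_le_pow_right (by positivity)
        (degree_le_totalDegree hα))

theorem slotColour_lt {j : ℕ} (B γ : ℕ) (i : Fin n) (l : Fin j) :
    slotColour j B γ i l < j + j / 2 := Nat.mod_lt _ (by have := l.2; omega)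

theorem natAbs_slotWeight_le (inp : ℕ → ℕ) (j : ℕ) {B : ℕ} (hB : 0 < B) (ζ : ℕ) (i : Fin n)
    (l : Fin j) : (slotWeight inp j B ζ i l).natAbs ≤ B := by
  rw [slotWeight]
  split_ifs
  · rw [mul_one, Int.natAbs_natCast]
    exact (Nat.mod_lt _ hB).le
  · simp

/-- If the polynomial lies in the ideal, no trial of the main test succeeds. -/
theorem not_mainGood {f : MvPolynomial (Fin n) ℤ} {inp : ℕ → ℕ} (j B ρ : ℕ)
    (he : ∀ i < n, inp (66 + i) ≠ 0) (hf : ∀ α ∈ f.support, ∃ i : Fin n, inp (66 + i) ≤ α i) :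
    ¬ MainGood (evalSeq f) inp n j B ρ := by
  rw [MainGood, not_not]
  have h := pow_dvd_mainSum_sub f inp j B (ρ % B + 1) (ρ / B % B ^ (n * j)) (ρ / B / B ^ (n * j))
  rwa [residue_eq_zero (e := fun i : Fin n => inp (66 + i)) (fun i => he i i.2) hf
    (slotColour_lt _ _), mul_zero, sub_zero] at h
  intro i l hl
  rw [slotWeight, if_neg (by omega), mul_zero]

theorem mainGood_of_prime {f : MvPolynomial (Fin n) ℤ} {inp : ℕ → ℕ} {j B ρ : ℕ}
    (hp : (ρ % B + 1).Prime) (hd : ¬ ((ρ % B + 1 : ℕ) : ℤ) ∣ 2 * residue f j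
      (slotWeight inp j B (ρ / B % B ^ (n * j))) (slotColour j B (ρ / B / B ^ (n * j)))) :
    MainGood (evalSeq f) inp n j B ρ := by
  intro h
  have h' := pow_dvd_mainSum_sub f inp j B (ρ % B + 1) (ρ / B % B ^ (n * j)) (ρ / B / B ^ (n * j))
  have h2 := (dvd_sub_right h).1 h'
  rw [mul_comm (2 : ℤ), mul_assoc, pow_succ] at h2
  exact hd (Int.dvd_of_mul_dvd_mul_left (pow_ne_zero _ (by exact_mod_cast hp.ne_zero)) h2)

theorem not_degreeGood {f : MvPolynomial (Fin n) ℤ} {j : ℕ} (h : f.totalDegree ≤ j) (B ρ : ℕ) :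
    ¬ DegreeGood (evalSeq f) j B ρ := by
  rw [DegreeGood, not_not, degreeSum_evalSeq_eq_zero h]
  exact dvd_zero _

end

/-! ### Success probabilities, by counting draws and by the coin measure. -/

/-! ### Counting the successful trials -/

theorem card_filter_range_mul (a b : ℕ) (p : ℕ → ℕ → Prop) [∀ x y, Decidable (p x y)] :
    ((Finset.range (a * b)).filter fun x => p (x % a) (x / a)).card =
      ∑ y ∈ Finset.range b, ((Finset.range a).filter fun x => p x y).card := by
  simp only [Finset.card_filter]
  induction b with
  | zero => simp
  | succ b ih =>
    rw [Nat.mul_succ, Finset.sum_range_add, ih, Finset.sum_range_succ]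
    congr 1
    refine Finset.sum_congr rfl fun x hx => ?_
    have hx := Finset.mem_range.1 hx
    rw [Nat.mul_add_mod, Nat.mod_eq_of_lt hx, Nat.mul_add_div (by omega), Nat.div_eq_of_lt hx,
      add_zero]

/-- Chaining of conditional probabilities without division: for each good high part `y`, a
proportion of at least `A / (K * a)` of the low parts is good. -/
theorem mul_card_le_mul_card_filter_range_mul {a b K A : ℕ} (p : ℕ → ℕ → Prop) (q : ℕ → Prop)
    [∀ x y, Decidable (p x y)] [DecidablePred q]
    (h : ∀ y < b, q y → A ≤ K * ((Finset.range a).filter fun x => p x y).card) :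
    A * ((Finset.range b).filter q).card ≤
      K * ((Finset.range (a * b)).filter fun x => p (x % a) (x / a)).card := by
  rw [card_filter_range_mul, mul_comm A, Finset.mul_sum]
  refine (Finset.card_nsmul_le_sum _ _ A fun y hy => ?_).trans
    (Finset.sum_le_sum_of_subset (Finset.filter_subset q _))
  obtain ⟨h1, h2⟩ := Finset.mem_filter.1 hy
  exact h y (Finset.mem_range.1 h1) h2

theorem card_filter_digit (B m : ℕ) (Q : (Fin m → ℕ) → Prop) [DecidablePred Q] :
    ((Finset.range (B ^ m)).filter fun ζ => Q fun v => digit B ζ v).card =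
      (Finset.univ.filter fun g : Fin m → Fin B => Q fun v => g v).card := by
  symm
  refine Finset.card_bij (fun g _ => (finFunctionFinEquiv g : ℕ)) ?_ ?_ ?_
  · intro g hg
    have h : (fun v : Fin m => digit B (finFunctionFinEquiv g : ℕ) v) = fun v => (g v : ℕ) := by
      funext v
      rw [digit, ← finFunctionFinEquiv_symm_apply_val, Equiv.symm_apply_apply]
    rw [Finset.mem_filter, h]
    exact ⟨Finset.mem_range.2 (Fin.is_lt _), (Finset.mem_filter.1 hg).2⟩
  · intro g _ g' _ h
    exact finFunctionFinEquiv.injective (Fin.ext h)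
  · intro ζ hζ
    obtain ⟨h1, h2⟩ := Finset.mem_filter.1 hζ
    refine ⟨finFunctionFinEquiv.symm ⟨ζ, Finset.mem_range.1 h1⟩, ?_, by simp⟩
    rw [Finset.mem_filter]
    refine ⟨Finset.mem_univ _, ?_⟩
    simpa only [finFunctionFinEquiv_symm_apply_val, digit] using h2

/-- Schwartz–Zippel on the grid of digits: with `B ≥ 2d`, at most half of the points are zeros. -/
theorem card_filter_digit_eval_ne_zero {m d B : ℕ} {p : MvPolynomial (Fin m) ℤ} (hp : p ≠ 0)
    (hd : p.totalDegree ≤ d) (hB : 2 * d ≤ B) (hB₀ : 0 < B) :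
    B ^ m ≤ 2 * ((Finset.range (B ^ m)).filter fun ζ =>
      MvPolynomial.eval (fun v : Fin m => (digit B ζ v : ℤ)) p ≠ 0).card := by
  classical
  set S : Finset ℤ := (Finset.range B).map Nat.castEmbedding with hS
  have hSc : S.card = B := by simp [hS]
  have hsz := MvPolynomial.schwartz_zippel_totalDegree hp S
  set Z := ((Fintype.piFinset fun _ : Fin m => S).filter fun g => MvPolynomial.eval g p = 0).card
    with hZ
  rw [hSc, div_le_div_iff₀ (by positivity) (by positivity)] at hsz
  have hsz' : Z * B ≤ p.totalDegree * B ^ m := by exact_mod_cast hsz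
  have h2 : 2 * Z ≤ B ^ m := by
    refine Nat.le_of_mul_le_mul_right ?_ hB₀
    calc 2 * Z * B = 2 * (Z * B) := by ring
      _ ≤ 2 * (p.totalDegree * B ^ m) := Nat.mul_le_mul_left _ hsz'
      _ = (2 * p.totalDegree) * B ^ m := by ring
      _ ≤ B * B ^ m := Nat.mul_le_mul_right _ (by omega)
      _ = B ^ m * B := mul_comm _ _
  have hZ' : ((Finset.range (B ^ m)).filter fun ζ =>
      MvPolynomial.eval (fun v : Fin m => (digit B ζ v : ℤ)) p = 0).card = Z := by
    rw [card_filter_digit B m fun z => MvPolynomial.eval (fun v : Fin m => (z v : ℤ)) p = 0, hZ]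
    refine Finset.card_bij (fun g _ v => ((g v : ℕ) : ℤ)) ?_ ?_ ?_
    · intro g hg
      rw [Finset.mem_filter, Fintype.mem_piFinset]
      exact ⟨fun v => by simp [hS], (Finset.mem_filter.1 hg).2⟩
    · intro g _ g' _ h
      funext v
      exact Fin.ext (by exact_mod_cast congr_fun h v)
    · intro g hg
      obtain ⟨h1, h2⟩ := Finset.mem_filter.1 hg
      rw [Fintype.mem_piFinset] at h1
      have h3 : ∀ v, ∃ x : Fin B, ((x : ℕ) : ℤ) = g v := by
        intro v
        obtain ⟨x, hx, hxg⟩ := Finset.mem_map.1 (h1 v)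
        exact ⟨⟨x, Finset.mem_range.1 hx⟩, hxg⟩
      choose g' hg' using h3
      refine ⟨g', ?_, funext hg'⟩
      rw [Finset.mem_filter]
      refine ⟨Finset.mem_univ _, ?_⟩
      simpa only [hg'] using h2
  have hsum := Finset.card_filter_add_card_filter_not (s := Finset.range (B ^ m)) (fun ζ =>
      MvPolynomial.eval (fun v : Fin m => (digit B ζ v : ℤ)) p = 0)
  rw [Finset.card_range, hZ'] at hsum
  simp only [ne_eq]
  omega

/-- Colours are digits modulo `M`, and `M` need not divide `B`. By Bernoulli's inequality,
discarding the incomplete last block of residues for `j` digits costs at most a factor `2`. -/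
theorem pow_le_two_mul_mul_div_pow {B M j : ℕ} (hB : 2 * j * M ≤ B) (hB₀ : 0 < B)
    (hM : 0 < M) : B ^ j ≤ 2 * (M * (B / M)) ^ j := by
  have hBr : (0 : ℝ) < B := by exact_mod_cast hB₀
  have h1 : (B : ℝ) - M ≤ (M * (B / M) : ℕ) := by
    have h := Nat.div_add_mod B M
    have := Nat.mod_lt B hM
    have h' : B ≤ M * (B / M) + M := by omega
    have : (B : ℝ) ≤ (M * (B / M) : ℕ) + M := by exact_mod_cast h'
    linarith
  rcases Nat.eq_zero_or_pos j with rfl | hj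
  · simp
  have hMB : M ≤ B := le_trans (by nlinarith) hB
  have hMB' : (M : ℝ) ≤ B := by exact_mod_cast hMB
  have hx : (M : ℝ) / B ≤ 1 := (div_le_one hBr).2 hMB'
  have h2 := one_add_mul_le_pow (show (-2 : ℝ) ≤ -(M / B) by linarith) j
  have h3 : (1 : ℝ) / 2 ≤ 1 + j * -((M : ℝ) / B) := by
    have h4 : (2 : ℝ) * j * M ≤ B := by exact_mod_cast hB
    have h5 : (j : ℝ) * (M / B) ≤ 1 / 2 := by
      rw [← mul_div_assoc, div_le_iff₀ hBr]
      linarith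
    linarith
  have h6 : ((B : ℝ) - M) ^ j = B ^ j * (1 + -((M : ℝ) / B)) ^ j := by
    rw [← mul_pow]
    congr 1
    field_simp
    ring
  have h7 : (B : ℝ) ^ j ≤ 2 * ((B : ℝ) - M) ^ j := by
    rw [h6]
    have := pow_pos hBr j
    nlinarith [h3.trans h2]
  have h8 : ((B : ℝ) - M) ^ j ≤ ((M * (B / M) : ℕ) : ℝ) ^ j :=
    pow_le_pow_left₀ (by linarith) h1 j
  have h9 : (B : ℝ) ^ j ≤ 2 * ((M * (B / M) : ℕ) : ℝ) ^ j := by linarith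
  exact_mod_cast h9

/-- `F` builds good digit vectors injectively, from an injective colouring of `S`, a quotient by `M`
for each slot of `S`, and arbitrary digits elsewhere. -/
theorem card_filter_digit_injOn {m B M : ℕ} (S : Finset (Fin m)) (hB : 2 * S.card * M ≤ B)
    (hB₀ : 0 < B) (hM : 0 < M) [DecidablePred fun γ => Set.InjOn (fun v : Fin m => digit B γ v % M) S] :
    M.descFactorial S.card * B ^ m ≤ 2 * M ^ S.card * ((Finset.range (B ^ m)).filter fun γ =>
      Set.InjOn (fun v : Fin m => digit B γ v % M) S).card := by
  classical
  have hdig := card_filter_digit B m fun z => Set.InjOn (fun v : Fin m => z v % M) S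
  set G := Finset.univ.filter fun g : Fin m → Fin B => Set.InjOn (fun v : Fin m => (g v : ℕ) % M) S
  have hlt : ∀ (x : Fin M) (y : Fin (B / M)), (x : ℕ) + M * y < B := by
    intro x y
    have h1 : M * (B / M) ≤ B := Nat.mul_div_le B M
    have h2 : M * ((y : ℕ) + 1) ≤ M * (B / M) := Nat.mul_le_mul_left _ y.2
    have := x.2
    rw [Nat.mul_succ] at h2
    omega
  let F : (S ↪ Fin M) × (S → Fin (B / M)) × ((Sᶜ : Finset (Fin m)) → Fin B) → (Fin m → Fin B) :=
    fun t v => if h : v ∈ S then ⟨(t.1 ⟨v, h⟩ : ℕ) + M * t.2.1 ⟨v, h⟩, hlt _ _⟩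
      else t.2.2 ⟨v, Finset.mem_compl.2 h⟩
  have hmod : ∀ t v (h : v ∈ S), (F t v : ℕ) % M = t.1 ⟨v, h⟩ := by
    intro t v h
    simp only [F, dif_pos h, Nat.add_mul_mod_self_left]
    exact Nat.mod_eq_of_lt (Fin.is_lt _)
  have hdiv : ∀ t v (h : v ∈ S), (F t v : ℕ) / M = t.2.1 ⟨v, h⟩ := by
    intro t v h
    simp only [F, dif_pos h]
    rw [Nat.add_mul_div_left _ _ hM, Nat.div_eq_of_lt (Fin.is_lt _), zero_add]
  have hF : Function.Injective F := by
    rintro t t' h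
    refine Prod.ext ?_ (Prod.ext ?_ ?_)
    · ext v
      rw [← hmod t v v.2, h, hmod t' v v.2]
    · ext v
      rw [← hdiv t v v.2, h, hdiv t' v v.2]
    · funext v
      have := congr_fun h v
      simpa only [F, dif_neg (Finset.mem_compl.1 v.2)] using this
  have hmem : ∀ t, F t ∈ G := by
    intro t
    refine Finset.mem_filter.2 ⟨Finset.mem_univ _, fun v hv v' hv' h => ?_⟩
    dsimp only at h
    rw [hmod t v hv, hmod t v' hv'] at h
    have := t.1.injective (Fin.ext h)
    exact congr_arg Subtype.val this
  have hcard := Finset.card_le_card_of_injOn (s := Finset.univ) F (fun t _ => hmem t)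
    hF.injOn
  rw [Finset.card_univ, Fintype.card_prod, Fintype.card_prod, Fintype.card_embedding_eq,
    Fintype.card_fun, Fintype.card_fun, Fintype.card_fin, Fintype.card_fin, Fintype.card_fin,
    Fintype.card_coe, Fintype.card_coe, Finset.card_compl, Fintype.card_fin] at hcard
  have hle : S.card ≤ m := by simpa using Finset.card_le_univ S
  calc M.descFactorial S.card * B ^ m
      = M.descFactorial S.card * (B ^ S.card * B ^ (m - S.card)) := by
        rw [← pow_add, Nat.add_sub_cancel' hle]
    _ ≤ M.descFactorial S.card * (2 * (M * (B / M)) ^ S.card * B ^ (m - S.card)) :=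
        Nat.mul_le_mul_left _ (Nat.mul_le_mul_right _ (pow_le_two_mul_mul_div_pow hB hB₀ hM))
    _ = 2 * M ^ S.card * (M.descFactorial S.card * ((B / M) ^ S.card * B ^ (m - S.card))) := by
        rw [mul_pow]; ring
    _ ≤ 2 * M ^ S.card * G.card := Nat.mul_le_mul_left _ hcard
    _ = _ := by rw [← hdig]; congr!

theorem card_filter_prime_succ (B : ℕ) :
    ((Finset.range B).filter fun x => (x + 1).Prime).card = B.primeCounting := by
  rw [Nat.primeCounting, Nat.primeCounting', Nat.count_eq_card_filter_range,
    Finset.card_filter, Finset.card_filter, Finset.sum_range_succ']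
  simp [Nat.not_prime_zero]

/-- The product of the distinct primes dividing `v` divides `v`, and each is at least `2`. -/
theorem card_filter_prime_dvd_lt {B E : ℕ} {v : ℤ} (hv : v ≠ 0) (hE : v.natAbs < 2 ^ E) :
    ((Finset.range B).filter fun x => (x + 1).Prime ∧ ((x + 1 : ℕ) : ℤ) ∣ v).card ≤ E := by
  set s := (Finset.range B).filter fun x => (x + 1).Prime ∧ ((x + 1 : ℕ) : ℤ) ∣ v with hs
  have hdvd : ∏ p ∈ s.map (addRightEmbedding 1), p ∣ v.natAbs := by
    refine Finset.prod_primes_dvd _ (fun p hp => ?_) fun p hp => ?_ <;>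
      obtain ⟨x, hx, rfl⟩ := Finset.mem_map.1 hp <;>
      obtain ⟨-, h1, h2⟩ := Finset.mem_filter.1 hx
    · exact h1.prime
    · exact Int.natCast_dvd.1 h2
  have hle := Nat.le_of_dvd (Int.natAbs_pos.2 hv) hdvd
  have hpow : 2 ^ s.card ≤ ∏ p ∈ s.map (addRightEmbedding 1), p := by
    rw [← Finset.card_map (addRightEmbedding 1)]
    refine Finset.pow_card_le_prod _ _ _ fun p hp => ?_
    obtain ⟨x, hx, rfl⟩ := Finset.mem_map.1 hp
    exact (Finset.mem_filter.1 hx).2.1.two_le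
  exact ((Nat.pow_lt_pow_iff_right (by norm_num)).1 (hpow.trans_lt (hle.trans_lt hE))).le

theorem two_pow_le_mul_primeCounting {b : ℕ} (hb : 0 < b) :
    2 ^ b ≤ b * (2 ^ b).primeCounting + (b + 1) := by
  have h := Chebyshev.pi_ge (2 ^ b)
  have hl : (0 : ℝ) < Real.log 2 := Real.log_pos (by norm_num)
  have hb' : (0 : ℝ) < b := by exact_mod_cast hb
  push_cast at h
  rw [Real.log_pow, div_le_iff₀ (by positivity)] at h
  have h1 : Real.log (2 ^ b + 1) ≤ (b + 1) * Real.log 2 := by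
    have h2 : ((b : ℝ) + 1) * Real.log 2 = Real.log (2 ^ (b + 1)) := by
      rw [Real.log_pow]; push_cast; ring
    rw [h2]
    refine Real.log_le_log (by positivity) ?_
    have : (1 : ℝ) ≤ 2 ^ b := one_le_pow₀ (by norm_num)
    rw [pow_succ]
    linarith
  have h3 : ((2 : ℝ) ^ b) * Real.log 2 ≤
      (b * (2 ^ b).primeCounting + (b + 1)) * Real.log 2 := by nlinarith
  have h4 := le_of_mul_le_mul_right h3 hl
  exact_mod_cast h4

/-- By Chebyshev there are about `2^(8u) / (8u)` primes in the range, while `v` has at most `2^(4u)`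
prime divisors, only the square root of the size of the range. The factor `4` absorbs both this and
the error term. -/
theorem card_filter_prime_not_dvd {u : ℕ} {v : ℤ} (hu : 2 ≤ u) (hv : v ≠ 0)
    (hE : v.natAbs < 2 ^ 2 ^ (4 * u)) :
    2 ^ (8 * u) ≤ 4 * (8 * u) * ((Finset.range (2 ^ (8 * u))).filter fun x =>
      (x + 1).Prime ∧ ¬ ((x + 1 : ℕ) : ℤ) ∣ v).card := by
  have h1 := two_pow_le_mul_primeCounting (b := 8 * u) (by omega)
  have h2 := card_filter_prime_dvd_lt (B := 2 ^ (8 * u)) hv hE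
  have h3 := Finset.card_filter_add_card_filter_not
    (s := (Finset.range (2 ^ (8 * u))).filter fun x => (x + 1).Prime)
    (fun x => ((x + 1 : ℕ) : ℤ) ∣ v)
  rw [Finset.filter_filter, Finset.filter_filter, card_filter_prime_succ] at h3
  set g := ((Finset.range (2 ^ (8 * u))).filter fun x =>
      (x + 1).Prime ∧ ¬ ((x + 1 : ℕ) : ℤ) ∣ v).card
  set d := ((Finset.range (2 ^ (8 * u))).filter fun x =>
      (x + 1).Prime ∧ ((x + 1 : ℕ) : ℤ) ∣ v).card
  have hE2 : 128 * u ≤ 2 ^ (4 * u) := by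
    clear h1 h2 h3 hE
    induction u, hu using Nat.le_induction with
    | base => norm_num
    | succ u hu ih =>
      rw [show 4 * (u + 1) = 4 * u + 4 by ring, pow_add]
      omega
  have hB : 2 ^ (8 * u) = 2 ^ (4 * u) * 2 ^ (4 * u) := by rw [← pow_add]; congr 1; ring
  rw [← h3] at h1
  rw [hB] at h1 ⊢
  set E := 2 ^ (4 * u)
  have h4 : 8 * u * (d + g) ≤ 8 * u * (E + g) := Nat.mul_le_mul_left _ (by omega)
  have h5 : 128 * u * E ≤ E * E := Nat.mul_le_mul_right _ hE2
  have h6 : E ≤ E * E := Nat.le_mul_self E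
  nlinarith

section

variable {n : ℕ} {f : MvPolynomial (Fin n) ℤ} {inp : ℕ → ℕ}

/-- The slots used by a monomial. -/
def slots (j : ℕ) (a : Fin n →₀ ℕ) : Finset (Fin (n * j)) :=
  Finset.univ.filter fun v => ((finProdFinEquiv.symm v).2 : ℕ) < a (finProdFinEquiv.symm v).1

theorem card_slots {j : ℕ} {a : Fin n →₀ ℕ} (ha : a.degree = j) : (slots j a).card = j := by
  rw [slots, Finset.card_filter, ← finProdFinEquiv.sum_comp, Fintype.sum_prod_type]
  simp only [Equiv.symm_apply_apply]
  conv_rhs => rw [← ha, Finsupp.degree_eq_sum]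
  refine Finset.sum_congr rfl fun i _ => ?_
  have hle : a i ≤ j := ha ▸ Finsupp.le_degree i a
  rw [← Finset.sum_range (fun l => if l < a i then 1 else 0), ← Finset.card_filter]
  have : (Finset.range j).filter (fun l => l < a i) = Finset.range (a i) := by
    ext l; simp only [Finset.mem_filter, Finset.mem_range]; omega
  rw [this, Finset.card_range]

open Classical in
-- Choose `γ`, then `ζ`, then `P`. The monomial `a` gets distinct colours at a loss of `2 * M^j /
-- M.descFactorial j`, the weights lose a factor `2`, the prime a factor `4 * (8 * u)`; together `16
-- * (8 * u)`.
theorem card_mainGood {j u : ℕ} {a : Fin n →₀ ℕ} (hu : 2 ≤ u) (ha : a.degree = j)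
    (haf : a ∈ f.support) (hai : ∀ i : Fin n, a i < inp (66 + i))
    (hjB : 2 * j * (j + j / 2) ≤ 2 ^ (8 * u)) (hjB' : 2 * j ≤ 2 ^ (8 * u))
    (hf : 2 * (coeffNorm f * ((j * 2 ^ (8 * u)) ^ j * levelFactor j)) < 2 ^ 2 ^ (4 * u)) :
    (j + j / 2).descFactorial j * (2 ^ (8 * u)) ^ (1 + 2 * (n * j)) ≤
      16 * (8 * u) * (j + j / 2) ^ j * ((Finset.range ((2 ^ (8 * u)) ^ (1 + 2 * (n * j)))).filter
        fun ρ => MainGood (evalSeq f) inp n j (2 ^ (8 * u)) ρ).card := by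
  set B := 2 ^ (8 * u) with hB
  have hB₀ : 0 < B := by positivity
  set M := j + j / 2 with hM
  set b : Fin n → Fin j → ℤ := fun i l => if (l : ℕ) + 2 ≤ inp (66 + i) then 1 else 0 with hb
  set good : ℕ → Prop := fun γ =>
    Set.InjOn (fun v : Fin (n * j) => digit B γ v % M) (slots j a) with hgood
  have hval : ∀ (i : Fin n) (l : Fin j), ((finProdFinEquiv (i, l) : Fin (n * j)) : ℕ) = i * j + l := by
    intro i l
    rw [finProdFinEquiv_apply_val]; ring
  have h1 : M.descFactorial j * B ^ (n * j) ≤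
      2 * M ^ j * ((Finset.range (B ^ (n * j))).filter good).card := by
    -- For `j = 0` there are no colours (`M = 0`) and no slots, so injectivity is vacuous.
    rcases Nat.eq_zero_or_pos j with hj | hj
    · have hall : ∀ γ ∈ Finset.range (B ^ (n * j)), good γ := by
        intro γ _ v hv
        have h0 : slots j a = ∅ := Finset.card_eq_zero.1 ((card_slots ha).trans hj)
        rw [h0] at hv
        exact absurd hv (by simp)
      rw [Finset.filter_true_of_mem hall]
      simp [hj]
    · have := card_filter_digit_injOn (B := B) (M := M) (slots j a) (by rwa [card_slots ha]) hB₀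
        (by omega)
      rwa [card_slots ha] at this
  have h2 : B ^ (n * j) * ((Finset.range (B ^ (n * j))).filter good).card ≤
      2 * ((Finset.range (B ^ (n * j) * B ^ (n * j))).filter fun y => residue f j
        (slotWeight inp j B (y % B ^ (n * j))) (slotColour j B (y / B ^ (n * j))) ≠ 0).card := by
    refine mul_card_le_mul_card_filter_range_mul (fun ζ γ => residue f j
        (slotWeight inp j B ζ) (slotColour j B γ) ≠ 0) good fun γ _ hγ => ?_
    have heval := eval_residuePoly f b (slotColour_lt (j := j) B γ)
    have hne : residuePoly f j b (slotColour j B γ) ≠ 0 := by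
      intro h0
      refine eval_residuePoly_indicator (b := b) (col := slotColour j B γ) ha haf ?_ ?_ ?_
        (by rw [h0, map_zero])
      · intro i l
        simp only [hb]
        split_ifs <;> simp
      · intro i l hl
        have := hai i
        simp only [hb]
        rw [if_pos (by omega)]
      · intro i l i' l' hl hl' h
        have hS : ∀ i (l : Fin j), (l : ℕ) < a i → finProdFinEquiv (i, l) ∈ slots j a := by
          intro i l hl
          simpa only [slots, Finset.mem_filter, Finset.mem_univ, true_and,
            Equiv.symm_apply_apply] using hl
        have := hγ (hS i l hl) (hS i' l' hl') (by simp only [hval]; exact h)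
        simpa using this
    refine (card_filter_digit_eval_ne_zero hne (totalDegree_residuePoly_le _ _ _ _) hjB'
      hB₀).trans_eq ?_
    congr 2
    refine Finset.filter_congr fun ζ _ => ?_
    rw [heval]
    simp only [hval]
    rfl
  have h3 : B * ((Finset.range (B ^ (n * j) * B ^ (n * j))).filter fun y => residue f j
        (slotWeight inp j B (y % B ^ (n * j))) (slotColour j B (y / B ^ (n * j))) ≠ 0).card ≤
      4 * (8 * u) * ((Finset.range (B * (B ^ (n * j) * B ^ (n * j)))).filter fun ρ =>
        (ρ % B + 1).Prime ∧ ¬ ((ρ % B + 1 : ℕ) : ℤ) ∣ 2 * residue f j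
        (slotWeight inp j B (ρ / B % B ^ (n * j)))
        (slotColour j B (ρ / B / B ^ (n * j)))).card := by
    refine mul_card_le_mul_card_filter_range_mul (fun x y => (x + 1).Prime ∧
      ¬ ((x + 1 : ℕ) : ℤ) ∣ 2 * residue f j (slotWeight inp j B (y % B ^ (n * j)))
        (slotColour j B (y / B ^ (n * j)))) _ fun y _ hy => ?_
    refine card_filter_prime_not_dvd hu (mul_ne_zero two_ne_zero hy) ?_
    rw [Int.natAbs_mul]
    exact lt_of_le_of_lt (Nat.mul_le_mul_left 2 (natAbs_residue_le f (slotColour_lt _ _)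
      (natAbs_slotWeight_le _ _ hB₀ _))) hf
  have hpow : B ^ (1 + 2 * (n * j)) = B * (B ^ (n * j) * B ^ (n * j)) := by ring
  have h4 : ((Finset.range (B * (B ^ (n * j) * B ^ (n * j)))).filter fun ρ =>
        (ρ % B + 1).Prime ∧ ¬ ((ρ % B + 1 : ℕ) : ℤ) ∣ 2 * residue f j
        (slotWeight inp j B (ρ / B % B ^ (n * j)))
        (slotColour j B (ρ / B / B ^ (n * j)))).card ≤
      ((Finset.range (B ^ (1 + 2 * (n * j)))).filter
        fun ρ => MainGood (evalSeq f) inp n j B ρ).card := by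
    rw [hpow]
    refine Finset.card_le_card (Finset.monotone_filter_right _ ?_)
    intro ρ _ hρ
    exact mainGood_of_prime hρ.1 hρ.2
  rw [hpow] at h4 ⊢
  set c1 := ((Finset.range (B ^ (n * j))).filter good).card
  set c2 := ((Finset.range (B ^ (n * j) * B ^ (n * j))).filter fun y => residue f j
        (slotWeight inp j B (y % B ^ (n * j))) (slotColour j B (y / B ^ (n * j))) ≠ 0).card
  calc M.descFactorial j * (B * (B ^ (n * j) * B ^ (n * j)))
      = M.descFactorial j * B ^ (n * j) * (B * B ^ (n * j)) := by ring
    _ ≤ 2 * M ^ j * c1 * (B * B ^ (n * j)) := Nat.mul_le_mul_right _ h1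
    _ = 2 * M ^ j * B * (B ^ (n * j) * c1) := by ring
    _ ≤ 2 * M ^ j * B * (2 * c2) := Nat.mul_le_mul_left _ h2
    _ = 4 * M ^ j * (B * c2) := by ring
    _ ≤ 4 * M ^ j * (4 * (8 * u) * _) := Nat.mul_le_mul_left _ (h3.trans (Nat.mul_le_mul_left _ h4))
    _ = _ := by ring

open Classical in
theorem card_degreeGood {j u : ℕ} (hu : 2 ≤ u) (hj : j < f.totalDegree)
    (hB : 2 * f.totalDegree ≤ 2 ^ (8 * u))
    (hf : coeffNorm f * (2 ^ (j + 1) * ((j + 1) * 2 ^ (8 * u)) ^ f.totalDegree) <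
      2 ^ 2 ^ (4 * u)) :
    (2 ^ (8 * u)) ^ (1 + n) ≤ 8 * (8 * u) * ((Finset.range ((2 ^ (8 * u)) ^ (1 + n))).filter
        fun ρ => DegreeGood (evalSeq f) j (2 ^ (8 * u)) ρ).card := by
  have hB₀ : 0 < 2 ^ (8 * u) := by positivity
  set B := 2 ^ (8 * u)
  have h1 : B ^ n ≤ 2 * ((Finset.range (B ^ n)).filter fun ζ =>
      degreeSum (evalSeq f) j B ζ ≠ 0).card := by
    simp only [degreeSum_evalSeq]
    exact card_filter_digit_eval_ne_zero (degreePoly_ne_zero hj) (totalDegree_degreePoly_le f j)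
      hB hB₀
  have h2 : B * ((Finset.range (B ^ n)).filter fun ζ => degreeSum (evalSeq f) j B ζ ≠ 0).card ≤
      4 * (8 * u) * ((Finset.range (B * B ^ n)).filter fun ρ => (ρ % B + 1).Prime ∧
        ¬ ((ρ % B + 1 : ℕ) : ℤ) ∣ degreeSum (evalSeq f) j B (ρ / B)).card := by
    refine mul_card_le_mul_card_filter_range_mul (fun x y => (x + 1).Prime ∧
      ¬ ((x + 1 : ℕ) : ℤ) ∣ degreeSum (evalSeq f) j B y) _ fun y _ hy => ?_
    exact card_filter_prime_not_dvd hu hy ((natAbs_degreeSum_le f j hB₀ y).trans_lt hf)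
  have h3 : ((Finset.range (B * B ^ n)).filter fun ρ => (ρ % B + 1).Prime ∧
        ¬ ((ρ % B + 1 : ℕ) : ℤ) ∣ degreeSum (evalSeq f) j B (ρ / B)).card ≤
      ((Finset.range (B * B ^ n)).filter fun ρ => DegreeGood (evalSeq f) j B ρ).card :=
    Finset.card_le_card (Finset.monotone_filter_right _ fun ρ _ hρ => hρ.2)
  have hpow : B ^ (1 + n) = B * B ^ n := by ring
  rw [hpow]
  set c1 := ((Finset.range (B ^ n)).filter fun ζ => degreeSum (evalSeq f) j B ζ ≠ 0).card
  calc B * B ^ n ≤ B * (2 * c1) := Nat.mul_le_mul_left _ h1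
    _ = 2 * (B * c1) := by ring
    _ ≤ 2 * (4 * (8 * u) * _) := Nat.mul_le_mul_left _ (h2.trans (Nat.mul_le_mul_left _ h3))
    _ = _ := by ring

end

/-! ### Independent trials -/

instance : IsProbabilityMeasure coinMeasure := by
  unfold coinMeasure
  infer_instance

theorem eq_of_coinNumber_eq {ω ω' : ℕ → Bool} {c L : ℕ}
    (h : coinNumber ω c L = coinNumber ω' c L) : ∀ i < L, ω (c + i) = ω' (c + i) := by
  induction L with
  | zero => intro i hi; omega
  | succ L ih =>
    simp only [coinNumber] at h
    have h1 := Bool.toNat_le (ω (c + L))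
    have h2 := Bool.toNat_le (ω' (c + L))
    intro i hi
    rcases Nat.lt_succ_iff_lt_or_eq.1 hi with hi' | rfl
    · exact ih (by omega) i hi'
    · have h3 : (ω (c + i)).toNat = (ω' (c + i)).toNat := by omega
      revert h3
      cases ω (c + i) <;> cases ω' (c + i) <;> simp

theorem coinMeasure_box (ω₀ : ℕ → Bool) (s : Finset ℕ) :
    coinMeasure ((s : Set ℕ).pi fun i => {ω₀ i}) = 2⁻¹ ^ s.card := by
  rw [coinMeasure, Measure.infinitePi_pi _ fun i _ => MeasurableSet.singleton _]
  rw [Finset.prod_congr rfl (g := fun _ => (2⁻¹ : ℝ≥0∞)), Finset.prod_const]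
  intro i _
  rw [PMF.toMeasure_uniformOfFintype_apply _ (MeasurableSet.singleton _)]
  simp

open Classical in
-- A union bound over all tuples of bad draws: each tuple prescribes `T * L` coins, so its event is
-- empty or lies in a box of measure `2^(-T L)`. Only monotonicity and subadditivity are used, so
-- the event need not be shown measurable.
theorem coinMeasure_trials_le (Good : ℕ → Prop) (c L T : ℕ) :
    coinMeasure {ω | ∀ t < T, ¬ Good (coinNumber ω (c + t * L) L)} ≤
      (((Finset.range (2 ^ L)).filter fun ρ => ¬ Good ρ).card * (2⁻¹ : ℝ≥0∞) ^ L) ^ T := by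
  set Bad := (Finset.range (2 ^ L)).filter fun ρ => ¬ Good ρ
  have hsub : {ω | ∀ t < T, ¬ Good (coinNumber ω (c + t * L) L)} ⊆
      ⋃ y ∈ Fintype.piFinset fun _ : Fin T => Bad,
        {ω | ∀ t : Fin T, coinNumber ω (c + t * L) L = y t} := by
    intro ω hω
    simp only [Set.mem_iUnion]
    exact ⟨fun t => coinNumber ω (c + t * L) L, Fintype.mem_piFinset.2 fun t =>
      Finset.mem_filter.2 ⟨Finset.mem_range.2 (coinNumber_lt _ _ _), hω t t.2⟩, fun t => rfl⟩
  have hone : ∀ y : Fin T → ℕ,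
      coinMeasure {ω | ∀ t : Fin T, coinNumber ω (c + t * L) L = y t} ≤ 2⁻¹ ^ (T * L) := by
    intro y
    rcases Set.eq_empty_or_nonempty {ω | ∀ t : Fin T, coinNumber ω (c + t * L) L = y t} with h | h
    · rw [h]; simp
    · obtain ⟨ω₀, h₀⟩ := h
      have hbox := coinMeasure_box ω₀ (Finset.Ico c (c + T * L))
      rw [Nat.card_Ico, Nat.add_sub_cancel_left] at hbox
      rw [← hbox]
      refine measure_mono fun ω hω i hi => ?_
      obtain ⟨h1, h2⟩ := Finset.mem_Ico.1 (Finset.mem_coe.1 hi)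
      have hL : 0 < L := Nat.pos_of_ne_zero fun h => by simp [h] at h2; omega
      have hd := Nat.div_add_mod (i - c) L
      have ht : (i - c) / L < T := Nat.div_lt_of_lt_mul (by rw [mul_comm]; omega)
      have := eq_of_coinNumber_eq ((hω ⟨_, ht⟩).trans (h₀ ⟨_, ht⟩).symm) ((i - c) % L)
        (Nat.mod_lt _ hL)
      rw [show c + (i - c) / L * L + (i - c) % L = i by rw [mul_comm]; omega] at this
      exact this
  refine (measure_mono hsub).trans ((measure_biUnion_finset_le _ _).trans
    ((Finset.sum_le_sum fun y _ => hone y).trans_eq ?_))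
  rw [Finset.sum_const, Fintype.card_piFinset, Finset.prod_const, Finset.card_univ,
    Fintype.card_fin, mul_pow, ← pow_mul, mul_comm L T]
  simp

open Classical in
theorem coinMeasure_trials_le_exp {Good : ℕ → Prop} {δ : ℝ} {L : ℕ} (c T : ℕ)
    (h : δ * 2 ^ L ≤ ((Finset.range (2 ^ L)).filter Good).card) :
    coinMeasure {ω | ∀ t < T, ¬ Good (coinNumber ω (c + t * L) L)} ≤
      ENNReal.ofReal (Real.exp (-(δ * T))) := by
  refine (coinMeasure_trials_le Good c L T).trans ?_
  have hsum := Finset.card_filter_add_card_filter_not (s := Finset.range (2 ^ L)) Good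
  rw [Finset.card_range] at hsum
  set bad := ((Finset.range (2 ^ L)).filter fun ρ => ¬ Good ρ).card
  set good := ((Finset.range (2 ^ L)).filter Good).card
  have hsum' : (good : ℝ) + bad = 2 ^ L := by exact_mod_cast hsum
  have hp : (0 : ℝ) < 2 ^ L := by positivity
  have h1 : (bad : ℝ) * 2⁻¹ ^ L ≤ Real.exp (-δ) := by
    refine le_trans ?_ (Real.one_sub_le_exp_neg δ)
    rw [inv_pow, ← div_eq_mul_inv, div_le_iff₀ hp]
    nlinarith
  have h2 : ((bad : ℝ≥0∞) * 2⁻¹ ^ L) = ENNReal.ofReal (bad * 2⁻¹ ^ L) := by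
    rw [ENNReal.ofReal_mul (Nat.cast_nonneg _), ENNReal.ofReal_natCast,
      ENNReal.ofReal_pow (by norm_num), ENNReal.ofReal_inv_of_pos (by norm_num)]
    norm_num
  rw [h2, ← ENNReal.ofReal_pow (by positivity)]
  refine ENNReal.ofReal_le_ofReal ((pow_le_pow_left₀ (by positivity) h1 T).trans_eq ?_)
  rw [← Real.exp_nat_mul]
  congr 1
  ring

section

variable {n : ℕ} {f : MvPolynomial (Fin n) ℤ} {inp : ℕ → ℕ} {N : ℕ}

/-- The conditions on the sizes under which the trials at stage `j` succeed often enough. -/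
structure SizeBounds (f : MvPolynomial (Fin n) ℤ) (N j : ℕ) : Prop where
  color : 2 * j * (j + j / 2) ≤ 2 ^ (8 * (N + j + 2))
  deg : 2 * f.totalDegree ≤ 2 ^ (8 * (N + j + 2))
  main : 2 * (coeffNorm f * ((j * 2 ^ (8 * (N + j + 2))) ^ j * levelFactor j)) <
    2 ^ 2 ^ (4 * (N + j + 2))
  degree : coeffNorm f * (2 ^ (j + 1) * ((j + 1) * 2 ^ (8 * (N + j + 2))) ^ f.totalDegree) <
    2 ^ 2 ^ (4 * (N + j + 2))

theorem coinMeasure_not_mainFlag_le {j : ℕ} (hs : SizeBounds f N j) {a : Fin n →₀ ℕ}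
    (ha : a.degree = j) (haf : a ∈ f.support) (hai : ∀ i : Fin n, a i < inp (66 + i)) (c : ℕ) :
    coinMeasure {ω | ¬ MainFlag (evalSeq f) inp N n j ω c} ≤ ENNReal.ofReal (Real.exp (-4)) := by
  classical
  set u := N + j + 2 with hu
  have hjt : j ≤ f.totalDegree := ha ▸ degree_le_totalDegree haf
  have hcard := card_mainGood (u := u) (by omega) ha haf hai hs.color
    (le_trans (by omega) hs.deg) hs.main
  have hL : (2 ^ (8 * u)) ^ (1 + 2 * (n * j)) = 2 ^ mainLen N n j := by
    rw [mainLen, fieldBits, ← pow_mul]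
  set M := j + j / 2 with hM
  have hdesc : M.descFactorial j = ∏ t ∈ Finset.range j, (j / 2 + t + 1) := by
    rw [hM, add_comm j, Nat.add_descFactorial_eq_ascFactorial, Nat.ascFactorial_eq_prod_range]
    exact Finset.prod_congr rfl fun t _ => by ring
  have hDpos : 0 < M.descFactorial j := by
    rw [hdesc]; exact Finset.prod_pos fun t _ => by omega
  have hMpos : 0 < M ^ j := by
    rcases Nat.eq_zero_or_pos j with h | h
    · simp [h]
    · exact pow_pos (by omega) _
  have hMr : (0 : ℝ) < (M : ℝ) ^ j := by exact_mod_cast hMpos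
  have hDr : (0 : ℝ) < (M.descFactorial j : ℝ) := by exact_mod_cast hDpos
  have hur : (0 : ℝ) < u := by exact_mod_cast (by omega : 0 < u)
  rw [hL] at hcard
  have hδ : (M.descFactorial j / (16 * (8 * u) * (M : ℝ) ^ j) : ℝ) * 2 ^ mainLen N n j ≤
      ((Finset.range (2 ^ mainLen N n j)).filter
        fun ρ => MainGood (evalSeq f) inp n j (2 ^ (8 * u)) ρ).card := by
    rw [div_mul_eq_mul_div, div_le_iff₀ (by positivity)]
    have : ((M.descFactorial j * 2 ^ mainLen N n j : ℕ) : ℝ) ≤ _ := Nat.cast_le.2 hcard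
    push_cast at this
    linarith
  have hset : {ω | ¬ MainFlag (evalSeq f) inp N n j ω c} = {ω | ∀ t < mainTrials N j,
      ¬ MainGood (evalSeq f) inp n j (2 ^ (8 * u))
        (coinNumber ω (c + t * mainLen N n j) (mainLen N n j))} := by
    ext ω
    simp only [MainFlag, Set.mem_ofPred_eq, not_exists, not_and]
    rfl
  rw [hset]
  refine (coinMeasure_trials_le_exp c _ hδ).trans (ENNReal.ofReal_le_ofReal
    (Real.exp_le_exp.2 (neg_le_neg ?_)))
  have hT : (M : ℝ) ^ j / M.descFactorial j * (64 * (8 * u)) ≤ (mainTrials N j : ℝ) := by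
    rw [mainTrials, ← hdesc, fieldBits, ← hM, ← hu]
    push_cast
    refine mul_le_mul_of_nonneg_right ?_ (by positivity)
    have := Nat.lt_div_mul_add (a := M ^ j) hDpos
    have h2 : M ^ j < (M ^ j / M.descFactorial j + 1) * M.descFactorial j := by
      rw [Nat.add_mul, one_mul]; exact this
    rw [div_le_iff₀ hDr]
    exact_mod_cast h2.le
  -- Success probability of one trial times a lower bound for the number of trials.
  calc (4 : ℝ) = M.descFactorial j / (16 * (8 * u) * (M : ℝ) ^ j) *
        ((M : ℝ) ^ j / M.descFactorial j * (64 * (8 * u))) := by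
        field_simp
        norm_num
    _ ≤ _ := mul_le_mul_of_nonneg_left hT (by positivity)

theorem coinMeasure_not_degreeFlag_le {j : ℕ} (hs : SizeBounds f N j) (hj : j < f.totalDegree)
    (c : ℕ) : coinMeasure {ω | ¬ DegreeFlag (evalSeq f) N n j ω c} ≤ 2⁻¹ ^ (j + 3) := by
  classical
  set u := N + j + 2 with hu
  have hcard := card_degreeGood (u := u) (by omega) hj hs.deg hs.degree
  have hL : (2 ^ (8 * u)) ^ (1 + n) = 2 ^ degreeLen N n j := by
    rw [degreeLen, fieldBits, ← pow_mul]
  rw [hL] at hcard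
  have hur : (0 : ℝ) < u := by exact_mod_cast (by omega : 0 < u)
  have hδ : (1 / (8 * (8 * u)) : ℝ) * 2 ^ degreeLen N n j ≤
      ((Finset.range (2 ^ degreeLen N n j)).filter
        fun ρ => DegreeGood (evalSeq f) j (2 ^ (8 * u)) ρ).card := by
    rw [div_mul_eq_mul_div, div_le_iff₀ (by positivity)]
    have : ((2 ^ degreeLen N n j : ℕ) : ℝ) ≤ _ := Nat.cast_le.2 hcard
    push_cast at this
    linarith
  have hset : {ω | ¬ DegreeFlag (evalSeq f) N n j ω c} = {ω | ∀ t < degreeTrials N j,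
      ¬ DegreeGood (evalSeq f) j (2 ^ (8 * u)) (coinNumber ω
        (c + mainTrials N j * mainLen N n j + t * degreeLen N n j) (degreeLen N n j))} := by
    ext ω
    simp only [DegreeFlag, Set.mem_ofPred_eq, not_exists, not_and]
    rfl
  rw [hset]
  refine (coinMeasure_trials_le_exp _ _ hδ).trans ?_
  have hexp : (1 / (8 * (8 * u)) : ℝ) * degreeTrials N j = (j + 3 : ℕ) := by
    rw [degreeTrials, fieldBits, ← hu]
    push_cast
    field_simp
  have h2 : (2⁻¹ : ℝ≥0∞) ^ (j + 3) = ENNReal.ofReal (2⁻¹ ^ (j + 3)) := by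
    rw [ENNReal.ofReal_pow (by norm_num), ENNReal.ofReal_inv_of_pos (by norm_num)]
    norm_num
  rw [hexp, h2]
  refine ENNReal.ofReal_le_ofReal ?_
  rw [← mul_neg_one, Real.exp_nat_mul]
  refine pow_le_pow_left₀ (Real.exp_pos _).le ?_ _
  rw [Real.exp_neg]
  exact inv_anti₀ (by norm_num) (by linarith [Real.add_one_le_exp (1 : ℝ)])

/-- The probability that the tests wrongly reject. -/
theorem coinMeasure_reject_le (hs : ∀ j ≤ f.totalDegree, SizeBounds f N j) {a : Fin n →₀ ℕ}
    (haf : a ∈ f.support) (hai : ∀ i : Fin n, a i < inp (66 + i)) (c : ℕ → ℕ) :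
    coinMeasure {ω | ∃ J, ¬ DegreeFlag (evalSeq f) N n J ω (c J) ∧
      ∀ j ≤ J, ¬ MainFlag (evalSeq f) inp N n j ω (c j)} ≤ 1 / 3 := by
  have hd := degree_le_totalDegree haf
  -- If the run stops at `J ≥ |a|`, the main test has failed at degree `|a|`; if `J < |a|`, a degree
  -- test has overlooked the monomial `a`.
  have hsub : {ω | ∃ J, ¬ DegreeFlag (evalSeq f) N n J ω (c J) ∧
      ∀ j ≤ J, ¬ MainFlag (evalSeq f) inp N n j ω (c j)} ⊆
      {ω | ¬ MainFlag (evalSeq f) inp N n a.degree ω (c a.degree)} ∪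
      ⋃ J ∈ Finset.range a.degree, {ω | ¬ DegreeFlag (evalSeq f) N n J ω (c J)} := by
    rintro ω ⟨J, h1, h2⟩
    rcases Nat.lt_or_ge J a.degree with h | h
    · right
      simp only [Set.mem_iUnion]
      exact ⟨J, Finset.mem_range.2 h, h1⟩
    · exact Or.inl (h2 _ h)
  refine (measure_mono hsub).trans ((measure_union_le _ _).trans ?_)
  have h1 := coinMeasure_not_mainFlag_le (inp := inp) (hs _ hd) rfl haf hai (c a.degree)
  -- The sum of `2^(-(J+3))` over all `J` is `1/4`, which leaves `1/12` of the allowed `1/3` for the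
  -- main test; `e⁻⁴` is smaller.
  have h2 : coinMeasure (⋃ J ∈ Finset.range a.degree,
      {ω | ¬ DegreeFlag (evalSeq f) N n J ω (c J)}) ≤ 4⁻¹ := by
    refine (measure_biUnion_finset_le _ _).trans ?_
    calc _ ≤ ∑ J ∈ Finset.range a.degree, (2⁻¹ : ℝ≥0∞) ^ (J + 3) :=
          Finset.sum_le_sum fun J hJ => by
            have := Finset.mem_range.1 hJ
            exact coinMeasure_not_degreeFlag_le (hs J (by omega)) (by omega) _
      _ ≤ ∑' J : ℕ, (2⁻¹ : ℝ≥0∞) ^ (J + 3) := ENNReal.sum_le_tsum _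
      _ = 4⁻¹ := by
          simp only [pow_add]
          rw [ENNReal.tsum_mul_right, ENNReal.tsum_geometric, ENNReal.one_sub_inv_two, inv_inv]
          rw [← ENNReal.toReal_eq_toReal_iff' (by finiteness) (by finiteness)]
          simp [ENNReal.toReal_mul]
          norm_num
  have h3 : ENNReal.ofReal (Real.exp (-4)) ≤ 12⁻¹ := by
    have h4 : (12⁻¹ : ℝ≥0∞) = ENNReal.ofReal 12⁻¹ := by
      rw [ENNReal.ofReal_inv_of_pos (by norm_num)]; norm_num
    rw [h4]
    refine ENNReal.ofReal_le_ofReal ?_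
    rw [Real.exp_neg]
    refine inv_anti₀ (by norm_num) ?_
    have h5 : Real.exp 4 = Real.exp 1 ^ 4 := by rw [← Real.exp_nat_mul]; norm_num
    have h6 : (2 : ℝ) ≤ Real.exp 1 := by linarith [Real.add_one_le_exp (1 : ℝ)]
    rw [h5]
    calc (12 : ℝ) ≤ 2 ^ 4 := by norm_num
      _ ≤ _ := pow_le_pow_left₀ (by norm_num) h6 4
  refine (add_le_add (h1.trans h3) h2).trans ?_
  rw [← ENNReal.toReal_le_toReal (by finiteness) (by finiteness),
    ENNReal.toReal_add (by finiteness) (by finiteness)]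
  simp
  norm_num

end

end RAM

/-! ### The input in memory, and the circuit as the program reads it. -/

/-! ### The encoding of the input -/

theorem Gate.length_encode {n s : ℕ} (g : Gate n s) : g.encode.length = 3 := by
  cases g <;> simp only [Gate.encode]
  split_ifs <;> rfl
  all_goals rfl

theorem Circuit.length_encode {n s : ℕ} (C : Circuit n s) : C.encode.length = 3 * s := by
  induction C with
  | nil => rfl
  | snoc C g ih => simp [Circuit.encode, ih, Gate.length_encode, mul_add]

theorem length_encodeInput {n s : ℕ} (C : Circuit n s) (e : Fin n → ℕ) :
    (encodeInput C e).length = 2 + n + 3 * s := by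
  simp [encodeInput, Circuit.length_encode]; ring

theorem sum_map_eq_sum_range (h : ℕ → ℕ) (w : List ℕ) :
    (w.map h).sum = ∑ i ∈ Finset.range w.length, h (w.getD i 0) := by
  induction w with
  | nil => simp
  | cons x w ih => simp [Finset.sum_range_succ', ih, add_comm]

namespace RAM

theorem loadMem_apply (b a : ℕ) (w : List ℕ) :
    loadMem b w a = if b ≤ a then w.getD (a - b) 0 else 0 := by
  induction w generalizing b with
  | nil => simp [loadMem]
  | cons x w ih =>
    rw [loadMem, Finsupp.update_apply]
    rcases lt_trichotomy a b with h | rfl | h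
    · rw [if_neg h.ne, ih, if_neg (by omega), if_neg (by omega)]
    · simp
    · rw [if_neg h.ne', ih, if_pos (by omega), if_pos h.le]
      obtain ⟨d, rfl⟩ := Nat.exists_eq_add_of_lt h
      rw [show b + d + 1 - (b + 1) = d by omega, show b + d + 1 - b = d + 1 by omega]
      simp

theorem memBits_le_sum_range (μ : Mem) {b l : ℕ} (h : ∀ a, b + l ≤ a → μ a = 0) :
    memBits μ ≤ ∑ a ∈ Finset.range (b + l), (Nat.size a + Nat.size (μ a)) := by
  rw [memBits, Finsupp.sum]
  refine Finset.sum_le_sum_of_subset fun a ha => ?_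
  by_contra hcon
  rw [Finset.mem_range, not_lt] at hcon
  exact Finsupp.mem_support_iff.1 ha (h a hcon)

/-- The cells from address `64` on when the input `w` is loaded there. -/
noncomputable def inputCell (w : List ℕ) (a : ℕ) : ℕ := loadMem 64 w a

theorem inputCell_add (w : List ℕ) (i : ℕ) : inputCell w (64 + i) = w.getD i 0 := by
  rw [inputCell, loadMem_apply, if_pos (by omega), Nat.add_sub_cancel_left]

theorem bitLength_eq (w : List ℕ) :
    bitLength w = ∑ i ∈ Finset.range w.length, (Nat.size (inputCell w (64 + i)) + 1) := by
  simp only [inputCell_add]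
  exact sum_map_eq_sum_range (fun x => Nat.size x + 1) w

theorem length_le_bitLength (w : List ℕ) : w.length ≤ bitLength w := by
  rw [bitLength_eq]
  refine le_trans ?_ (Finset.sum_le_sum fun i _ => Nat.le_add_left 1 _)
  simp

theorem inputCell_lt (w : List ℕ) (a : ℕ) : inputCell w a < 2 ^ bitLength w := by
  rw [inputCell, loadMem_apply]
  split_ifs with h
  · rcases Nat.lt_or_ge (a - 64) w.length with h' | h'
    · rw [← Nat.size_le, bitLength, sum_map_eq_sum_range]
      have := Finset.single_le_sum (f := fun i => Nat.size (w.getD i 0) + 1)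
        (fun i _ => Nat.zero_le _) (Finset.mem_range.2 h')
      exact (Nat.le_succ _).trans this
    · rw [List.getD_eq_default _ _ h']
      positivity
  · positivity

theorem memBits_le {W : ℕ} {w : List ℕ} {μ : Mem} (h : ∀ a, 64 ≤ a → μ a = inputCell w a)
    (hW : ∀ a, μ a < 2 ^ W) :
    memBits μ ≤ 64 * (64 + W) + bitLength w * (64 + bitLength w) + bitLength w := by
  refine (memBits_le_sum_range μ (b := 64) (l := w.length) fun a ha => ?_).trans ?_
  · rw [h a (by omega), inputCell, loadMem_apply, if_pos (by omega),
      List.getD_eq_default _ _ (by omega)]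
  · rw [Finset.sum_range_add, add_assoc]
    refine add_le_add ?_ ?_
    · refine (Finset.sum_le_card_nsmul _ _ (64 + W) fun a ha => ?_).trans (by simp)
      have := Finset.mem_range.1 ha
      exact add_le_add ((size_le_self a).trans this.le) (Nat.size_le.2 (hW a))
    · rw [Finset.sum_add_distrib]
      have hl := length_le_bitLength w
      refine add_le_add ?_ ?_
      · refine (Finset.sum_le_card_nsmul _ _ (64 + bitLength w) fun a ha => ?_).trans ?_
        · have := Finset.mem_range.1 ha
          exact (size_le_self _).trans (by omega)
        · rw [Finset.card_range, smul_eq_mul]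
          exact Nat.mul_le_mul_right _ hl
      · conv_rhs => rw [bitLength_eq]
        refine Finset.sum_le_sum fun i _ => ?_
        rw [h _ (by omega)]
        exact Nat.le_succ _

section

variable {n s : ℕ} (C : Circuit n s) (e : Fin n → ℕ)

theorem inputCell_variables : inputCell (encodeInput C e) 64 = n := by
  rw [show 64 = 64 + 0 by rfl, inputCell_add]; rfl

theorem inputCell_gates : inputCell (encodeInput C e) 65 = s := by
  rw [show 65 = 64 + 1 by rfl, inputCell_add]; rfl

theorem inputCell_exponent (i : Fin n) : inputCell (encodeInput C e) (66 + i) = e i := by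
  rw [show 66 + (i : ℕ) = 64 + (i + 2) by ring, inputCell_add]
  simp only [encodeInput, List.getD_cons_succ]
  rw [List.getD_append _ _ _ _ (by simp)]
  simp

theorem inputCell_gate (i : ℕ) :
    inputCell (encodeInput C e) (66 + n + i) = C.encode.getD i 0 := by
  rw [show 66 + n + i = 64 + (n + i + 2) by ring, inputCell_add]
  simp only [encodeInput, List.getD_cons_succ]
  rw [List.getD_append_right _ _ _ _ (by simp)]
  simp

end

/-- The values of the gates at a point, as a sequence. -/
noncomputable def gateValue {n s : ℕ} (C : Circuit n s) (Q : ℕ) (pt : ℕ → ℤ) (g : ℕ) : ZMod Q :=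
  if h : g < s then ((evalSeq (C.eval ⟨g, h⟩) pt : ℤ) : ZMod Q) else 0

theorem gateValue_snoc_of_lt {n s : ℕ} (C : Circuit n s) (g : Gate n s) (Q : ℕ) (pt : ℕ → ℤ)
    {i : ℕ} (hi : i < s) : gateValue (C.snoc g) Q pt i = gateValue C Q pt i := by
  rw [gateValue, gateValue, dif_pos hi, dif_pos (by omega)]
  congr 2
  exact Fin.snoc_castSucc (α := fun _ => MvPolynomial (Fin n) ℤ) _ C.eval ⟨i, hi⟩

theorem gateValue_snoc_self {n s : ℕ} (C : Circuit n s) (g : Gate n s) (Q : ℕ) (pt : ℕ → ℤ) :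
    gateValue (C.snoc g) Q pt s = ((evalSeq (g.eval C.eval) pt : ℤ) : ZMod Q) := by
  rw [gateValue, dif_pos (by omega)]
  congr 2
  exact Fin.snoc_last (α := fun _ => MvPolynomial (Fin n) ℤ) _ C.eval

theorem GateOK.congr {Q n g tag a b : ℕ} {pt val val' : ℕ → ZMod Q} (h : ∀ i ≤ g, val' i = val i)
    (hg : GateOK n pt val g tag a b) : GateOK n pt val' g tag a b := by
  unfold GateOK at *
  rw [h g le_rfl]
  rcases hg with hg | hg | hg | ⟨h1, h2, h3, h4⟩ | ⟨h1, h2, h3, h4⟩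
  · exact Or.inl hg
  · exact Or.inr (Or.inl hg)
  · exact Or.inr (Or.inr (Or.inl hg))
  · exact Or.inr (Or.inr (Or.inr (Or.inl ⟨h1, h2, h3, by rw [h a h2.le, h b h3.le, h4]⟩)))
  · exact Or.inr (Or.inr (Or.inr (Or.inr ⟨h1, h2, h3, by rw [h a h2.le, h b h3.le, h4]⟩)))

theorem gateOK_encode {n s : ℕ} (C : Circuit n s) (Q : ℕ) (pt : ℕ → ℤ) {g : ℕ} (hg : g < s) :
    GateOK n (fun i => ((pt i : ℤ) : ZMod Q)) (gateValue C Q pt) g (C.encode.getD (3 * g) 0)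
      (C.encode.getD (3 * g + 1) 0) (C.encode.getD (3 * g + 2) 0) := by
  induction C with
  | nil => omega
  | @snoc s C gt ih =>
    have hlen := C.length_encode
    simp only [Circuit.encode]
    rcases Nat.lt_succ_iff_lt_or_eq.1 hg with h | rfl
    · rw [List.getD_append _ _ _ _ (by omega), List.getD_append _ _ _ _ (by omega),
        List.getD_append _ _ _ _ (by omega)]
      exact (ih h).congr fun i hi => gateValue_snoc_of_lt C gt Q pt (by omega)
    · have hval : ∀ i : Fin g, gateValue (C.snoc gt) Q pt i =
          ((evalSeq (C.eval i) pt : ℤ) : ZMod Q) := by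
        intro i
        rw [gateValue_snoc_of_lt C gt Q pt i.2, gateValue, dif_pos i.2]
      rw [List.getD_append_right _ _ _ _ (by omega), List.getD_append_right _ _ _ _ (by omega),
        List.getD_append_right _ _ _ _ (by omega), hlen, Nat.sub_self, Nat.add_sub_cancel_left,
        Nat.add_sub_cancel_left]
      unfold GateOK
      rw [gateValue_snoc_self]
      cases gt with
      | const c =>
        simp only [Gate.encode, Gate.eval, evalSeq, MvPolynomial.eval_C]
        split_ifs with hc
        · left
          refine ⟨rfl, ?_⟩
          obtain ⟨k, rfl⟩ := Int.eq_ofNat_of_zero_le hc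
          simp
        · right; left
          refine ⟨rfl, ?_⟩
          obtain ⟨k, hk⟩ := Int.eq_ofNat_of_zero_le (show 0 ≤ -c by omega)
          obtain rfl : c = -(k : ℤ) := by omega
          simp
      | var i =>
        right; right; left
        exact ⟨rfl, i.2, by simp [Gate.encode, Gate.eval, evalSeq]⟩
      | add i j =>
        right; right; right; left
        refine ⟨rfl, i.2, j.2, ?_⟩
        simp only [Gate.encode, List.getD_cons_succ, List.getD_cons_zero, hval]
        simp [Gate.eval, evalSeq]
      | mul i j =>
        right; right; right; right
        refine ⟨rfl, i.2, j.2, ?_⟩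
        simp only [Gate.encode, List.getD_cons_succ, List.getD_cons_zero, hval]
        simp [Gate.eval, evalSeq]

theorem computes_encodeInput {n s : ℕ} (C : Circuit n (s + 1)) (e : Fin n → ℕ) :
    Computes n (s + 1) (inputCell (encodeInput C e)) (evalSeq C.poly) := by
  intro Q pt
  refine ⟨gateValue C Q pt, fun g hg => ?_, ?_⟩
  · have h := gateOK_encode C Q pt hg
    rw [← inputCell_gate C e, ← inputCell_gate C e, ← inputCell_gate C e] at h
    rwa [show 67 + n + 3 * g = 66 + n + (3 * g + 1) by ring,
      show 68 + n + 3 * g = 66 + n + (3 * g + 2) by ring]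
  · rw [gateValue, dif_pos (by omega)]
    rfl

/-- A gate at most doubles the degree and the logarithm of the norm, repeated squaring being the
worst case. With `H + 1` in place of `H` the exponent is positive, so that doubling it also covers
sums. -/
theorem circuit_eval_bounds {n s : ℕ} (C : Circuit n s) {H : ℕ} (h : ∀ x ∈ C.encode, x < 2 ^ H)
    (g : Fin s) : (C.eval g).totalDegree ≤ 2 ^ (g : ℕ) ∧
      coeffNorm (C.eval g) ≤ 2 ^ ((H + 1) * 2 ^ (g : ℕ)) := by
  induction C with
  | nil => exact g.elim0
  | @snoc s C gt ih =>
    have ih := ih fun x hx => h x (List.mem_append_left _ hx)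
    refine Fin.lastCases ?_ (fun i => ?_) g
    · have he : (C.snoc gt).eval (Fin.last s) = gt.eval C.eval :=
        Fin.snoc_last (α := fun _ => MvPolynomial (Fin n) ℤ) _ C.eval
      rw [he, Fin.val_last]
      have h2 : ∀ i : Fin s, 2 * 2 ^ (i : ℕ) ≤ 2 ^ s := by
        intro i
        rw [← pow_succ']
        exact Nat.pow_le_pow_right (by norm_num) i.2
      have h3 : ∀ i : Fin s, 2 * ((H + 1) * 2 ^ (i : ℕ)) ≤ (H + 1) * 2 ^ s := by
        intro i
        have := Nat.mul_le_mul_left (H + 1) (h2 i)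
        linarith
      cases gt with
      | const c =>
        refine ⟨by rw [Gate.eval, MvPolynomial.totalDegree_C]; exact Nat.zero_le _,
          (coeffNorm_monomial_le 0 c).trans ?_⟩
        have hc : c.natAbs < 2 ^ H := by
          apply h
          simp only [Circuit.encode, Gate.encode]
          split_ifs <;> simp
        refine hc.le.trans (Nat.pow_le_pow_right (by norm_num) ?_)
        have : 1 ≤ 2 ^ s := Nat.one_le_two_pow
        nlinarith
      | var i =>
        refine ⟨?_, (coeffNorm_monomial_le _ 1).trans ?_⟩
        · simp only [Gate.eval, MvPolynomial.totalDegree_X]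
          exact Nat.one_le_two_pow
        · exact Nat.one_le_two_pow
      | add i j =>
        refine ⟨(MvPolynomial.totalDegree_add _ _).trans (max_le ?_ ?_), ?_⟩
        · have := (ih i).1; have := h2 i; omega
        · have := (ih j).1; have := h2 j; omega
        · refine (coeffNorm_add_le _ _).trans ?_
          have h5 : ∀ i : Fin s, 2 * coeffNorm (C.eval i) ≤ 2 ^ ((H + 1) * 2 ^ s) := by
            intro i
            refine (Nat.mul_le_mul_left 2 (ih i).2).trans ?_
            rw [← pow_succ']
            refine Nat.pow_le_pow_right (by norm_num) ?_
            have := h3 i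
            have : 1 ≤ (H + 1) * 2 ^ (i : ℕ) := Nat.mul_pos (by omega) (by positivity)
            omega
          have := h5 i; have := h5 j
          omega
      | mul i j =>
        refine ⟨(MvPolynomial.totalDegree_mul _ _).trans ?_, (coeffNorm_mul_le _ _).trans ?_⟩
        · have := (ih i).1; have := h2 i
          have := (ih j).1; have := h2 j; omega
        · refine (Nat.mul_le_mul (ih i).2 (ih j).2).trans ?_
          rw [← pow_add]
          refine Nat.pow_le_pow_right (by norm_num) ?_
          have := h3 i; have := h3 j; omega
    · have he : (C.snoc gt).eval i.castSucc = C.eval i :=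
        Fin.snoc_castSucc (α := fun _ => MvPolynomial (Fin n) ℤ) _ C.eval i
      rw [he]
      exact ih i

/-! ### Word length and running time. -/

/-! ### Bounds on the sizes of numbers -/

theorem two_mul_le_two_pow {U : ℕ} (hU : 1 ≤ U) : 2 * U ≤ 2 ^ U := by
  induction U, hU using Nat.le_induction with
  | base => norm_num
  | succ U hU ih => rw [pow_succ]; omega

theorem levelFactor_le {j u : ℕ} (h : j ≤ 2 ^ u) : levelFactor j ≤ 2 ^ ((u + 2) * j) := by
  calc levelFactor j ≤ (2 ^ u) ^ (j / 2) * 4 ^ (j / 2) := by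
        refine Nat.mul_le_mul_right _ ((Nat.factorial_le_pow _).trans ?_)
        exact Nat.pow_le_pow_left ((Nat.div_le_self _ _).trans h) _
    _ = 2 ^ ((u + 2) * (j / 2)) := by
        rw [← mul_pow, show 2 ^ u * 4 = 2 ^ (u + 2) by rw [pow_add]; rfl, ← pow_mul]
    _ ≤ _ := Nat.pow_le_pow_right (by norm_num) (Nat.mul_le_mul_left _ (Nat.div_le_self _ _))

/-- With `u = N + j + 2`, the tested integers have at most `16 * 4^u` bits, and `16 * 4^u ≤ 2^(4u)`
because `4 ≤ 2^u`. -/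
theorem sizeBounds {n : ℕ} {f : MvPolynomial (Fin n) ℤ} {N s j : ℕ} (hs : s ≤ N)
    (hd : f.totalDegree ≤ 2 ^ s) (hf : coeffNorm f ≤ 2 ^ ((N + 1) * 2 ^ s)) : SizeBounds f N j := by
  obtain ⟨u, hu⟩ : ∃ u, u = N + j + 2 := ⟨_, rfl⟩
  have huu : 2 * u ≤ 2 ^ u := two_mul_le_two_pow (by omega)
  have hsu : 2 ^ s * 4 ≤ 2 ^ u := by
    rw [show 2 ^ s * 4 = 2 ^ (s + 2) by rw [pow_add]; rfl]
    exact Nat.pow_le_pow_right (by norm_num) (by omega)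
  have hfu : coeffNorm f ≤ 2 ^ (2 ^ u * 2 ^ u) :=
    hf.trans (Nat.pow_le_pow_right (by norm_num) (Nat.mul_le_mul (by omega) (by omega)))
  have h4 : 2 ^ (4 * u) = 2 ^ u * 2 ^ u * (2 ^ u * 2 ^ u) := by ring
  have h8 : 2 ^ (8 * u) = 2 ^ (4 * u) * 2 ^ (4 * u) := by ring
  have h16 : 4 ≤ 2 ^ u := by omega
  have hx : 16 ≤ 2 ^ u * 2 ^ u := Nat.mul_le_mul h16 h16
  have h44 : 16 * (2 ^ u * 2 ^ u) ≤ 2 ^ (4 * u) := by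
    rw [h4]; exact Nat.mul_le_mul_right _ hx
  have h48 : 2 ^ (4 * u) ≤ 2 ^ (8 * u) := Nat.pow_le_pow_right (by norm_num) (by omega)
  have hju : j ≤ 2 ^ u := by omega
  have hu1 : u ≤ 2 ^ u := by omega
  refine ⟨?_, ?_, ?_, ?_⟩ <;> rw [← hu]
  · refine le_trans ?_ (h44.trans h48)
    calc 2 * j * (j + j / 2) ≤ 2 * 2 ^ u * (2 * 2 ^ u) :=
          Nat.mul_le_mul (by omega) (by omega)
      _ = 4 * (2 ^ u * 2 ^ u) := by ring
      _ ≤ _ := Nat.mul_le_mul_right _ (by norm_num)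
  · refine le_trans ?_ (h44.trans h48)
    calc 2 * f.totalDegree ≤ 2 ^ u * 1 := by omega
      _ ≤ 2 ^ u * 2 ^ u := Nat.mul_le_mul_left _ (by omega)
      _ ≤ _ := Nat.le_mul_of_pos_left _ (by norm_num)
  · calc 2 * (coeffNorm f * ((j * 2 ^ (8 * u)) ^ j * levelFactor j))
        ≤ 2 ^ 1 * (2 ^ (2 ^ u * 2 ^ u) * ((2 ^ u * 2 ^ (8 * u)) ^ j * 2 ^ ((u + 2) * j))) := by
          refine Nat.mul_le_mul (by norm_num) (Nat.mul_le_mul hfu (Nat.mul_le_mul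
            (Nat.pow_le_pow_left (Nat.mul_le_mul_right _ hju) _) (levelFactor_le hju)))
      _ = 2 ^ (1 + (2 ^ u * 2 ^ u + ((u + 8 * u) * j + (u + 2) * j))) := by
          rw [← pow_add 2 u (8 * u), ← pow_mul, ← pow_add, ← pow_add, ← pow_add, ← pow_add]
      _ < 2 ^ 2 ^ (4 * u) := by
          refine Nat.pow_lt_pow_right (by norm_num) (lt_of_lt_of_le ?_ h44)
          have h5 : u * j ≤ 2 ^ u * 2 ^ u := Nat.mul_le_mul hu1 hju
          have h6 : j ≤ 2 ^ u * 2 ^ u := hju.trans (Nat.le_mul_of_pos_left _ (by positivity))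
          have h7 : (u + 8 * u) * j + (u + 2) * j = 10 * (u * j) + 2 * j := by ring
          omega
  · calc coeffNorm f * (2 ^ (j + 1) * ((j + 1) * 2 ^ (8 * u)) ^ f.totalDegree)
        ≤ 2 ^ (2 ^ u * 2 ^ u) * (2 ^ (j + 1) * (2 ^ u * 2 ^ (8 * u)) ^ 2 ^ s) := by
          refine Nat.mul_le_mul hfu (Nat.mul_le_mul_left _ ?_)
          exact (Nat.pow_le_pow_left (Nat.mul_le_mul_right _ (by omega)) _).trans
            (Nat.pow_le_pow_right (by positivity) hd)
      _ = 2 ^ (2 ^ u * 2 ^ u + ((j + 1) + (u + 8 * u) * 2 ^ s)) := by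
          rw [← pow_add 2 u (8 * u), ← pow_mul, ← pow_add, ← pow_add, ← pow_add]
      _ < 2 ^ 2 ^ (4 * u) := by
          refine Nat.pow_lt_pow_right (by norm_num) (lt_of_lt_of_le ?_ h44)
          have h5 : u * 2 ^ s ≤ 2 ^ u * 2 ^ u := Nat.mul_le_mul hu1 (by omega)
          have h6 : j + 1 ≤ 2 ^ u * 2 ^ u :=
            (show j + 1 ≤ 2 ^ u by omega).trans (Nat.le_mul_of_pos_left _ (by positivity))
          have h7 : (u + 8 * u) * 2 ^ s = 9 * (u * 2 ^ s) := by ring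
          omega

/-- The longest words are the packed gate values, below `B^((j+1) G)`, and the draws of `fieldBits *
(1 + 2nj)` bits. Both are cubic in `N + k + 2`. -/
theorem stageBounds {N n G k j : ℕ} {inp : ℕ → ℕ} (hj : j ≤ k) (hlen : 2 + n + 3 * G ≤ N)
    (hG : 0 < G) (hin : ∀ a, inp a < 2 ^ N) :
    StageBounds (100 * (N + k + 2) ^ 3) n G N j inp := by
  obtain ⟨U, hU⟩ : ∃ U, U = N + k + 2 := ⟨_, rfl⟩
  rw [← hU]
  obtain ⟨W, hW⟩ : ∃ W, W = 100 * U ^ 3 := ⟨_, rfl⟩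
  rw [← hW]
  have hU1 : U ≤ U * U := Nat.le_mul_self U
  have hU2 : U * U ≤ U * U * U := Nat.le_mul_of_pos_right _ (by omega)
  have hW' : W = 100 * (U * U * U) := by rw [hW]; ring
  have hWW : W < 2 ^ W := Nat.lt_two_pow_self
  have hlt : ∀ {x y : ℕ}, y < W → x ≤ 2 ^ y → x < 2 ^ W := fun h h' =>
    h'.trans_lt (Nat.pow_lt_pow_right (by norm_num) h)
  have hfb : fieldBits N j ≤ 8 * U := by rw [fieldBits]; omega
  have hnj : n * j ≤ U * U := Nat.mul_le_mul (by omega) (by omega)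
  have hUU : 2 * U ≤ 2 ^ U := two_mul_le_two_pow (by omega)
  have hfnj : fieldBits N j * (n * j) ≤ 8 * (U * U * U) := by
    calc _ ≤ 8 * U * (U * U) := Nat.mul_le_mul hfb hnj
      _ = _ := by ring
  have hfn : fieldBits N j * (1 + n) ≤ 8 * (U * U) := by
    calc _ ≤ 8 * U * U := Nat.mul_le_mul hfb (by omega)
      _ = _ := by ring
  have hMj : (j + j / 2) ^ j ≤ 2 ^ (U * U) := by
    calc (j + j / 2) ^ j ≤ (2 ^ U) ^ j := Nat.pow_le_pow_left (by omega) _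
      _ = 2 ^ (U * j) := by rw [pow_mul]
      _ ≤ _ := Nat.pow_le_pow_right (by norm_num) (Nat.mul_le_mul_left _ (by omega))
  refine ⟨⟨hG, by positivity, ?_, by omega, by omega, by omega, by omega, ?_, ?_, by omega, ?_,
    ?_⟩, ?_, ?_, ?_, ?_, by omega, ?_, by omega⟩
  · rw [← pow_mul, ← pow_mul]
    refine Nat.pow_lt_pow_right (by norm_num) ?_
    calc fieldBits N j * ((j + 1) * G) ≤ 8 * U * (U * U) :=
          Nat.mul_le_mul hfb (Nat.mul_le_mul (by omega) (by omega))
      _ = 8 * (U * U * U) := by ring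
      _ < W := by omega
  · rw [← pow_mul]
    refine Nat.pow_lt_pow_right (by norm_num) ?_
    have := Nat.mul_le_mul_left (fieldBits N j) (show n ≤ 1 + n by omega)
    omega
  · rw [← pow_mul]
    exact Nat.pow_lt_pow_right (by norm_num) (by omega)
  · refine hlt (y := U * U) (by omega) ?_
    calc (2 * (j / 2)) ^ (j / 2) ≤ (2 ^ U) ^ (j / 2) := Nat.pow_le_pow_left (by omega) _
      _ = 2 ^ (U * (j / 2)) := by rw [pow_mul]
      _ ≤ _ := Nat.pow_le_pow_right (by norm_num) (Nat.mul_le_mul_left _ (by omega))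
  · exact fun a _ => hlt (by omega) (hin a).le
  · rw [mainLen, mul_add, mul_left_comm]
    omega
  · rw [degreeLen]
    omega
  · refine hlt (y := U * U + 1 + (10 + U)) (by omega) ?_
    rw [mainTrials, pow_add, pow_add 2 (U * U)]
    refine Nat.mul_le_mul ?_ ?_
    · have := Nat.div_le_self ((j + j / 2) ^ j) (∏ t ∈ Finset.range j, (j / 2 + t + 1))
      have : 1 ≤ 2 ^ (U * U) := Nat.one_le_two_pow
      omega
    · rw [pow_add]
      omega
  · refine lt_of_le_of_lt ?_ hWW
    rw [degreeTrials]
    calc 8 * fieldBits N j * (j + 3) ≤ 64 * U * (2 * U) := Nat.mul_le_mul (by omega) (by omega)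
      _ ≤ 64 * U * (U * U) := Nat.mul_le_mul_left _ (Nat.mul_le_mul_right _ (by omega))
      _ = 64 * (U * U * U) := by ring
      _ ≤ W := by omega
  · exact hlt (by omega) hMj

/-! ### Bounds on the number of steps -/

open Polynomial in
theorem card_filter_bitSum_eq (m i : ℕ) :
    ((Finset.range (2 ^ m)).filter fun x => bitSum m x = i).card = m.choose i := by
  have h := sum_range_two_pow_prod m fun _ b => (X : ℕ[X]) ^ b
  simp only [Finset.prod_pow_eq_pow_sum, pow_zero, pow_one, Finset.prod_const,
    Finset.card_range] at h
  have h' := congr_arg (fun p => coeff p i) h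
  simp only [finsetSum_coeff, coeff_X_pow, coeff_one_add_X_pow] at h'
  rw [Finset.card_filter]
  refine (Finset.sum_congr rfl fun x _ => ?_).trans h'
  exact if_congr eq_comm rfl rfl

theorem choose_le_choose_of_le_half {m i q : ℕ} (hi : i ≤ q) (hq : 2 * q ≤ m) :
    m.choose i ≤ m.choose q := by
  induction q, hi using Nat.le_induction with
  | base => exact le_rfl
  | succ q _ ih => exact (ih (by omega)).trans (Nat.choose_le_succ_of_lt_half_left (by omega))

/-- The number of points of the cube that the enumeration visits. -/
theorem card_filter_bitSum_le (j : ℕ) :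
    ((Finset.range (2 ^ (3 * (j / 2) + 1))).filter
      (fun x => bitSum (3 * (j / 2) + 1) x ≤ j / 2 + 1)).card ≤
      4 * (j + 2) * (j + j / 2).choose j := by
  obtain ⟨q, hq⟩ : ∃ q, q = j / 2 := ⟨_, rfl⟩
  rw [← hq]
  -- The ratio of the two binomials is `(3q+1)/(2q+1) ≤ 2`; in the next claim it is `(2q+1)/(q+1) ≤
  -- 2`.
  have h1 : (3 * q + 1).choose q ≤ 2 * (3 * q).choose q := by
    have h := Nat.add_one_mul_choose_eq (3 * q) (2 * q)
    rw [← Nat.choose_symm_of_eq_add (show 3 * q = 2 * q + q by ring),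
      ← Nat.choose_symm_of_eq_add (show 3 * q + 1 = 2 * q + 1 + q by ring)]
    nlinarith
  have h2 : (3 * q + 1).choose (q + 1) ≤ 2 * (3 * q + 1).choose q := by
    have h := Nat.choose_succ_right_eq (3 * q + 1) q
    rw [show 3 * q + 1 - q = 2 * q + 1 by omega] at h
    nlinarith
  have h3 : (3 * q).choose q ≤ (j + q).choose j := by
    rw [Nat.choose_symm_add]
    exact Nat.choose_le_choose _ (by omega)
  rw [Finset.card_eq_sum_card_fiberwise (f := bitSum (3 * q + 1)) (t := Finset.range (q + 2))]
  · refine (Finset.sum_le_card_nsmul _ _ (4 * (j + q).choose j) fun i hi => ?_).trans ?_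
    · have hi := Finset.mem_range.1 hi
      rw [Finset.filter_filter]
      refine (Finset.card_le_card (Finset.monotone_filter_right _ fun x _ hx => hx.2)).trans ?_
      rw [card_filter_bitSum_eq]
      rcases Nat.lt_or_ge i (q + 1) with h | h
      · have := choose_le_choose_of_le_half (m := 3 * q + 1) (show i ≤ q by omega) (by omega)
        omega
      · obtain rfl : i = q + 1 := by omega
        omega
    · rw [Finset.card_range, smul_eq_mul]
      have : q + 2 ≤ j + 2 := by omega
      calc (q + 2) * (4 * (j + q).choose j) ≤ (j + 2) * (4 * (j + q).choose j) :=
            Nat.mul_le_mul_right _ this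
        _ = _ := by ring
  · intro x hx
    have := (Finset.mem_filter.1 hx).2
    rw [Finset.mem_coe, Finset.mem_range]
    omega

/-- The base of the exponential bound for the running time. -/
noncomputable def rate : ℝ := 3 / 2 * Real.exp 1

theorem one_le_rate : 1 ≤ rate := by
  have := Real.add_one_le_exp (1 : ℝ)
  rw [rate]; linarith

theorem rate_lt : rate < 4.08 := by
  have := Real.exp_one_lt_d9
  rw [rate]; norm_num at this ⊢; linarith

/-- The source of the base: `M^j / M.descFactorial j * M.choose j = M^j / j!`. Now `M ≤ 3j/2` and
`j^j / j! ≤ e^j` give `(3e/2)^j`. -/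
theorem mainTrials_mul_choose_le (N j : ℕ) :
    (mainTrials N j : ℝ) * (j + j / 2).choose j ≤ 128 * fieldBits N j * rate ^ j := by
  set M := j + j / 2 with hM
  have hdesc : M.descFactorial j = ∏ t ∈ Finset.range j, (j / 2 + t + 1) := by
    rw [hM, add_comm j, Nat.add_descFactorial_eq_ascFactorial, Nat.ascFactorial_eq_prod_range]
    exact Finset.prod_congr rfl fun t _ => by ring
  have hD : M.descFactorial j = j.factorial * M.choose j :=
    Nat.descFactorial_eq_factorial_mul_choose _ _
  have hDpos : 0 < M.descFactorial j := Nat.descFactorial_pos.2 (by omega)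
  have hDM : M.descFactorial j ≤ M ^ j := Nat.descFactorial_le_pow _ _
  have h1 : (M ^ j / M.descFactorial j + 1) * M.descFactorial j ≤ 2 * M ^ j := by
    have := Nat.div_mul_le_self (M ^ j) (M.descFactorial j)
    rw [Nat.add_mul]
    omega
  have h2 : (M : ℝ) ^ j / j.factorial ≤ rate ^ j := by
    have h3 := Real.pow_div_factorial_le_exp (j : ℝ) (Nat.cast_nonneg j) j
    have h4 : (M : ℝ) ≤ 3 / 2 * j := by
      have : 2 * M ≤ 3 * j := by omega
      have : (2 * M : ℝ) ≤ 3 * j := by exact_mod_cast this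
      linarith
    calc (M : ℝ) ^ j / j.factorial ≤ (3 / 2 * j) ^ j / j.factorial := by gcongr
      _ = (3 / 2) ^ j * ((j : ℝ) ^ j / j.factorial) := by rw [mul_pow]; ring
      _ ≤ (3 / 2) ^ j * Real.exp j := by gcongr
      _ = rate ^ j := by rw [rate, mul_pow, ← Real.exp_nat_mul, mul_one]
  have hjf : (0 : ℝ) < j.factorial := by exact_mod_cast j.factorial_pos
  have h5 : ((M ^ j / M.descFactorial j + 1 : ℕ) : ℝ) * M.choose j ≤ 2 * rate ^ j := by
    have h6 : ((M ^ j / M.descFactorial j + 1 : ℕ) : ℝ) * (j.factorial * M.choose j) ≤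
        2 * (M : ℝ) ^ j := by
      rw [hD] at h1 ⊢
      exact_mod_cast h1
    calc _ = ((M ^ j / M.descFactorial j + 1 : ℕ) : ℝ) * (j.factorial * M.choose j) /
          j.factorial := by field_simp
      _ ≤ 2 * (M : ℝ) ^ j / j.factorial := by gcongr
      _ = 2 * ((M : ℝ) ^ j / j.factorial) := by ring
      _ ≤ _ := by gcongr
  rw [mainTrials, ← hdesc, ← hM]
  push_cast at h5 ⊢
  calc _ = (((M ^ j / M.descFactorial j : ℕ) : ℝ) + 1) * M.choose j * (64 * fieldBits N j) := by
        ring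
    _ ≤ 2 * rate ^ j * (64 * fieldBits N j) := by gcongr
    _ = _ := by ring

theorem stageCost_le {N n G j U : ℕ} (hj : j + 2 ≤ U) (hn : n + 2 ≤ U) (hG : G ≤ U)
    (hN : N + j + 2 ≤ U) : (stageCost N n G j : ℝ) ≤ 10 ^ 7 * (U : ℝ) ^ 6 * rate ^ j := by
  have hU2 : 2 ≤ U := by omega
  have p0 : 1 ≤ U ^ 4 := Nat.one_le_pow _ _ (by omega)
  have p1 : U ≤ U ^ 4 := Nat.le_self_pow (by norm_num) U
  have p2 : U ^ 2 ≤ U ^ 4 := Nat.pow_le_pow_right (by omega) (by norm_num)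
  have p3 : U ^ 3 ≤ U ^ 4 := Nat.pow_le_pow_right (by omega) (by norm_num)
  have hfb : fieldBits N j ≤ 8 * U := by rw [fieldBits]; omega
  have he : evalCost n G j ≤ 60 * U ^ 4 := by
    calc evalCost n G j ≤ U * (U * (3 * (U * U) + 3 * (U + U) + 12) + 6 * U + 26) + 6 := by
          rw [evalCost]; gcongr <;> omega
      _ ≤ _ := by nlinarith
  have hnj : n * j ≤ U ^ 4 := (Nat.mul_le_mul (show n ≤ U by omega) (show j ≤ U by omega)).trans
    (by rwa [← pow_two])
  have hlen : mainLen N n j ≤ 24 * U ^ 4 := by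
    calc mainLen N n j ≤ 8 * U * (1 + 2 * (U * U)) := by rw [mainLen]; gcongr <;> omega
      _ ≤ _ := by nlinarith
  have hdlen : degreeLen N n j ≤ 8 * U ^ 4 := by
    calc degreeLen N n j ≤ 8 * U * U := by rw [degreeLen]; gcongr; omega
      _ ≤ _ := by nlinarith
  set V := 4 * (j + 2) * (j + j / 2).choose j with hV
  have hVpos : 1 ≤ V := Nat.mul_pos (by omega) (Nat.choose_pos (by omega))
  have hcard := card_filter_bitSum_le j
  rw [← hV] at hcard
  have hm : mainTrialCost n G j + 4 * mainLen N n j + 5 ≤ V * (400 * U ^ 4) := by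
    have h1 : mainTrialCost n G j ≤ V * (stepCost n G j + 1) + (3 * (n * j) + 3 * j + 16) := by
      rw [mainTrialCost]
      have := Nat.mul_le_mul_right (stepCost n G j + 1) hcard
      omega
    have h2 : stepCost n G j + 1 ≤ 241 * U ^ 4 := by rw [stepCost]; omega
    have h3 := Nat.mul_le_mul_left V h2
    have h4 : 159 * U ^ 4 ≤ V * (159 * U ^ 4) := Nat.le_mul_of_pos_left _ hVpos
    have h5 : V * (400 * U ^ 4) = V * (241 * U ^ 4) + V * (159 * U ^ 4) := by ring
    omega
  have hd : degreeTrialCost n G j + 4 * degreeLen N n j + 5 ≤ 100 * U ^ 4 := by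
    have h1 : degreeTrialCost n G j ≤ U * (U * (3 * U + 6 * U + 25) + 10) + 10 := by
      rw [degreeTrialCost]; gcongr; omega
    nlinarith
  have hdt : degreeTrials N j ≤ 128 * U ^ 2 := by
    calc degreeTrials N j ≤ 8 * (8 * U) * (2 * U) := by
          rw [degreeTrials]; gcongr; omega
      _ = _ := by ring
  have hN' : stageCost N n G j ≤ mainTrials N j * (V * (400 * U ^ 4)) +
      128 * U ^ 2 * (100 * U ^ 4) + 100 * U ^ 4 := by
    rw [stageCost]
    refine add_le_add (add_le_add (Nat.mul_le_mul_left _ hm) (Nat.mul_le_mul hdt hd)) ?_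
    omega
  have hr : (1 : ℝ) ≤ rate ^ j := one_le_pow₀ one_le_rate
  have hT := mainTrials_mul_choose_le N j
  have hUr : (1 : ℝ) ≤ U := by exact_mod_cast (by omega : 1 ≤ U)
  have hjr : (j : ℝ) + 2 ≤ U := by exact_mod_cast hj
  have hfr : (fieldBits N j : ℝ) ≤ 8 * U := by exact_mod_cast hfb
  have hpr : (U : ℝ) ^ 4 ≤ (U : ℝ) ^ 6 := pow_le_pow_right₀ hUr (by norm_num)
  have hr0 : 0 ≤ rate ^ j := by linarith
  have hfirst : (mainTrials N j : ℝ) * V ≤ 4096 * (U : ℝ) ^ 2 * rate ^ j := by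
    calc (mainTrials N j : ℝ) * V = 4 * ((j : ℝ) + 2) *
          ((mainTrials N j : ℝ) * (j + j / 2).choose j) := by rw [hV]; push_cast; ring
      _ ≤ 4 * U * (128 * (8 * U) * rate ^ j) := by
          refine mul_le_mul (mul_le_mul_of_nonneg_left hjr (by norm_num))
            (hT.trans ?_) (by positivity) (by positivity)
          gcongr
      _ = _ := by ring
  calc (stageCost N n G j : ℝ) ≤ ((mainTrials N j * (V * (400 * U ^ 4)) +
      128 * U ^ 2 * (100 * U ^ 4) + 100 * U ^ 4 : ℕ) : ℝ) := by exact_mod_cast hN'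
    _ = (mainTrials N j : ℝ) * V * (400 * (U : ℝ) ^ 4) + 12800 * (U : ℝ) ^ 6 +
        100 * (U : ℝ) ^ 4 := by push_cast; ring
    _ ≤ 4096 * (U : ℝ) ^ 2 * rate ^ j * (400 * (U : ℝ) ^ 4) + 12800 * (U : ℝ) ^ 6 * rate ^ j +
        100 * (U : ℝ) ^ 6 * rate ^ j := by
        refine add_le_add (add_le_add (mul_le_mul_of_nonneg_right hfirst (by positivity))
          (le_mul_of_one_le_right (by positivity) hr)) ?_
        calc 100 * (U : ℝ) ^ 4 ≤ 100 * (U : ℝ) ^ 6 := by linarith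
          _ ≤ _ := le_mul_of_one_le_right (by positivity) hr
    _ = 1651300 * ((U : ℝ) ^ 6 * rate ^ j) := by ring
    _ ≤ 10 ^ 7 * ((U : ℝ) ^ 6 * rate ^ j) := by
        refine mul_le_mul_of_nonneg_right (by norm_num) (by positivity)
    _ = _ := by ring

/-- Polynomial factors are absorbed by the gap between the rates. -/
theorem exists_pow_mul_rate_pow_le (d : ℕ) :
    ∃ C : ℕ, ∀ k : ℕ, ((k : ℝ) + 2) ^ d * rate ^ k ≤ C * (4.08 : ℝ) ^ k := by
  have hr0 : 0 < rate := by linarith [one_le_rate]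
  have hlim := tendsto_pow_const_mul_const_pow_of_abs_lt_one d (r := rate / 4.08) (by
    rw [abs_of_pos (by positivity), div_lt_one (by norm_num)]
    exact rate_lt)
  have hlim2 := (Filter.tendsto_add_atTop_iff_nat 2).2 hlim
  obtain ⟨B, hB⟩ := hlim2.bddAbove_range
  obtain ⟨C, hC⟩ := exists_nat_ge (B * (4.08 / rate) ^ 2)
  refine ⟨C, fun k => ?_⟩
  have h := hB ⟨k, rfl⟩
  dsimp only at h
  push_cast at h
  have h2 : ((k : ℝ) + 2) ^ d * (rate / 4.08) ^ k ≤ C := by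
    refine le_trans ?_ hC
    calc ((k : ℝ) + 2) ^ d * (rate / 4.08) ^ k =
        ((k : ℝ) + 2) ^ d * (rate / 4.08) ^ (k + 2) * (4.08 / rate) ^ 2 := by
          rw [pow_add]; field_simp
      _ ≤ _ := mul_le_mul_of_nonneg_right h (by positivity)
  calc ((k : ℝ) + 2) ^ d * rate ^ k =
      ((k : ℝ) + 2) ^ d * (rate / 4.08) ^ k * (4.08 : ℝ) ^ k := by
        rw [mul_assoc, ← mul_pow]; congr 2; field_simp
    _ ≤ _ := mul_le_mul_of_nonneg_right h2 (by positivity)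

/-! ### The theorem -/

/-- The algorithm for the complement of monomial ideal membership. -/
def monomialTest : Algorithm := ⟨64, mainProg⟩

/-- A bound for the number of steps of the algorithm. -/
noncomputable def stepBound (U k : ℕ) : ℝ := 2 * 10 ^ 7 * (U : ℝ) ^ 7 * rate ^ k

/-- The total degree enters only the analysis: it determines the word length `W` and the last
possible stage, for every coin sequence. -/
theorem monomialTest_halts {n s : ℕ} (C : Circuit n (s + 1)) (e : Fin n → ℕ) (ω : ℕ → Bool) :
    ∃ t : State, monomialTest.Halts (encodeInput C e) ω t ∧
      (t.time : ℝ) ≤ stepBound (bitLength (encodeInput C e) + C.poly.totalDegree + 2)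
        C.poly.totalDegree * (mainProg.weight *
          ((100 * (bitLength (encodeInput C e) + C.poly.totalDegree + 2) ^ 3 + 1) ^ 2 : ℕ)) ∧
      t.space ≤ 64 * (64 + 100 * (bitLength (encodeInput C e) + C.poly.totalDegree + 2) ^ 3) +
        bitLength (encodeInput C e) * (64 + bitLength (encodeInput C e)) +
        bitLength (encodeInput C e) + mainProg.weight *
          (100 * (bitLength (encodeInput C e) + C.poly.totalDegree + 2) ^ 3 + 1) ^ 2 ∧
      ∃ J, ¬ DegreeFlag (evalSeq C.poly) (bitLength (encodeInput C e)) n J ω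
          (stageOffset (bitLength (encodeInput C e)) n J) ∧
        (t.mem 0 ≠ 0 ↔ (∃ j ≤ J, MainFlag (evalSeq C.poly) (inputCell (encodeInput C e))
          (bitLength (encodeInput C e)) n j ω (stageOffset (bitLength (encodeInput C e)) n j)) ∧
          ∀ i < n, inputCell (encodeInput C e) (66 + i) ≠ 0) := by
  obtain ⟨w, hw⟩ : ∃ w, w = encodeInput C e := ⟨_, rfl⟩
  have hcomp := computes_encodeInput C e
  have hvar := inputCell_variables C e
  have hgates := inputCell_gates C e
  have hlen := length_encodeInput C e
  rw [← hw] at hcomp hvar hgates hlen ⊢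
  have hlenN := length_le_bitLength w
  have hNsum := bitLength_eq w
  rw [hlen] at hlenN hNsum
  have hlt := inputCell_lt w
  obtain ⟨N, hN⟩ : ∃ N, N = bitLength w := ⟨_, rfl⟩
  have hmem := fun W μ => memBits_le (W := W) (w := w) (μ := μ)
  rw [← hN] at hlenN hNsum hlt hmem ⊢
  obtain ⟨k, hk⟩ : ∃ k, k = C.poly.totalDegree := ⟨_, rfl⟩
  rw [← hk]
  obtain ⟨U, hU⟩ : ∃ U, U = N + k + 2 := ⟨_, rfl⟩
  rw [← hU]
  obtain ⟨W, hW⟩ : ∃ W, W = 100 * U ^ 3 := ⟨_, rfl⟩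
  rw [← hW]
  have hUpos : 1 ≤ U := by omega
  have hU3 : U ≤ U ^ 3 := Nat.le_self_pow (by norm_num) U
  have hpow : ∀ {x}, x ≤ W → x < 2 ^ W := fun h => h.trans_lt Nat.lt_two_pow_self
  have hltW : ∀ a, inputCell w a < 2 ^ W := fun a =>
    (hlt a).trans_le (Nat.pow_le_pow_right (by norm_num) (by omega))
  have hloadW : ∀ a, loadMem 64 w a < 2 ^ W := hltW
  have hrate := one_le_rate
  have hTS : ∀ j ≤ k, stageCost N n (s + 1) j ≤ ⌊10 ^ 7 * (U : ℝ) ^ 6 * rate ^ k⌋₊ := by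
    intro j hj
    refine Nat.le_floor ((stageCost_le (U := U) (by omega) (by omega) (by omega)
      (by omega)).trans ?_)
    have := pow_le_pow_right₀ hrate hj
    gcongr
  obtain ⟨m', c', T, hrun, hT, J, -, -, hJ, hacc⟩ := mainProg_ht (W := W) (ω := ω)
    (m := loadMem 64 w) (inp := inputCell w) (k := k) (N := N)
    (fun a _ => rfl) (by rw [loadMem_apply, if_neg (by norm_num)]) hvar hgates hNsum
    (fun a _ => hltW a) (hpow (by omega)) hcomp
    (fun j hj => by
      rw [hW, hU]
      exact stageBounds hj hlenN (Nat.succ_pos s) hlt)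
    hTS (fun ρ => not_degreeGood hk.ge _ ρ)
  obtain ⟨t, hexec, hmem', -, htime, hspace⟩ := hrun.exec (m₀ := inputCell w)
    (S := 64 * (64 + W) + N * (64 + N) + N) (fun μ h1 h2 => hmem W μ h1 h2) le_rfl hloadW
    (fun a _ => rfl) (monomialTest.init w) rfl rfl
  generalize mainProg.weight = v at htime hspace ⊢
  refine ⟨t, hexec, ?_, ?_, J, hJ, by rw [← hacc, ← hmem']⟩
  · clear hrun hexec hspace hacc
    have hTr : (T : ℝ) ≤ stepBound U k := by
      have h1 : (⌊10 ^ 7 * (U : ℝ) ^ 6 * rate ^ k⌋₊ : ℝ) ≤ 10 ^ 7 * (U : ℝ) ^ 6 * rate ^ k :=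
        Nat.floor_le (by positivity)
      have hr : (1 : ℝ) ≤ rate ^ k := one_le_pow₀ hrate
      have hUr : (1 : ℝ) ≤ U := by exact_mod_cast hUpos
      have h2 : (2 + n + 3 * (s + 1)) * (3 * W + 7) + 4 * n + 14 ≤ 400 * U ^ 4 := by
        have h3 : 1 ≤ U ^ 4 := Nat.one_le_pow _ _ hUpos
        have h4 : U ≤ U ^ 4 := Nat.le_self_pow (by norm_num) U
        calc _ ≤ U * (3 * W + 7) + 4 * U + 14 := by
              have := Nat.mul_le_mul_right (3 * W + 7) (show 2 + n + 3 * (s + 1) ≤ U by omega)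
              omega
          _ = 300 * U ^ 4 + 11 * U + 14 := by rw [hW]; ring
          _ ≤ _ := by omega
      have h5 : (T : ℝ) ≤ ((k : ℝ) + 1) * (⌊10 ^ 7 * (U : ℝ) ^ 6 * rate ^ k⌋₊ + 1) +
          400 * (U : ℝ) ^ 4 := by
        exact_mod_cast hT.trans (Nat.add_le_add_left h2 _)
      have h6 : (k : ℝ) + 1 ≤ U := by exact_mod_cast (by omega : k + 1 ≤ U)
      have h7 : (U : ℝ) ≤ (U : ℝ) ^ 7 * rate ^ k :=
        (le_self_pow₀ hUr (by norm_num)).trans (le_mul_of_one_le_right (by positivity) hr)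
      have h8 : (U : ℝ) ^ 4 ≤ (U : ℝ) ^ 7 * rate ^ k :=
        (pow_le_pow_right₀ hUr (by norm_num)).trans (le_mul_of_one_le_right (by positivity) hr)
      calc (T : ℝ) ≤ U * (10 ^ 7 * (U : ℝ) ^ 6 * rate ^ k + 1) + 400 * (U : ℝ) ^ 4 := by
            exact h5.trans (add_le_add (mul_le_mul h6 (add_le_add h1 le_rfl) (by positivity)
              (by positivity)) le_rfl)
        _ = 10 ^ 7 * ((U : ℝ) ^ 7 * rate ^ k) + U + 400 * (U : ℝ) ^ 4 := by ring
        _ ≤ 2 * 10 ^ 7 * ((U : ℝ) ^ 7 * rate ^ k) := by linarith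
        _ = _ := by rw [stepBound]; ring
    have h9 : t.time ≤ T * (v * (W + 1) ^ 2) := by
      have : (monomialTest.init w).time = 0 := rfl
      omega
    calc (t.time : ℝ) ≤ ((T * (v * (W + 1) ^ 2) : ℕ) : ℝ) := by exact_mod_cast h9
      _ = T * (v * ((W + 1) ^ 2 : ℕ)) := by push_cast; ring
      _ ≤ _ := mul_le_mul_of_nonneg_right hTr (by positivity)
  · refine hspace.trans (max_le ?_ le_rfl)
    exact (hmem W (loadMem 64 w) (fun a _ => rfl) hloadW).trans (Nat.le_add_right _ _)

theorem monomialTest_not_accepts {n s : ℕ} (C : Circuit n (s + 1)) (e : Fin n → ℕ)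
    (ω : ℕ → Bool) (h : C.poly ∈ Ideal.span
      (Set.range fun i : Fin n => (MvPolynomial.X i : MvPolynomial (Fin n) ℤ) ^ e i)) :
    ¬ monomialTest.Accepts (encodeInput C e) ω := by
  rintro ⟨t, ht, hne⟩
  obtain ⟨t', ht', -, -, J, -, hacc⟩ := monomialTest_halts C e ω
  -- Acceptance speaks of some halting state; determinism identifies it with the one analysed.
  obtain rfl := ht.deterministic ht'
  obtain ⟨⟨j, -, l, -, hgood⟩, he⟩ := hacc.1 hne
  refine not_mainGood _ _ _ he (fun α hα => ?_) hgood
  simp only [inputCell_exponent]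
  exact mem_span_X_pow_iff.1 h α hα

theorem le_acceptProb_monomialTest {n s : ℕ} (C : Circuit n (s + 1)) (e : Fin n → ℕ)
    (h : C.poly ∉ Ideal.span
      (Set.range fun i : Fin n => (MvPolynomial.X i : MvPolynomial (Fin n) ℤ) ^ e i)) :
    2 / 3 ≤ monomialTest.acceptProb (encodeInput C e) := by
  rw [mem_span_X_pow_iff] at h
  push Not at h
  obtain ⟨a, haf, hai⟩ := h
  set w := encodeInput C e with hw
  have hb := circuit_eval_bounds C (H := bitLength w) (fun x hx => by
    obtain ⟨i, hi, rfl⟩ := List.mem_iff_getElem.1 hx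
    have := inputCell_gate C e i
    rw [List.getD_eq_getElem _ _ hi] at this
    rw [← this]
    exact inputCell_lt _ _) (Fin.last s)
  have hs : s ≤ bitLength w := by
    have := length_le_bitLength w
    rw [hw] at this ⊢
    rw [length_encodeInput] at this
    omega
  have hrej := coinMeasure_reject_le (inp := inputCell w) (N := bitLength w)
    (fun j _ => sizeBounds (j := j) hs hb.1 hb.2) haf
    (fun i => by rw [hw, inputCell_exponent]; exact hai i) (stageOffset (bitLength w) n)
  have hsub : {ω | monomialTest.Accepts w ω}ᶜ ⊆
      {ω | ∃ J, ¬ DegreeFlag (evalSeq C.poly) (bitLength w) n J ω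
        (stageOffset (bitLength w) n J) ∧ ∀ j ≤ J, ¬ MainFlag (evalSeq C.poly) (inputCell w)
          (bitLength w) n j ω (stageOffset (bitLength w) n j)} := by
    intro ω hω
    obtain ⟨t, ht, -, -, J, hJ, hacc⟩ := monomialTest_halts C e ω
    refine ⟨J, hJ, fun j hj hflag => hω ⟨t, ht, hacc.2 ⟨⟨j, hj, hflag⟩, fun i hi => ?_⟩⟩⟩
    have := inputCell_exponent C e ⟨i, hi⟩
    rw [this]
    exact (Nat.zero_le _).trans_lt (hai ⟨i, hi⟩) |>.ne'
  have hcompl := (measure_mono hsub).trans hrej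
  -- Subadditivity suffices here, so the acceptance event need not be measurable.
  have huniv : (1 : ℝ≥0∞) ≤ coinMeasure {ω | monomialTest.Accepts w ω} + 1 / 3 := by
    calc (1 : ℝ≥0∞) = coinMeasure ({ω | monomialTest.Accepts w ω} ∪
          {ω | monomialTest.Accepts w ω}ᶜ) := by rw [Set.union_compl_self, measure_univ]
      _ ≤ _ := (measure_union_le _ _).trans (add_le_add_right hcompl _)
  have h23 : (2 / 3 : ℝ≥0∞) + 1 / 3 = 1 := by
    rw [← ENNReal.add_div]
    norm_num
    exact ENNReal.div_self (by norm_num) (by norm_num)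
  exact (ENNReal.add_le_add_iff_right (by finiteness)).1 (h23.le.trans huniv)

end RAM

theorem theorem1p5 :
    ∃ (A : RAM.Algorithm) (c : ℕ), ∀ (n s : ℕ) (C : Circuit n (s + 1)) (e : Fin n → ℕ),
      (∀ ω : ℕ → Bool, ∃ t : RAM.State, A.Halts (encodeInput C e) ω t ∧
        (t.time : ℝ) ≤
          c * (4.08 : ℝ) ^ C.poly.totalDegree * (bitLength (encodeInput C e) : ℝ) ^ c ∧
        t.space ≤ c * (bitLength (encodeInput C e) + C.poly.totalDegree) ^ c) ∧
      (C.poly ∉ Ideal.span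
          (Set.range fun i : Fin n => (MvPolynomial.X i : MvPolynomial (Fin n) ℤ) ^ e i) →
        2 / 3 ≤ A.acceptProb (encodeInput C e)) ∧
      (C.poly ∈ Ideal.span
          (Set.range fun i : Fin n => (MvPolynomial.X i : MvPolynomial (Fin n) ℤ) ^ e i) →
        A.acceptProb (encodeInput C e) ≤ 1 / 3) := by
  -- `13 = 7 + 6`: the number of steps grows with `U^7`, and the cost of a step with the square of
  -- the cubic word length.
  obtain ⟨D, hD⟩ := RAM.exists_pow_mul_rate_pow_le 13
  obtain ⟨v, hv⟩ : ∃ v, v = RAM.mainProg.weight := ⟨_, rfl⟩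
  obtain ⟨K, hK⟩ : ∃ K, K = 2 * 10 ^ 7 * 10201 * v := ⟨_, rfl⟩
  -- `K * D` serves the time bound, the middle summand the space bound, and `13` makes `c` large
  -- enough as an exponent.
  obtain ⟨c, hc⟩ : ∃ c, c = K * D + 64 * (20000 + 10201 * v) + 13 := ⟨_, rfl⟩
  refine ⟨RAM.monomialTest, c, fun n s C e => ⟨fun ω => ?_, RAM.le_acceptProb_monomialTest C e,
    fun h => ?_⟩⟩
  · obtain ⟨t, ht, htime, hspace, -⟩ := RAM.monomialTest_halts C e ω
    refine ⟨t, ht, ?_, ?_⟩ <;>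
    · have hN2 : 2 ≤ bitLength (encodeInput C e) := by
        have := RAM.length_le_bitLength (encodeInput C e)
        rw [length_encodeInput] at this
        omega
      clear ht
      revert htime hspace hN2
      generalize bitLength (encodeInput C e) = N
      generalize C.poly.totalDegree = k
      rw [← hv]
      clear hv
      intro htime hspace hN2
      obtain ⟨U, hU⟩ : ∃ U, U = N + k + 2 := ⟨_, rfl⟩
      rw [← hU] at htime hspace
      have hU1 : 1 ≤ U := by omega
      have hW : (100 * U ^ 3 + 1) ^ 2 ≤ 10201 * U ^ 6 := by
        calc (100 * U ^ 3 + 1) ^ 2 ≤ (101 * U ^ 3) ^ 2 := by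
              have := Nat.one_le_pow 3 U hU1
              exact Nat.pow_le_pow_left (by omega) 2
          _ = _ := by ring
      first
      -- From `N ≥ 2`, the sum `U = N + (k + 2)` is at most a product, which separates the power of
      -- `N` from the power of `k + 2` that is absorbed into `4.08^k`.
      | have hUN : U ≤ N * (k + 2) := by rw [hU, add_assoc]; exact add_le_mul hN2 (by omega)
        have hUN' : (U : ℝ) ≤ N * (k + 2) := by exact_mod_cast hUN
        have hWr : (((100 * U ^ 3 + 1) ^ 2 : ℕ) : ℝ) ≤ 10201 * (U : ℝ) ^ 6 := by
          exact_mod_cast hW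
        have hr := RAM.one_le_rate
        have hKD : (K * D : ℝ) ≤ c := by exact_mod_cast (by omega : K * D ≤ c)
        have hN1 : (1 : ℝ) ≤ N := by exact_mod_cast (by omega : 1 ≤ N)
        calc (t.time : ℝ) ≤ RAM.stepBound U k * (v * (10201 * (U : ℝ) ^ 6)) := by
              refine htime.trans ?_
              unfold RAM.stepBound
              gcongr
          _ = K * (U : ℝ) ^ 13 * RAM.rate ^ k := by
              rw [RAM.stepBound, hK]; push_cast; ring
          _ ≤ K * ((N : ℝ) * (k + 2)) ^ 13 * RAM.rate ^ k := by gcongr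
          _ = K * (N : ℝ) ^ 13 * (((k : ℝ) + 2) ^ 13 * RAM.rate ^ k) := by ring
          _ ≤ K * (N : ℝ) ^ 13 * (D * (4.08 : ℝ) ^ k) := by
              exact mul_le_mul_of_nonneg_left (hD k) (by positivity)
          _ = K * D * (4.08 : ℝ) ^ k * (N : ℝ) ^ 13 := by ring
          _ ≤ c * (4.08 : ℝ) ^ k * (N : ℝ) ^ c := by
              have : (N : ℝ) ^ 13 ≤ (N : ℝ) ^ c := pow_le_pow_right₀ hN1 (by omega)
              gcongr
      | have hUN : U ≤ 2 * (N + k) := by omega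
        have p0 : 1 ≤ U ^ 6 := Nat.one_le_pow _ _ hU1
        have p1 : U ≤ U ^ 6 := Nat.le_self_pow (by norm_num) U
        have p3 : U ^ 3 ≤ U ^ 6 := Nat.pow_le_pow_right hU1 (by norm_num)
        have p2 : N * (64 + N) ≤ 65 * U ^ 6 := by
          calc N * (64 + N) ≤ U * (65 * U) := Nat.mul_le_mul (by omega) (by omega)
            _ = 65 * U ^ 2 := by ring
            _ ≤ _ := Nat.mul_le_mul_left _ (Nat.pow_le_pow_right hU1 (by norm_num))
        calc t.space ≤ 20000 * U ^ 6 + v * (10201 * U ^ 6) := by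
              have := Nat.mul_le_mul_left v hW
              omega
          _ = (20000 + 10201 * v) * U ^ 6 := by ring
          _ ≤ (20000 + 10201 * v) * (2 * (N + k)) ^ 6 :=
              Nat.mul_le_mul_left _ (Nat.pow_le_pow_left hUN 6)
          _ = 64 * (20000 + 10201 * v) * (N + k) ^ 6 := by ring
          _ ≤ c * (N + k) ^ c := Nat.mul_le_mul (by omega)
              (Nat.pow_le_pow_right (by omega) (by omega))
  · have h0 : {ω | RAM.monomialTest.Accepts (encodeInput C e) ω} = ∅ :=
      Set.eq_empty_of_forall_notMem fun ω hω => RAM.monomialTest_not_accepts C e ω h hω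
    rw [RAM.Algorithm.acceptProb, h0]
    simp
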